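/- Let $(M^{2m},g,J)$ be a compact Kähler manifold (for instance a compact negative Kähler–Einstein manifold; no Einstein condition is needed), i.e. $J$ is a smooth almost complex structure which is orthogonal for the Riemannian metric $g$ and parallel for its Levi-Civita connection $\nabla$. Let $\mathrm{Sym}^{2,-}TM$ be the bundle of $g$-symmetric endomorphisms $h$ of $TM$ with $hJ=-Jh$. *Conventions.* For $h\in\Gamma(\mathrm{End}\,TM)=\Omega^1(M,TM)$ put $d_\nabla h(X,Y)=(\nabla_Xh)Y-(\nabla_Yh)X$, and let $\delta=-\sum_i e_i\lrcorner\nabla_{e_i}:\Omega^k(M,TM)\to\Omega^{k-1}(M,TM)$ be the divergence. The products $\langle\cdot,\cdot\rangle_{L^2}$ are taken with respect to the Riemannian volume and the pointwise products $\langle A,B\rangle=\sum_i g(Ae_i,Be_i)$ on $\mathrm{End}(TM)$ and $\langle\alpha,\beta\rangle=\sum_{i<j}g(\alpha(e_i,e_j),\beta(e_i,e_j))$ on $\Lambda^2(M,TM)$. Put $\{h,k\}=hk+kh$. The Frölicher–Nijenhuis bracket is the symmetric bracket obtained by polarisation, $2[h,k]^{FN}=[h+k,h+k]^{FN}-[h,h]^{FN}-[k,k]^{FN}$,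 from $$[h,h]^{FN}(X,Y)=-h^2[X,Y]+h([hX,Y]+[X,hY])-[hX,hY].$$ Let $\lambda^2(M,TM)=\{\alpha\in\Lambda^2(M,TM):\alpha(J\cdot,J\cdot)=-\alpha\}$ and $\lambda^2_-(M,TM)=\{\gamma\in\lambda^2(M,TM):\gamma(X,JY)=-J\gamma(X,Y)\}$. The Kodaira–Spencer bracket $[h,k]^c$ of $h,k\in\Gamma(\mathrm{Sym}^{2,-}TM)$ is the component of $[h,k]^{FN}$ in $\lambda^2_-(M,TM)$: if $\alpha=[h,k]^{FN}$ and $2\gamma(X,Y)=\alpha(X,Y)-\alpha(JX,JY)$, then $2[h,k]^c(X,Y)=\gamma(X,Y)+J\gamma(X,JY)$. Put $\bar\partial h=\tfrac12\big(d_\nabla h-d_\nabla h(J\cdot,J\cdot)\big)$. Finally let $$\mathbf v(h_1,h_2,h_3)=\langle\mathbf v(h_1,h_2),h_3\rangle_{L^2}:=\mathfrak S_{abc}\,\langle\delta[h_a,h_b]^{FN},h_c\rangle_{L^2},$$ where $\mathfrak S_{abc}$ is the sum over the three cyclic permutations $(a,b,c)$ of $(1,2,3)$. **Proposition.** For all smooth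 sections $h_1,h_2,h_3$ of $\mathrm{Sym}^{2,-}TM$, $$\mathbf v(h_1,h_2,h_3)=2\,\mathfrak S_{abc}\,\langle[h_a,h_b]^c,\bar\partial h_c\rangle_{L^2}-\tfrac12\,\mathfrak S_{abc}\,\langle\delta\{h_a,h_b\},\delta h_c\rangle_{L^2}.$$ -/

import Mathlib

open Bundle Manifold MeasureTheory FiberBundle VectorField
open scoped ContDiff Topology

namespace Kaehler

section Operators

variable {E : Type*} [NormedAddCommGroup E] [NormedSpace ℝ E] [FiniteDimensional ℝ E]
  {H : Type*} [TopologicalSpace H] (I : ModelWithCorners ℝ E H)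
  {M : Type*} [TopologicalSpace M] [ChartedSpace H M] [IsManifold I ∞ M]
  [RiemannianBundle (fun x : M => TangentSpace I x)]

instance finiteDimensional_tangentSpace (x : M) : FiniteDimensional ℝ (TangentSpace I x) :=
  inferInstanceAs (FiniteDimensional ℝ E)

instance completeSpace_tangentSpace (x : M) : CompleteSpace (TangentSpace I x) :=
  FiniteDimensional.complete ℝ (TangentSpace I x)

/-- One half of the right-hand side of the Koszul formula. -/
noncomputable def koszul (X Y Z : (x : M) → TangentSpace I x) (x : M) : ℝ :=
  (1 / 2 : ℝ) *
    (mvfderiv I (fun p => inner ℝ (Y p) (Z p)) x (X x)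
      + mvfderiv I (fun p => inner ℝ (X p) (Z p)) x (Y x)
      - mvfderiv I (fun p => inner ℝ (X p) (Y p)) x (Z x)
      + inner ℝ (mlieBracket I X Y x) (Z x)
      - inner ℝ (mlieBracket I X Z x) (Y x)
      - inner ℝ (mlieBracket I Y Z x) (X x))

variable [IsContMDiffRiemannianBundle I ∞ E (fun x : M => TangentSpace I x)]

variable {I}

theorem mdifferentiableAt_inner {x : M} {X Y : (x : M) → TangentSpace I x}
    (hX : MDiffAt (T% X) x) (hY : MDiffAt (T% Y) x) :
    MDifferentiableAt I 𝓘(ℝ, ℝ) (fun p => (inner ℝ (X p) (Y p) : ℝ)) x :=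
  MDifferentiableAt.inner_bundle (IB := I) (F := E) (E := fun x : M => TangentSpace I x)
    (b := fun x => x) hX hY

theorem mvfderiv_inner_add {x : M} {X X' Y Y' : (x : M) → TangentSpace I x}
    (hX : MDiffAt (T% X) x) (hX' : MDiffAt (T% X') x) (hY : MDiffAt (T% Y) x)
    (hY' : MDiffAt (T% Y') x) :
    mvfderiv I (fun p => (inner ℝ (X p) (Y p) : ℝ) + inner ℝ (X' p) (Y' p)) x
      = mvfderiv I (fun p => (inner ℝ (X p) (Y p) : ℝ)) x
        + mvfderiv I (fun p => (inner ℝ (X' p) (Y' p) : ℝ)) x :=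
  mvfderiv_fun_add (mdifferentiableAt_inner hX hY) (mdifferentiableAt_inner hX' hY')

theorem mvfderiv_inner_smul {x : M} {f : M → ℝ} {X Y : (x : M) → TangentSpace I x}
    (hf : MDiffAt f x) (hX : MDiffAt (T% X) x) (hY : MDiffAt (T% Y) x) (u : TangentSpace I x) :
    mvfderiv I (fun p => f p * (inner ℝ (X p) (Y p) : ℝ)) x u
      = f x * mvfderiv I (fun p => (inner ℝ (X p) (Y p) : ℝ)) x u
        + mvfderiv I f x u * inner ℝ (X x) (Y x) := by
  rw [mvfderiv_fun_mul hf (mdifferentiableAt_inner hX hY)]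
  simp
  ring

theorem koszul_tensorial_left {x : M} {Y Z : (x : M) → TangentSpace I x}
    (hY : MDiffAt (T% Y) x) (hZ : MDiffAt (T% Z) x) :
    TensorialAt I E (fun X => koszul I X Y Z x) x where
  smul {f X} hf hX := by
    simp only [koszul, Pi.smul_apply', mvfderiv_inner_smul hf hX hY,
      mvfderiv_inner_smul hf hX hZ, mlieBracket_smul_left hf hX, inner_add_left,
      real_inner_smul_left, real_inner_smul_right, map_smul, smul_eq_mul]
    ring
  add {X X'} hX hX' := by
    simp only [koszul, Pi.add_apply, mvfderiv_inner_add hX hX' hY hY,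
      mvfderiv_inner_add hX hX' hZ hZ, mlieBracket_add_left hX hX', inner_add_left,
      inner_add_right, map_add, add_apply]
    ring

theorem koszul_tensorial_right {x : M} {X Y : (x : M) → TangentSpace I x}
    (hX : MDiffAt (T% X) x) (hY : MDiffAt (T% Y) x) :
    TensorialAt I E (fun Z => koszul I X Y Z x) x where
  smul {f Z} hf hZ := by
    simp only [koszul, Pi.smul_apply', mvfderiv_inner_smul hf hY hZ,
      mvfderiv_inner_smul hf hX hZ, mlieBracket_smul_right hf hZ, inner_add_left,
      real_inner_smul_left, real_inner_smul_right, map_smul, smul_eq_mul]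
    rw [real_inner_comm (Z x) (X x), real_inner_comm (Z x) (Y x)]
    ring
  add {Z Z'} hZ hZ' := by
    simp only [koszul, Pi.add_apply, mvfderiv_inner_add hY hY hZ hZ',
      mvfderiv_inner_add hX hX hZ hZ', mlieBracket_add_right hZ hZ', inner_add_left,
      inner_add_right, map_add, add_apply]
    ring

/-- The bilinear form `(u, w) ↦ g(∇_u Y, w)` on the tangent space at `x`. -/
noncomputable def koszulForm (Y : (x : M) → TangentSpace I x) (x : M) (hY : MDiffAt (T% Y) x) :
    TangentSpace I x →L[ℝ] TangentSpace I x →L[ℝ] ℝ :=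
  TensorialAt.mkHom₂ (I := I) (F := E) (F' := E) (fun X Z => koszul I X Y Z x) x
    (fun _ hZ => koszul_tensorial_left hY hZ) (fun _ hX => koszul_tensorial_right hX hY)

theorem koszulForm_apply {X Y Z : (x : M) → TangentSpace I x} {x : M} (hX : MDiffAt (T% X) x)
    (hY : MDiffAt (T% Y) x) (hZ : MDiffAt (T% Z) x) :
    koszulForm Y x hY (X x) (Z x) = koszul I X Y Z x :=
  TensorialAt.mkHom₂_apply _ _ hX hZ

theorem koszulForm_add {Y Y' : (x : M) → TangentSpace I x} {x : M}
    (hY : MDiffAt (T% Y) x) (hY' : MDiffAt (T% Y') x) (hYY' : MDiffAt (T% (Y + Y')) x)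
    (u w : TangentSpace I x) :
    koszulForm (Y + Y') x hYY' u w = koszulForm Y x hY u w + koszulForm Y' x hY' u w := by
  have hU := mdifferentiableAt_extend I E u
  have hW := mdifferentiableAt_extend I E w
  have h := koszulForm_apply hU hYY' hW
  have h1 := koszulForm_apply hU hY hW
  have h2 := koszulForm_apply hU hY' hW
  simp only [extend_apply_self] at h h1 h2
  rw [h, h1, h2]
  simp only [koszul, Pi.add_apply, mvfderiv_inner_add hY hY' hW hW,
    mvfderiv_inner_add hU hU hY hY', mlieBracket_add_left hY hY',
    mlieBracket_add_right hY hY', inner_add_left, inner_add_right, map_add,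
    add_apply]
  ring

theorem koszulForm_smul {f : M → ℝ} {Y : (x : M) → TangentSpace I x} {x : M}
    (hf : MDiffAt f x) (hY : MDiffAt (T% Y) x) (hfY : MDiffAt (T% (f • Y)) x)
    (u w : TangentSpace I x) :
    koszulForm (f • Y) x hfY u w
      = f x * koszulForm Y x hY u w + mvfderiv I f x u * inner ℝ (Y x) w := by
  have hU := mdifferentiableAt_extend I E u
  have hW := mdifferentiableAt_extend I E w
  have h := koszulForm_apply hU hfY hW
  have h1 := koszulForm_apply hU hY hW
  simp only [extend_apply_self] at h h1
  rw [h, h1]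
  simp only [koszul, Pi.smul_apply', mvfderiv_inner_smul hf hY hW,
    mvfderiv_inner_smul hf hU hY, mlieBracket_smul_left hf hY,
    mlieBracket_smul_right hf hY, inner_add_left, real_inner_smul_left, real_inner_smul_right,
    map_smul, smul_eq_mul, extend_apply_self]
  rw [real_inner_comm u (Y x)]
  ring

open Classical in
variable (I M) in
/-- The Levi-Civita connection of the Riemannian metric on `M`, given by the Koszul formula (with
the junk value `0` on vector fields that are not differentiable at the point). -/
noncomputable def leviCivita : CovariantDerivative I E (fun x : M => TangentSpace I x) where
  toFun Y x :=
    if hY : MDiffAt (T% Y) x then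
      LinearMap.toContinuousLinearMap
        { toFun := fun u =>
            (InnerProductSpace.toDual ℝ (TangentSpace I x)).symm (koszulForm Y x hY u)
          map_add' := fun u v => by simp
          map_smul' := fun r u => by simp }
    else 0
  isCovariantDerivativeOnUniv :=
    { add := by
        intro Y Y' x hY hY' _
        have hYY' : MDiffAt (T% (Y + Y')) x := mdifferentiableAt_add_section hY hY'
        ext1 u
        refine ext_inner_right ℝ fun w => ?_
        simp only [hY, hY', hYY', dite_true, LinearMap.coe_toContinuousLinearMap',
          LinearMap.coe_mk, AddHom.coe_mk, add_apply, inner_add_left,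
          InnerProductSpace.toDual_symm_apply]
        exact koszulForm_add hY hY' hYY' u w
      leibniz := by
        intro Y f x hY hf _
        have hfY : MDiffAt (T% (f • Y)) x := hf.smul_section hY
        ext1 u
        refine ext_inner_right ℝ fun w => ?_
        simp only [hY, hfY, dite_true, LinearMap.coe_toContinuousLinearMap',
          LinearMap.coe_mk, AddHom.coe_mk, add_apply, inner_add_left,
          smul_apply, real_inner_smul_left,
          ContinuousLinearMap.smulRight_apply, InnerProductSpace.toDual_symm_apply]
        exact koszulForm_smul hf hY hfY u w }

theorem inner_leviCivita {X Y Z : (x : M) → TangentSpace I x} {x : M} (hX : MDiffAt (T% X) x)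
    (hY : MDiffAt (T% Y) x) (hZ : MDiffAt (T% Z) x) :
    inner ℝ (leviCivita I M Y x (X x)) (Z x) = koszul I X Y Z x := by
  rw [← koszulForm_apply hX hY hZ]
  simp [leviCivita, hY]

theorem leviCivita_torsion : (leviCivita I M).torsion = 0 := by
  rw [CovariantDerivative.torsion_eq_zero_iff]
  intro X Y x hX hY
  refine ext_inner_right ℝ fun w => ?_
  have hW := mdifferentiableAt_extend I E w
  have h1 := inner_leviCivita hX hY hW
  have h2 := inner_leviCivita hY hX hW
  simp only [extend_apply_self] at h1 h2
  rw [inner_sub_left, h1, h2]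
  have e : (fun p => (inner ℝ (Y p) (X p) : ℝ)) = fun p => inner ℝ (X p) (Y p) :=
    funext fun p => real_inner_comm _ _
  simp only [koszul, e, mlieBracket_swap_apply (V := Y) (W := X), inner_neg_left,
    extend_apply_self]
  ring

theorem leviCivita_metric {X Y Z : (x : M) → TangentSpace I x} {x : M} (hX : MDiffAt (T% X) x)
    (hY : MDiffAt (T% Y) x) (hZ : MDiffAt (T% Z) x) :
    mvfderiv I (fun p => (inner ℝ (Y p) (Z p) : ℝ)) x (X x)
      = inner ℝ (leviCivita I M Y x (X x)) (Z x) + inner ℝ (Y x) (leviCivita I M Z x (X x)) := by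
  rw [real_inner_comm _ (Y x), inner_leviCivita hX hY hZ, inner_leviCivita hX hZ hY]
  have e : (fun p => (inner ℝ (Z p) (Y p) : ℝ)) = fun p => inner ℝ (Y p) (Z p) :=
    funext fun p => real_inner_comm _ _
  simp only [koszul, e, mlieBracket_swap_apply (V := Z) (W := Y), inner_neg_left]
  ring


variable (I M)

/-- (Not necessarily smooth) vector fields on `M`. -/
abbrev VecField : Type _ := (x : M) → TangentSpace I x

/-- (Not necessarily smooth) sections of `End(TM) = Λ¹(M, TM)`. -/
abbrev EndField : Type _ := (x : M) → TangentSpace I x →L[ℝ] TangentSpace I x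

/-- `TM`-valued `2`-tensors on `M`, written as functions of two tangent vectors. Those which occur
below are bilinear and alternating, that is, sections of `Λ²(M, TM)`. -/
abbrev TwoTensor : Type _ := (x : M) → TangentSpace I x → TangentSpace I x → TangentSpace I x

variable {I M}

/-- Smoothness of a section of `End(TM)`. -/
def SmoothEnd (h : EndField I M) : Prop :=
  ContMDiff I (I.prod 𝓘(ℝ, E →L[ℝ] E)) ∞
    (fun x => TotalSpace.mk' (E →L[ℝ] E)
      (E := fun x : M => TangentSpace I x →L[ℝ] TangentSpace I x) x (h x))

/-- A vector field, smooth near `x`, with the value `v` at `x`. -/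
noncomputable def extendVec {x : M} (v : TangentSpace I x) : VecField I M :=
  FiberBundle.extend E (E := fun x : M => TangentSpace I x) v

/-- An orthonormal basis of the tangent space at `x`. -/
noncomputable def orthoFrame (x : M) :
    OrthonormalBasis (Fin (Module.finrank ℝ (TangentSpace I x))) ℝ (TangentSpace I x) :=
  stdOrthonormalBasis ℝ (TangentSpace I x)

/-! ### Covariant derivatives, exterior differential and divergence -/

/-- `(∇_u h) v` for a section `h` of `End(TM)`. -/
noncomputable def covEnd (h : EndField I M) (x : M) (u v : TangentSpace I x) : TangentSpace I x :=
  leviCivita I M (fun p => h p (extendVec v p)) x u - h x (leviCivita I M (extendVec v) x u)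

/-- `(∇_u α)(v, w)` for a section `α` of `Λ²(M, TM)`. -/
noncomputable def covTwo (α : TwoTensor I M) (x : M) (u v w : TangentSpace I x) :
    TangentSpace I x :=
  leviCivita I M (fun p => α p (extendVec v p) (extendVec w p)) x u
    - α x (leviCivita I M (extendVec v) x u) w - α x v (leviCivita I M (extendVec w) x u)

/-- The coupled exterior differential `d_∇ : Ω¹(M, TM) → Ω²(M, TM)`. -/
noncomputable def dNabla (h : EndField I M) : TwoTensor I M :=
  fun x u v => covEnd h x u v - covEnd h x v u

/-- The divergence `δ h = -∑ (∇_{e_i} h) e_i` from `Ω¹(M, TM)` to vector fields. -/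
noncomputable def divEnd (h : EndField I M) : VecField I M :=
  fun x => -∑ i, covEnd h x (orthoFrame x i) (orthoFrame x i)

/-- The divergence `δ α = -∑ (∇_{e_i} α)(e_i, ·)` from `Ω²(M, TM)` to `Ω¹(M, TM)`. -/
noncomputable def divTwo (α : TwoTensor I M) (x : M) (v : TangentSpace I x) : TangentSpace I x :=
  -∑ i, covTwo α x (orthoFrame x i) (orthoFrame x i) v

/-! ### Brackets -/

/-- The anti-commutator `{h, k} = h ∘ k + k ∘ h`. -/
noncomputable def antiComm (h k : EndField I M) : EndField I M :=
  fun x => (h x).comp (k x) + (k x).comp (h x)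

/-- The quadratic Frölicher-Nijenhuis bracket
`[h, h](X, Y) = -h²[X, Y] + h([hX, Y] + [X, hY]) - [hX, hY]`. -/
noncomputable def fnSquare (h : EndField I M) : TwoTensor I M :=
  fun x u v =>
    -(h x (h x (mlieBracket I (extendVec u) (extendVec v) x)))
      + h x (mlieBracket I (fun p => h p (extendVec u p)) (extendVec v) x
          + mlieBracket I (extendVec u) (fun p => h p (extendVec v p)) x)
      - mlieBracket I (fun p => h p (extendVec u p)) (fun p => h p (extendVec v p)) x

/-- The Frölicher-Nijenhuis bracket `[h, k]`, by polarisation. -/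
noncomputable def fnBracket (h k : EndField I M) : TwoTensor I M :=
  fun x u v => (1 / 2 : ℝ) • (fnSquare (h + k) x u v - fnSquare h x u v - fnSquare k x u v)

/-- The component in `λ²(M, TM) = {α : α(J·, J·) = -α}`. -/
noncomputable def lambdaPart (J : EndField I M) (α : TwoTensor I M) : TwoTensor I M :=
  fun x u v => (1 / 2 : ℝ) • (α x u v - α x (J x u) (J x v))

/-- The component of `γ ∈ λ²(M, TM)` in `λ²₋(M, TM) = {γ ∈ λ² : γ(X, JY) = -J γ(X, Y)}`. -/
noncomputable def lambdaMinusPart (J : EndField I M) (γ : TwoTensor I M) : TwoTensor I M :=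
  fun x u v => (1 / 2 : ℝ) • (γ x u v + J x (γ x u (J x v)))

/-- `∂̄h = ½ (d_∇ h - d_∇ h(J·, J·))`. -/
noncomputable def dbar (J h : EndField I M) : TwoTensor I M :=
  lambdaPart J (dNabla h)

/-- The Kodaira-Spencer bracket `[h, k]ᶜ`: the component of the Frölicher-Nijenhuis bracket in
`λ²₋(M, TM)`. -/
noncomputable def ksBracket (J h k : EndField I M) : TwoTensor I M :=
  lambdaMinusPart J (lambdaPart J (fnBracket h k))

/-! ### Kähler structures and the bundle `Sym^{2,-} TM` -/

/-- `(g, J)` is a Kähler structure: `J` is a smooth almost complex structure, orthogonal for the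
Riemannian metric `g` of `M` and parallel for its Levi-Civita connection. -/
structure IsKaehler (J : EndField I M) : Prop where
  smooth : SmoothEnd J
  sq : ∀ (x : M) (v : TangentSpace I x), J x (J x v) = -v
  orthogonal : ∀ (x : M) (u v : TangentSpace I x),
    (inner ℝ (J x u) (J x v) : ℝ) = inner ℝ u v
  parallel : ∀ (x : M) (u v : TangentSpace I x), covEnd J x u v = 0

/-- `h` is a smooth section of `Sym^{2,-} TM`: it is `g`-symmetric and anti-commutes with `J`. -/
structure IsSymAnti (J h : EndField I M) : Prop where
  smooth : SmoothEnd h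
  symm : ∀ (x : M) (u v : TangentSpace I x), (inner ℝ (h x u) v : ℝ) = inner ℝ u (h x v)
  anti : ∀ (x : M) (v : TangentSpace I x), h x (J x v) = -J x (h x v)

/-! ### Pointwise inner products -/

/-- `⟨A, B⟩ = ∑ g(A e_i, B e_i)` on `End(T_x M)`. -/
noncomputable def innerEnd (x : M) (A B : TangentSpace I x → TangentSpace I x) : ℝ :=
  ∑ i, inner ℝ (A (orthoFrame x i)) (B (orthoFrame x i))

/-- `⟨α, β⟩ = ∑_{i < j} g(α(e_i, e_j), β(e_i, e_j))` on `Λ²(T_x M, T_x M)`, written as one half of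
the sum over all `i, j`. -/
noncomputable def innerTwo (x : M)
    (α β : TangentSpace I x → TangentSpace I x → TangentSpace I x) : ℝ :=
  (1 / 2 : ℝ) * ∑ i, ∑ j, inner ℝ (α (orthoFrame x i) (orthoFrame x j))
    (β (orthoFrame x i) (orthoFrame x j))

end Operators

/-! ### Riemannian volume, `L²` products and the trilinear form -/

section Volume

variable {n : ℕ} {M : Type*} [TopologicalSpace M] [ChartedSpace (EuclideanSpace ℝ (Fin n)) M]
  [IsManifold (𝓡 n) ∞ M] [RiemannianBundle (fun x : M => TangentSpace (𝓡 n) x)]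

/-- The density `√(det g_{ij})` in the preferred chart at `x₀`, where `g_{ij} = g(∂_i, ∂_j)`. -/
noncomputable def chartDensity (x₀ : M) (y : EuclideanSpace ℝ (Fin n)) : ℝ :=
  let ψ := (extChartAt (𝓡 n) x₀).symm
  let b : Fin n → TangentSpace (𝓡 n) (ψ y) := fun i =>
    mfderiv 𝓘(ℝ, EuclideanSpace ℝ (Fin n)) (𝓡 n) ψ y (EuclideanSpace.single i (1 : ℝ))
  √(Matrix.det (Matrix.of fun i j => (inner ℝ (b i) (b j) : ℝ)))

variable [MeasurableSpace M] [BorelSpace M]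

/-- The Riemannian volume measure of the domain of the preferred chart at `x₀`: the push-forward
of `√(det g_{ij}) dy` under the inverse chart. -/
noncomputable def chartVolume (x₀ : M) : Measure M :=
  ((volume.restrict (extChartAt (𝓡 n) x₀).target).withDensity
    (fun y => ENNReal.ofReal (chartDensity x₀ y))).map (extChartAt (𝓡 n) x₀).symm

variable (n M) in
/-- The Riemannian volume measure of a compact manifold `M`: the least measure which dominates the
volume measures of the chart domains. As the latter agree on overlaps, it is the measure which
restricts to each of them on the corresponding chart domain. -/
noncomputable def riemannianVolume : Measure M :=
  ⨆ x₀ : M, chartVolume (n := n) x₀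

/-- The `L²` product of vector fields (or `1`-forms). -/
noncomputable def l2Vec (X Y : VecField (𝓡 n) M) : ℝ :=
  ∫ x, (inner ℝ (X x) (Y x) : ℝ) ∂(riemannianVolume n M)

/-- The `L²` product of sections of `End(TM) = Λ¹(M, TM)`. -/
noncomputable def l2End (A B : (x : M) → TangentSpace (𝓡 n) x → TangentSpace (𝓡 n) x) : ℝ :=
  ∫ x, innerEnd x (A x) (B x) ∂(riemannianVolume n M)

/-- The `L²` product of sections of `Λ²(M, TM)`. -/
noncomputable def l2Two (α β : TwoTensor (𝓡 n) M) : ℝ :=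
  ∫ x, innerTwo x (α x) (β x) ∂(riemannianVolume n M)

/-- The cyclic sum `𝔖_{abc} T(h_a, h_b, h_c)`. -/
noncomputable def cyclicSum (T : EndField (𝓡 n) M → EndField (𝓡 n) M → EndField (𝓡 n) M → ℝ)
    (h₁ h₂ h₃ : EndField (𝓡 n) M) : ℝ :=
  T h₁ h₂ h₃ + T h₂ h₃ h₁ + T h₃ h₁ h₂

variable [IsContMDiffRiemannianBundle (𝓡 n) ∞ (EuclideanSpace ℝ (Fin n))
  (fun x : M => TangentSpace (𝓡 n) x)]

/-- The trilinear form `v(h₁, h₂, h₃) = ⟨v(h₁, h₂), h₃⟩ = 𝔖_{abc} ⟨δ[h_a, h_b], h_c⟩`, the bracket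
being the Frölicher-Nijenhuis bracket. -/
noncomputable def vForm (h₁ h₂ h₃ : EndField (𝓡 n) M) : ℝ :=
  cyclicSum (fun a b c => l2End (divTwo (fnBracket a b)) (fun x => c x)) h₁ h₂ h₃

end Volume

end Kaehler

set_option linter.unusedSectionVars false
set_option linter.unusedVariables false

namespace Kaehler

section Regularity

variable {E : Type*} [NormedAddCommGroup E] [NormedSpace ℝ E] [FiniteDimensional ℝ E]
  {H : Type*} [TopologicalSpace H] {I : ModelWithCorners ℝ E H}
  {M : Type*} [TopologicalSpace M] [ChartedSpace H M] [IsManifold I ∞ M]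

/-- Smoothness of a vector field at a point. -/
def SmAt (X : VecField I M) (x : M) : Prop := CMDiffAt ∞ (T% X) x

/-- Smoothness of a real function at a point. -/
abbrev FnAt (I : ModelWithCorners ℝ E H) (f : M → ℝ) (x : M) : Prop :=
  ContMDiffAt I 𝓘(ℝ, ℝ) ∞ f x

theorem SmAt.mdiff {X : VecField I M} {x : M} (h : SmAt X x) : MDiffAt (T% X) x :=
  ContMDiffAt.mdifferentiableAt h (by simp)

theorem FnAt.mdiff {f : M → ℝ} {x : M} (h : FnAt I f x) : MDiffAt f x :=
  ContMDiffAt.mdifferentiableAt h (by simp)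

theorem SmAt.eventually_mdiff {X : VecField I M} {x : M} (h : SmAt X x) :
    ∀ᶠ p in 𝓝 x, MDiffAt (T% X) p := by
  have h1 : CMDiffAt 1 (T% X) x := ContMDiffAt.of_le h (by norm_cast)
  filter_upwards [(contMDiffAt_iff_contMDiffAt_nhds (by simp)).1 h1] with p hp
  exact hp.mdifferentiableAt one_ne_zero

theorem FnAt.eventually_mdiff {f : M → ℝ} {x : M} (h : FnAt I f x) :
    ∀ᶠ p in 𝓝 x, MDiffAt f p := by
  have h1 : ContMDiffAt I 𝓘(ℝ, ℝ) 1 f x := ContMDiffAt.of_le h (by norm_cast)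
  filter_upwards [(contMDiffAt_iff_contMDiffAt_nhds (by simp)).1 h1] with p hp
  exact hp.mdifferentiableAt one_ne_zero

theorem SmAt.add {X Y : VecField I M} {x : M} (hX : SmAt X x) (hY : SmAt Y x) :
    SmAt (X + Y) x := ContMDiffAt.add_section hX hY

theorem SmAt.sub {X Y : VecField I M} {x : M} (hX : SmAt X x) (hY : SmAt Y x) :
    SmAt (X - Y) x := ContMDiffAt.sub_section hX hY

theorem SmAt.neg {X : VecField I M} {x : M} (hX : SmAt X x) :
    SmAt (-X) x := ContMDiffAt.neg_section hX

theorem FnAt.smul {f : M → ℝ} {X : VecField I M} {x : M} (hf : FnAt I f x) (hX : SmAt X x) :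
    SmAt (f • X) x := ContMDiffAt.smul_section hf hX

theorem SmAt.sum {ι : Type*} {s : Finset ι} {X : ι → VecField I M} {x : M}
    (hX : ∀ i ∈ s, SmAt (X i) x) : SmAt (fun p => ∑ i ∈ s, X i p) x :=
  ContMDiffAt.sum_section hX

theorem SmAt.congr {X Y : VecField I M} {x : M} (hX : SmAt X x) (h : ∀ᶠ p in 𝓝 x, Y p = X p) :
    SmAt Y x :=
  ContMDiffAt.congr_of_eventuallyEq hX (h.mono fun p hp => by simp [hp])

theorem smAt_extendVec {x : M} (v : TangentSpace I x) : SmAt (extendVec (I := I) v) x :=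
  contMDiffAt_extend I E v

@[simp] theorem extendVec_self {x : M} (v : TangentSpace I x) :
    (extendVec (I := I) v : VecField I M) x = v :=
  extend_apply_self _ _

theorem SmAt.bracket {X Y : VecField I M} {x : M} (hX : SmAt X x) (hY : SmAt Y x) :
    SmAt (mlieBracket I X Y) x :=
  have : IsManifold I (minSmoothness ℝ 2) M :=
    IsManifold.of_le (n := ∞) (by simp only [minSmoothness_of_isRCLikeNormedField]; norm_cast)
  have : IsManifold I (((⊤ : ℕ∞) : WithTop ℕ∞) + 1) M := IsManifold.of_le (n := ∞) (by norm_cast)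
  ContMDiffAt.mlieBracket_vectorField (n := (⊤ : ℕ∞)) (m := (⊤ : ℕ∞)) hX hY
    (by simp)

theorem SmAt.mvfderiv {f : M → ℝ} {X : VecField I M} {x : M} (hf : FnAt I f x) (hX : SmAt X x) :
    FnAt I (fun p => mvfderiv I f p (X p)) x := by
  have h1 := ContMDiffAt.mfderiv_const (m := ∞) hf (by norm_cast)
  have h2 := ContMDiffAt.clm_apply_of_inCoordinates (IM := I) (b₁ := fun p : M => p) (b₂ := f)
    (E₁ := fun p : M => TangentSpace I p) (E₂ := fun t : ℝ => TangentSpace 𝓘(ℝ, ℝ) t) 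
    (ϕ := fun p => mfderiv I 𝓘(ℝ, ℝ) f p) (v := X) h1 hX hf
  rw [contMDiffAt_totalSpace] at h2
  have h3 : ContMDiffAt I 𝓘(ℝ, ℝ) ∞ (fun p => mfderiv I 𝓘(ℝ, ℝ) f p (X p)) x := by
    simpa [TangentBundle.trivializationAt_apply] using h2.2
  exact h3

variable [RiemannianBundle (fun x : M => TangentSpace I x)]
  [IsContMDiffRiemannianBundle I ∞ E (fun x : M => TangentSpace I x)]

theorem SmAt.inner {X Y : VecField I M} {x : M} (hX : SmAt X x) (hY : SmAt Y x) :
    FnAt I (fun p => (inner ℝ (X p) (Y p) : ℝ)) x :=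
  ContMDiffAt.inner_bundle (IB := I) (F := E) (E := fun x : M => TangentSpace I x)
    (b := fun x => x) hX hY

theorem SmAt.koszul {X Y Z : VecField I M} {x : M} (hX : SmAt X x) (hY : SmAt Y x)
    (hZ : SmAt Z x) : FnAt I (koszul I X Y Z) x := by
  unfold Kaehler.koszul
  have a1 := SmAt.mvfderiv (hY.inner hZ) hX
  have a2 := SmAt.mvfderiv (hX.inner hZ) hY
  have a3 := SmAt.mvfderiv (hX.inner hY) hZ
  have a4 := (hX.bracket hY).inner hZ
  have a5 := (hX.bracket hZ).inner hY
  have a6 := (hY.bracket hZ).inner hX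
  exact contMDiffAt_const.mul (((((a1.add a2).sub a3).add a4).sub a5).sub a6)

theorem eventually_smAt_extendVec {x : M} (v : TangentSpace I x) :
    ∀ᶠ p in 𝓝 x, SmAt (extendVec (I := I) v) p := by
  obtain ⟨s, hs, h⟩ := exists_contMDiffOn_extend (k := ∞) I E v
  filter_upwards [eventually_mem_nhds_iff.2 hs] with p hp
  exact h.contMDiffAt hp

theorem smAt_gramSchmidt {n : ℕ} {x : M} {f : Fin n → VecField I M} (hf : ∀ i, SmAt (f i) x)
    (h0 : ∀ i, InnerProductSpace.gramSchmidt ℝ (fun j => f j x) i ≠ 0) (i : Fin n) :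
    SmAt (fun p => InnerProductSpace.gramSchmidt ℝ (fun j => f j p) i) x := by
  induction i using WellFoundedLT.induction with
  | ind i ih =>
    have e : (fun p => InnerProductSpace.gramSchmidt ℝ (fun j => f j p) i)
        = f i - (fun p => ∑ k ∈ Finset.Iio i,
          ((fun p => (inner ℝ (InnerProductSpace.gramSchmidt ℝ (fun j => f j p) k) (f i p) : ℝ)
            / (inner ℝ (InnerProductSpace.gramSchmidt ℝ (fun j => f j p) k)
            (InnerProductSpace.gramSchmidt ℝ (fun j => f j p) k) : ℝ)) •
            (fun p => InnerProductSpace.gramSchmidt ℝ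
              (fun j => f j p) k) : VecField I M) p) := by
      funext p
      rw [InnerProductSpace.gramSchmidt_def]
      simp [Submodule.starProjection_singleton]
    rw [e]
    refine (hf i).sub (SmAt.sum fun k hk => ?_)
    have hk' := ih k (Finset.mem_Iio.1 hk)
    refine FnAt.smul ?_ hk'
    exact ContMDiffAt.div₀ (hk'.inner (hf i)) (hk'.inner hk') (inner_self_ne_zero.2 (h0 k))

theorem FnAt.inv_sqrt {f : M → ℝ} {x : M} (hf : FnAt I f x) (h0 : f x ≠ 0) (hp : 0 ≤ f x) :
    FnAt I (fun p => (√(f p))⁻¹) x := by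
  refine ContMDiffAt.inv₀ ?_ (Real.sqrt_ne_zero'.2 (lt_of_le_of_ne hp h0.symm))
  have : ContMDiffAt 𝓘(ℝ, ℝ) 𝓘(ℝ, ℝ) ∞ Real.sqrt (f x) := (Real.contDiffAt_sqrt h0).contMDiffAt
  exact this.comp x hf

/-- An orthonormal basis of a tangent space extends to a smooth local orthonormal frame. -/
theorem exists_orthoFrame {n : ℕ} {x : M} (b : OrthonormalBasis (Fin n) ℝ (TangentSpace I x)) :
    ∃ e : Fin n → VecField I M, (∀ i, e i x = b i) ∧ (∀ᶠ p in 𝓝 x, ∀ i, SmAt (e i) p) ∧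
      ∀ᶠ p in 𝓝 x, ∃ b' : OrthonormalBasis (Fin n) ℝ (TangentSpace I p), ∀ i, b' i = e i p := by
  set g : Fin n → VecField I M := fun i p =>
    InnerProductSpace.gramSchmidt ℝ (fun j => extendVec (I := I) (b j) p) i with hg
  have key : ∀ j, g j x = b j := by
    intro j
    simp only [hg, extendVec_self]
    rw [InnerProductSpace.gramSchmidt_of_orthogonal]
    intro i j hij
    exact b.orthonormal.2 hij
  have hs : ∀ i, SmAt (g i) x := smAt_gramSchmidt (fun i => smAt_extendVec (b i)) fun i => by
    have := key i
    simp only [hg] at this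
    rw [this]
    exact b.orthonormal.ne_zero i
  have h1 : ∀ i, (inner ℝ (g i x) (g i x) : ℝ) = 1 := fun i => by
    rw [key, real_inner_self_eq_norm_sq, b.orthonormal.1]; simp
  have h0 : ∀ᶠ p in 𝓝 x, ∀ i, (inner ℝ (g i p) (g i p) : ℝ) ≠ 0 :=
    Filter.eventually_all.2 fun i =>
      ((hs i).inner (hs i)).continuousAt.eventually_ne (by rw [h1]; simp)
  refine ⟨fun i => (fun p => (√(inner ℝ (g i p) (g i p) : ℝ))⁻¹) • g i, fun i => ?_, ?_, ?_⟩
  · simp [key]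
  · filter_upwards [h0, Filter.eventually_all.2 fun i => eventually_smAt_extendVec (b i)]
      with p hp hep i
    have hsp : ∀ i, SmAt (g i) p :=
      smAt_gramSchmidt hep fun i => inner_self_ne_zero (𝕜 := ℝ).1 (hp i)
    exact (((hsp i).inner (hsp i)).inv_sqrt (hp i) real_inner_self_nonneg).smul (hsp i)
  · filter_upwards [h0] with p hp
    have ho : Orthonormal ℝ (fun i => (√(inner ℝ (g i p) (g i p) : ℝ))⁻¹ • g i p) := by
      refine ⟨fun i => ?_, fun i j hij => ?_⟩
      · have : ‖g i p‖ ≠ 0 := fun h => hp i (by rw [real_inner_self_eq_norm_sq, h]; simp)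
        beta_reduce
        rw [real_inner_self_eq_norm_sq, Real.sqrt_sq (norm_nonneg _), norm_smul, norm_inv, norm_norm]
        exact inv_mul_cancel₀ this
      · simp only [real_inner_smul_left, real_inner_smul_right]
        have : inner ℝ (g i p) (g j p) = (0 : ℝ) :=
          InnerProductSpace.gramSchmidt_orthogonal ℝ (fun j => extendVec (I := I) (b j) p) hij
        rw [this]; simp
    have hc : Module.finrank ℝ (TangentSpace I p) = n := by
      have : Module.finrank ℝ (TangentSpace I x) = n := by
        simpa using Module.finrank_eq_card_basis b.toBasis
      exact this
    refine ⟨OrthonormalBasis.mk ho ?_, fun i => by simp⟩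
    rw [ho.linearIndependent.span_eq_top_of_card_eq_finrank' (by simp [hc])]

end Regularity
section Tensoriality

variable {E : Type*} [NormedAddCommGroup E] [NormedSpace ℝ E] [FiniteDimensional ℝ E]
  {H : Type*} [TopologicalSpace H] {I : ModelWithCorners ℝ E H}
  {M : Type*} [TopologicalSpace M] [ChartedSpace H M] [IsManifold I ∞ M]
  {A : Type*} [AddCommGroup A] [Module ℝ A]

/-- Tensoriality of an operation on vector fields that are smooth at a point. -/
structure SmTensorialAt (Φ : VecField I M → A) (x : M) : Prop where
  smul : ∀ {f : M → ℝ} {X : VecField I M}, FnAt I f x → SmAt X x → Φ (f • X) = f x • Φ X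
  add : ∀ {X Y : VecField I M}, SmAt X x → SmAt Y x → Φ (X + Y) = Φ X + Φ Y

namespace SmTensorialAt

variable {Φ : VecField I M → A} {x : M}

theorem congr (hΦ : SmTensorialAt Φ x) {X Y : VecField I M} (hX : SmAt X x) (hY : SmAt Y x)
    (h : ∀ᶠ p in 𝓝 x, X p = Y p) : Φ X = Φ Y := by
  classical
  let ψ (p : M) : ℝ := if X p = Y p then 1 else 0
  have hψx : ψ x = 1 := by simp [ψ, h.self_of_nhds]
  have e : ψ • X = ψ • Y := by
    funext p
    by_cases hp : X p = Y p <;> simp [ψ, hp]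
  have hψ : FnAt I ψ x := by
    refine (contMDiffAt_const (c := (1 : ℝ))).congr_of_eventuallyEq ?_
    filter_upwards [h] with p hp
    simp [ψ, hp]
  have h1 := hΦ.smul hψ hX
  have h2 := hΦ.smul hψ hY
  rw [e, h2, hψx, one_smul, one_smul] at h1
  exact h1.symm

theorem zero (hΦ : SmTensorialAt Φ x) : Φ 0 = 0 := by
  have h := hΦ.smul (f := fun _ => (0 : ℝ)) contMDiffAt_const
    (smAt_extendVec (I := I) (0 : TangentSpace I x))
  have e : ((fun _ => (0 : ℝ)) : M → ℝ) • (extendVec (I := I) (0 : TangentSpace I x)) = 0 := by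
    funext p; simp
  rwa [e, zero_smul] at h

theorem sum (hΦ : SmTensorialAt Φ x) {ι : Type*} {s : Finset ι} {X : ι → VecField I M}
    (hX : ∀ i ∈ s, SmAt (X i) x) : Φ (fun p => ∑ i ∈ s, X i p) = ∑ i ∈ s, Φ (X i) := by
  classical
  induction s using Finset.induction_on with
  | empty => simpa only [Finset.sum_empty] using! hΦ.zero
  | insert a s ha ih =>
    have h1 := ih fun i hi => hX i (Finset.mem_insert_of_mem hi)
    rw [Finset.sum_insert ha, ← h1, ← hΦ.add (hX a (Finset.mem_insert_self _ _))
      (SmAt.sum fun i hi => hX i (Finset.mem_insert_of_mem hi))]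
    congr 1
    funext p
    simp [Finset.sum_insert ha]

variable [RiemannianBundle (fun x : M => TangentSpace I x)]
  [IsContMDiffRiemannianBundle I ∞ E (fun x : M => TangentSpace I x)]

theorem exists_linear (hΦ : SmTensorialAt Φ x) :
    ∃ L : TangentSpace I x →ₗ[ℝ] A, ∀ X : VecField I M, SmAt X x → Φ X = L (X x) := by
  obtain ⟨e, hex, hes, hev⟩ := exists_orthoFrame (orthoFrame (I := I) x)
  have he := hes.self_of_nhds
  refine ⟨∑ i, (innerₗ _ (orthoFrame x i)).smulRight (Φ (e i)), fun X hX => ?_⟩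
  have hf : ∀ i, FnAt I (fun p => (inner ℝ (e i p) (X p) : ℝ)) x := fun i => (he i).inner hX
  rw [hΦ.congr (Y := fun p => ∑ i, ((fun p => (inner ℝ (e i p) (X p) : ℝ)) • e i) p) hX
    (SmAt.sum fun i _ => (hf i).smul (he i)),
    hΦ.sum fun i _ => (hf i).smul (he i)]
  · simp only [LinearMap.sum_apply, LinearMap.smulRight_apply, innerₗ_apply_apply]
    exact Finset.sum_congr rfl fun i _ => by rw [hΦ.smul (hf i) (he i), hex]
  · filter_upwards [hev] with p ⟨b, hb⟩
    simp only [Pi.smul_apply', ← hb]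
    exact (b.sum_repr' (X p)).symm

theorem pointwise (hΦ : SmTensorialAt Φ x) {X Y : VecField I M} (hX : SmAt X x) (hY : SmAt Y x)
    (h : X x = Y x) : Φ X = Φ Y := by
  obtain ⟨L, hL⟩ := hΦ.exists_linear
  rw [hL X hX, hL Y hY, h]

end SmTensorialAt

end Tensoriality

section Connection

variable {E : Type*} [NormedAddCommGroup E] [NormedSpace ℝ E] [FiniteDimensional ℝ E]
  {H : Type*} [TopologicalSpace H] {I : ModelWithCorners ℝ E H}
  {M : Type*} [TopologicalSpace M] [ChartedSpace H M] [IsManifold I ∞ M]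
  [RiemannianBundle (fun x : M => TangentSpace I x)]
  [IsContMDiffRiemannianBundle I ∞ E (fun x : M => TangentSpace I x)]

/-- The covariant derivative `∇_X Y` of vector fields. -/
noncomputable def nabla (X Y : VecField I M) : VecField I M := fun p => leviCivita I M Y p (X p)

theorem nabla_apply (X Y : VecField I M) (x : M) : nabla X Y x = leviCivita I M Y x (X x) := rfl

variable {x : M} {X Y Z : VecField I M}

theorem cov_add (hX : SmAt X x) (hY : SmAt Y x) :
    leviCivita I M (X + Y) x = leviCivita I M X x + leviCivita I M Y x :=
  (leviCivita I M).isCovariantDerivativeOnUniv.add hX.mdiff hY.mdiff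

theorem cov_smul {f : M → ℝ} (hf : FnAt I f x) (hX : SmAt X x) (u : TangentSpace I x) :
    leviCivita I M (f • X) x u = f x • leviCivita I M X x u + mvfderiv I f x u • X x := by
  rw [(leviCivita I M).isCovariantDerivativeOnUniv.leibniz hX.mdiff hf.mdiff]
  simp

theorem cov_neg (hX : SmAt X x) : leviCivita I M (-X) x = - leviCivita I M X x := by
  have h := (leviCivita I M).isCovariantDerivativeOnUniv.smul_const (-1 : ℝ) hX.mdiff
  have e : (-1 : ℝ) • X = -X := by funext p; simp
  rw [e] at h
  rw [h]; simp

theorem cov_sub (hX : SmAt X x) (hY : SmAt Y x) :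
    leviCivita I M (X - Y) x = leviCivita I M X x - leviCivita I M Y x := by
  rw [sub_eq_add_neg, cov_add hX hY.neg, cov_neg hY, sub_eq_add_neg]

theorem cov_congr (hX : SmAt X x) (h : ∀ᶠ p in 𝓝 x, Y p = X p) :
    leviCivita I M Y x = leviCivita I M X x :=
  (leviCivita I M).isCovariantDerivativeOnUniv.congr_of_eventuallyEq (hX.congr h).mdiff hX.mdiff
    Filter.univ_mem h

theorem cov_sum {ι : Type*} {s : Finset ι} {X : ι → VecField I M} (hX : ∀ i ∈ s, SmAt (X i) x) :
    leviCivita I M (fun p => ∑ i ∈ s, X i p) x = ∑ i ∈ s, leviCivita I M (X i) x := by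
  classical
  induction s using Finset.induction_on with
  | empty =>
    simpa only [Finset.sum_empty] using! (leviCivita I M).isCovariantDerivativeOnUniv.zero (x := x)
  | insert a s ha ih =>
    have h1 := ih fun i hi => hX i (Finset.mem_insert_of_mem hi)
    rw [Finset.sum_insert ha, ← h1, ← cov_add (hX a (Finset.mem_insert_self _ _))
      (SmAt.sum fun i hi => hX i (Finset.mem_insert_of_mem hi))]
    congr 1
    funext p
    simp [Finset.sum_insert ha]

theorem cov_bracket (hX : SmAt X x) (hY : SmAt Y x) :
    leviCivita I M Y x (X x) - leviCivita I M X x (Y x) = mlieBracket I X Y x :=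
  CovariantDerivative.torsion_eq_zero_iff _ |>.1 leviCivita_torsion hX.mdiff hY.mdiff

theorem mvfderiv_inner (hY : SmAt Y x) (hZ : SmAt Z x) (u : TangentSpace I x) :
    mvfderiv I (fun p => (inner ℝ (Y p) (Z p) : ℝ)) x u
      = inner ℝ (leviCivita I M Y x u) (Z x) + inner ℝ (Y x) (leviCivita I M Z x u) := by
  have h := leviCivita_metric (smAt_extendVec u).mdiff hY.mdiff hZ.mdiff
  simpa only [extendVec_self] using h

theorem SmAt.nabla (hX : SmAt X x) (hY : SmAt Y x) : SmAt (nabla X Y) x := by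
  obtain ⟨e, hex, hes, hev⟩ := exists_orthoFrame (orthoFrame (I := I) x)
  have he := hes.self_of_nhds
  refine (SmAt.sum (s := Finset.univ)
    fun i _ => (SmAt.koszul hX hY (he i)).smul (he i)).congr ?_
  filter_upwards [hev, hX.eventually_mdiff, hY.eventually_mdiff,
    Filter.eventually_all.2 fun i => (he i).eventually_mdiff] with p ⟨b, hb⟩ hXp hYp hep
  simp only [Pi.smul_apply', ← inner_leviCivita hXp hYp (hep _), ← hb, nabla_apply]
  rw [← b.sum_repr' (leviCivita I M Y p (X p))]
  exact Finset.sum_congr rfl fun i _ => by rw [b.sum_repr', real_inner_comm]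

theorem eventually_bracket_smul {f : M → ℝ} (hf : FnAt I f x) (hY : SmAt Y x) :
    ∀ᶠ p in 𝓝 x, mlieBracket I X (f • Y) p
      = (((fun p => mvfderiv I f p (X p)) • Y) + f • mlieBracket I X Y) p := by
  filter_upwards [hf.eventually_mdiff, hY.eventually_mdiff] with p hfp hYp
  rw [mlieBracket_smul_right hfp hYp]
  rfl

/-- The second derivatives of a function along vector fields commute up to the Lie bracket. -/
theorem mvfderiv_commutator {f : M → ℝ} (hf : FnAt I f x) (hX : SmAt X x) (hY : SmAt Y x) :
    mvfderiv I (fun p => mvfderiv I f p (Y p)) x (X x)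
      - mvfderiv I (fun p => mvfderiv I f p (X p)) x (Y x)
      = mvfderiv I f x (mlieBracket I X Y x) := by
  have hI2 : IsManifold I (minSmoothness ℝ 2) M :=
    IsManifold.of_le (n := ∞) (by simp only [minSmoothness_of_isRCLikeNormedField]; norm_cast)
  have hI3 : IsManifold I (minSmoothness ℝ 3) M :=
    IsManifold.of_le (n := ∞) (by simp only [minSmoothness_of_isRCLikeNormedField]; norm_cast)
  rcases subsingleton_or_nontrivial (TangentSpace I x) with hs | hs
  · simp [Subsingleton.elim (X x) 0, Subsingleton.elim (Y x) 0,
      Subsingleton.elim (mlieBracket I X Y x) 0]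
  obtain ⟨w, hw⟩ := exists_ne (0 : TangentSpace I x)
  set W : VecField I M := extendVec w
  have hW : SmAt W x := smAt_extendVec w
  have le2 : minSmoothness ℝ 2 ≤ ∞ := by
    simp only [minSmoothness_of_isRCLikeNormedField]; norm_cast
  have hfW := hf.smul hW
  have hDX : FnAt I (fun p => mvfderiv I f p (X p)) x := SmAt.mvfderiv hf hX
  have hDY : FnAt I (fun p => mvfderiv I f p (Y p)) x := SmAt.mvfderiv hf hY
  have e1 : mlieBracket I X (mlieBracket I Y (f • W)) x = _ :=
    Filter.EventuallyEq.mlieBracket_vectorField_eq (Filter.EventuallyEq.refl _ _)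
      (eventually_bracket_smul hf hW)
  have e2 : mlieBracket I Y (mlieBracket I X (f • W)) x = _ :=
    Filter.EventuallyEq.mlieBracket_vectorField_eq (Filter.EventuallyEq.refl _ _)
      (eventually_bracket_smul hf hW)
  rw [mlieBracket_add_right (hDY.smul hW).mdiff (hf.smul (hY.bracket hW)).mdiff,
    mlieBracket_smul_right hDY.mdiff hW.mdiff,
    mlieBracket_smul_right hf.mdiff (hY.bracket hW).mdiff] at e1
  rw [mlieBracket_add_right (hDX.smul hW).mdiff (hf.smul (hX.bracket hW)).mdiff,
    mlieBracket_smul_right hDX.mdiff hW.mdiff,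
    mlieBracket_smul_right hf.mdiff (hX.bracket hW).mdiff] at e2
  have j1 := leibniz_identity_mlieBracket_apply (ContMDiffAt.of_le hX le2)
    (ContMDiffAt.of_le hY le2) (ContMDiffAt.of_le hfW le2)
  have j2 := leibniz_identity_mlieBracket_apply (ContMDiffAt.of_le hX le2)
    (ContMDiffAt.of_le hY le2) (ContMDiffAt.of_le hW le2)
  rw [e1, e2, mlieBracket_smul_right hf.mdiff hW.mdiff, j2] at j1
  have hWx : W x = w := extendVec_self w
  have : (mvfderiv I (fun p => mvfderiv I f p (Y p)) x (X x)
      - mvfderiv I (fun p => mvfderiv I f p (X p)) x (Y x)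
      - mvfderiv I f x (mlieBracket I X Y x)) • w = 0 := by
    rw [← hWx]
    rw [← sub_eq_zero] at j1
    rw [← j1]
    module
  have h0 := (smul_eq_zero.1 this).resolve_right hw
  linarith

end Connection
section Trace

variable {V : Type*} [NormedAddCommGroup V] [InnerProductSpace ℝ V]
  {A : Type*} [AddCommGroup A] [Module ℝ A] {ι κ : Type*} [Fintype ι] [Fintype κ]

/-- The metric trace of a bilinear map does not depend on the orthonormal basis. -/
theorem sum_bilin_eq (F : V →ₗ[ℝ] V →ₗ[ℝ] A) (b : OrthonormalBasis ι ℝ V)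
    (b' : OrthonormalBasis κ ℝ V) : ∑ i, F (b i) (b i) = ∑ j, F (b' j) (b' j) := by
  classical
  have h1 : ∀ i, F (b i) (b i)
      = ∑ j, ∑ k, ((inner ℝ (b' j) (b i) : ℝ) * inner ℝ (b i) (b' k)) • F (b' j) (b' k) := by
    intro i
    conv_lhs => rw [← b'.sum_repr' (b i)]
    simp only [map_sum, map_smul, LinearMap.sum_apply, LinearMap.smul_apply, smul_smul,
      Finset.smul_sum]
    rw [Finset.sum_comm]
    refine Finset.sum_congr rfl fun j _ => Finset.sum_congr rfl fun k _ => ?_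
    rw [real_inner_comm (b i) (b' k), mul_comm]
  simp only [h1]
  rw [Finset.sum_comm]
  refine Finset.sum_congr rfl fun j _ => ?_
  rw [Finset.sum_comm]
  simp only [← Finset.sum_smul, b.sum_inner_mul_inner]
  simp [OrthonormalBasis.inner_eq_ite]

/-- The metric trace of a bilinear map with one argument precomposed with a symmetric map. -/
theorem sum_bilin_symm (F : V →ₗ[ℝ] V →ₗ[ℝ] A) (b : OrthonormalBasis ι ℝ V) {a : V → V}
    (ha : ∀ u v, (inner ℝ (a u) v : ℝ) = inner ℝ u (a v)) :
    ∑ i, F (a (b i)) (b i) = ∑ i, F (b i) (a (b i)) := by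
  have h1 : ∀ i, F (a (b i)) (b i) = ∑ j, (inner ℝ (b j) (a (b i)) : ℝ) • F (b j) (b i) := by
    intro i
    conv_lhs => rw [← b.sum_repr' (a (b i))]
    simp
  have h2 : ∀ i, F (b i) (a (b i)) = ∑ j, (inner ℝ (b j) (a (b i)) : ℝ) • F (b i) (b j) := by
    intro i
    conv_lhs => rw [← b.sum_repr' (a (b i))]
    simp
  simp only [h1, h2]
  rw [Finset.sum_comm]
  refine Finset.sum_congr rfl fun j _ => Finset.sum_congr rfl fun k _ => ?_
  rw [← ha, real_inner_comm]

/-- The metric trace of a bilinear map is invariant under an orthogonal complex structure. -/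
theorem sum_bilin_complex (F : V →ₗ[ℝ] V →ₗ[ℝ] A) (b : OrthonormalBasis ι ℝ V) {J : V →ₗ[ℝ] V}
    (hJ : ∀ v, J (J v) = -v) (ho : ∀ u v, (inner ℝ (J u) (J v) : ℝ) = inner ℝ u v) :
    ∑ i, F (J (b i)) (J (b i)) = ∑ i, F (b i) (b i) := by
  let j : V ≃ₗᵢ[ℝ] V :=
    LinearEquiv.isometryOfInner (LinearEquiv.ofLinearMap J (-J) (by ext v; simp [hJ])
      (by ext v; simp [hJ])) (by intro u v; simpa using ho u v)
  have := sum_bilin_eq F (b.map j) b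
  simpa [j] using this

end Trace

section Tensors

variable {E : Type*} [NormedAddCommGroup E] [NormedSpace ℝ E] [FiniteDimensional ℝ E]
  {H : Type*} [TopologicalSpace H] {I : ModelWithCorners ℝ E H}
  {M : Type*} [TopologicalSpace M] [ChartedSpace H M] [IsManifold I ∞ M]

/-- Endomorphism fields which map smooth vector fields to smooth vector fields. -/
def SmEnd (h : EndField I M) : Prop :=
  ∀ ⦃x : M⦄ ⦃X : VecField I M⦄, SmAt X x → SmAt (fun p => h p (X p)) x

/-- Smooth sections of `T*M ⊗ T*M ⊗ TM`. -/
structure SmoothTwo (α : TwoTensor I M) : Prop where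
  add_left : ∀ x u u' v, α x (u + u') v = α x u v + α x u' v
  smul_left : ∀ x (r : ℝ) u v, α x (r • u) v = r • α x u v
  add_right : ∀ x u v v', α x u (v + v') = α x u v + α x u v'
  smul_right : ∀ x (r : ℝ) u v, α x u (r • v) = r • α x u v
  smooth : ∀ ⦃x : M⦄ ⦃X Y : VecField I M⦄, SmAt X x → SmAt Y x →
    SmAt (fun p => α p (X p) (Y p)) x

/-- The bilinear map underlying a smooth tensor. -/
noncomputable def SmoothTwo.toBilin {α : TwoTensor I M} (hα : SmoothTwo α) (x : M) :
    TangentSpace I x →ₗ[ℝ] TangentSpace I x →ₗ[ℝ] TangentSpace I x :=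
  LinearMap.mk₂ ℝ (α x) (hα.add_left x) (hα.smul_left x) (hα.add_right x) (hα.smul_right x)

@[simp] theorem SmoothTwo.toBilin_apply {α : TwoTensor I M} (hα : SmoothTwo α) (x : M)
    (u v : TangentSpace I x) : hα.toBilin x u v = α x u v := rfl

variable [RiemannianBundle (fun x : M => TangentSpace I x)]

theorem SmoothEnd.smEnd {h : EndField I M} (hh : SmoothEnd h) : SmEnd h :=
  fun x _ hX => ContMDiffAt.clm_bundle_apply (F₁ := E) (F₂ := E) (hh x) hX

theorem SmEnd.add {h k : EndField I M} (hh : SmEnd h) (hk : SmEnd k) : SmEnd (h + k) :=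
  fun _ _ hX => (hh hX).add (hk hX)

theorem SmEnd.antiComm {h k : EndField I M} (hh : SmEnd h) (hk : SmEnd k) :
    SmEnd (antiComm h k) :=
  fun _ _ hX => (hh (hk hX)).add (hk (hh hX))

theorem SmoothTwo.add {α β : TwoTensor I M} (hα : SmoothTwo α) (hβ : SmoothTwo β) :
    SmoothTwo (α + β) where
  add_left x u u' v := by simp only [Pi.add_apply, hα.add_left, hβ.add_left]; abel
  smul_left x r u v := by simp only [Pi.add_apply, hα.smul_left, hβ.smul_left, smul_add]
  add_right x u v v' := by simp only [Pi.add_apply, hα.add_right, hβ.add_right]; abel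
  smul_right x r u v := by simp only [Pi.add_apply, hα.smul_right, hβ.smul_right, smul_add]
  smooth _ _ _ hX hY := (hα.smooth hX hY).add (hβ.smooth hX hY)

theorem SmoothTwo.const_smul {α : TwoTensor I M} (hα : SmoothTwo α) (c : ℝ) :
    SmoothTwo (c • α) where
  add_left x u u' v := by simp only [Pi.smul_apply, hα.add_left, smul_add]
  smul_left x r u v := by simp only [Pi.smul_apply, hα.smul_left, smul_comm c r]
  add_right x u v v' := by simp only [Pi.smul_apply, hα.add_right, smul_add]
  smul_right x r u v := by simp only [Pi.smul_apply, hα.smul_right, smul_comm c r]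
  smooth _ _ _ hX hY := FnAt.smul (f := fun _ => c) contMDiffAt_const (hα.smooth hX hY)

theorem SmoothTwo.neg {α : TwoTensor I M} (hα : SmoothTwo α) : SmoothTwo (-α) := by
  have := hα.const_smul (-1)
  rwa [neg_one_smul] at this

theorem SmoothTwo.sub {α β : TwoTensor I M} (hα : SmoothTwo α) (hβ : SmoothTwo β) :
    SmoothTwo (α - β) := by
  rw [sub_eq_add_neg]; exact hα.add hβ.neg

/-- Precomposition of both arguments and postcomposition with endomorphisms. -/
theorem SmoothTwo.comp {α : TwoTensor I M} (hα : SmoothTwo α) {h k l : EndField I M}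
    (hh : SmEnd h) (hk : SmEnd k) (hl : SmEnd l) :
    SmoothTwo (fun x u v => h x (α x (k x u) (l x v))) where
  add_left x u u' v := by simp only [map_add, hα.add_left]
  smul_left x r u v := by simp only [map_smul, hα.smul_left]
  add_right x u v v' := by simp only [map_add, hα.add_right]
  smul_right x r u v := by simp only [map_smul, hα.smul_right]
  smooth _ _ _ hX hY := hh (hα.smooth (hk hX) (hl hY))

theorem SmoothTwo.swap {α : TwoTensor I M} (hα : SmoothTwo α) :
    SmoothTwo (fun x u v => α x v u) where
  add_left x u u' v := hα.add_right x _ _ _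
  smul_left x r u v := hα.smul_right x _ _ _
  add_right x u v v' := hα.add_left x _ _ _
  smul_right x r u v := hα.smul_left x _ _ _
  smooth _ _ _ hX hY := hα.smooth hY hX

/-- The identity of the tangent bundle. -/
noncomputable def idEnd : EndField I M := fun x => ContinuousLinearMap.id ℝ (TangentSpace I x)

@[simp] theorem idEnd_apply (x : M) (v : TangentSpace I x) : idEnd (I := I) x v = v := rfl

theorem smEnd_id : SmEnd (idEnd : EndField I M) := fun _ _ hX => hX

variable [IsContMDiffRiemannianBundle I ∞ E (fun x : M => TangentSpace I x)]
  {x : M} {X Y Z : VecField I M}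

theorem covEnd_tensorial {h : EndField I M} (hh : SmEnd h) (u : TangentSpace I x) :
    SmTensorialAt (fun V : VecField I M =>
      leviCivita I M (fun p => h p (V p)) x u - h x (leviCivita I M V x u)) x where
  smul {f V} hf hV := by
    have e : (fun p => h p ((f • V) p)) = f • (fun p => h p (V p)) := by funext p; simp
    rw [e, cov_smul hf (hh hV), cov_smul hf hV]
    simp [smul_sub]
  add {V W} hV hW := by
    have e : (fun p => h p ((V + W) p)) = (fun p => h p (V p)) + (fun p => h p (W p)) := by
      funext p; simp
    rw [e, cov_add (hh hV) (hh hW), cov_add hV hW]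
    simp only [add_apply, map_add]
    abel

theorem covEnd_apply {h : EndField I M} (hh : SmEnd h) (u : TangentSpace I x) (hX : SmAt X x) :
    covEnd h x u (X x) = leviCivita I M (fun p => h p (X p)) x u - h x (leviCivita I M X x u) :=
  (covEnd_tensorial hh u).pointwise (smAt_extendVec _) hX (extendVec_self _)

theorem covEnd_add_right {h : EndField I M} (hh : SmEnd h) (x : M) (u v v' : TangentSpace I x) :
    covEnd h x u (v + v') = covEnd h x u v + covEnd h x u v' := by
  obtain ⟨L, hL⟩ := (covEnd_tensorial hh u).exists_linear
  simp only [covEnd, hL _ (smAt_extendVec _), extendVec_self, map_add]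

theorem covEnd_smul_right {h : EndField I M} (hh : SmEnd h) (x : M) (r : ℝ)
    (u v : TangentSpace I x) : covEnd h x u (r • v) = r • covEnd h x u v := by
  obtain ⟨L, hL⟩ := (covEnd_tensorial hh u).exists_linear
  simp only [covEnd, hL _ (smAt_extendVec _), extendVec_self, map_smul]

theorem smoothTwo_covEnd {h : EndField I M} (hh : SmEnd h) : SmoothTwo (covEnd h) where
  add_left x u u' v := by simp only [covEnd, map_add]; abel
  smul_left x r u v := by simp only [covEnd, map_smul, smul_sub]
  add_right := covEnd_add_right hh
  smul_right := covEnd_smul_right hh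
  smooth x X Y hX hY := by
    obtain ⟨e, hex, hes, hev⟩ := exists_orthoFrame (orthoFrame (I := I) x)
    have he := hes.self_of_nhds
    refine (SmAt.sum (s := Finset.univ) fun i _ =>
      ((he i).inner hY).smul ((hX.nabla (hh (he i))).sub (hh (hX.nabla (he i))))).congr ?_
    filter_upwards [hes, hev] with p hp ⟨b, hb⟩
    simp only [Pi.smul_apply', Pi.sub_apply, nabla_apply, ← covEnd_apply hh _ (hp _)]
    simp only [← hb]
    conv_lhs => rw [← b.sum_repr' (Y p)]
    let L : TangentSpace I p →ₗ[ℝ] TangentSpace I p :=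
      { toFun := covEnd h p (X p)
        map_add' := covEnd_add_right hh p _
        map_smul' := fun r => covEnd_smul_right hh p r _ }
    change L _ = ∑ i, _ • L _
    simp only [map_sum, map_smul]

theorem covTwo_tensorial_left {α : TwoTensor I M} (hα : SmoothTwo α) (u : TangentSpace I x)
    (hY : SmAt Y x) :
    SmTensorialAt (fun V : VecField I M => leviCivita I M (fun p => α p (V p) (Y p)) x u
      - α x (leviCivita I M V x u) (Y x) - α x (V x) (leviCivita I M Y x u)) x where
  smul {f V} hf hV := by
    have e : (fun p => α p ((f • V) p) (Y p)) = f • (fun p => α p (V p) (Y p)) := by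
      funext p; simp [hα.smul_left]
    rw [e, cov_smul hf (hα.smooth hV hY), cov_smul hf hV]
    simp [smul_sub, hα.smul_left, hα.add_left]
  add {V W} hV hW := by
    have e : (fun p => α p ((V + W) p) (Y p))
        = (fun p => α p (V p) (Y p)) + (fun p => α p (W p) (Y p)) := by
      funext p; simp [hα.add_left]
    rw [e, cov_add (hα.smooth hV hY) (hα.smooth hW hY), cov_add hV hW]
    simp only [add_apply, hα.add_left, Pi.add_apply]
    abel

theorem covTwo_tensorial_right {α : TwoTensor I M} (hα : SmoothTwo α) (u : TangentSpace I x)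
    (hX : SmAt X x) :
    SmTensorialAt (fun V : VecField I M => leviCivita I M (fun p => α p (X p) (V p)) x u
      - α x (leviCivita I M X x u) (V x) - α x (X x) (leviCivita I M V x u)) x := by
  have h := covTwo_tensorial_left hα.swap u hX
  refine ⟨fun hf hV => ?_, fun hV hW => ?_⟩
  · have := h.smul hf hV
    rw [sub_right_comm] at this
    rw [this, sub_right_comm]
  · have := h.add hV hW
    rw [sub_right_comm] at this
    rw [this]
    abel

theorem covTwo_apply {α : TwoTensor I M} (hα : SmoothTwo α) (u : TangentSpace I x)
    (hX : SmAt X x) (hY : SmAt Y x) :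
    covTwo α x u (X x) (Y x) = leviCivita I M (fun p => α p (X p) (Y p)) x u
      - α x (leviCivita I M X x u) (Y x) - α x (X x) (leviCivita I M Y x u) := by
  have h1 := (covTwo_tensorial_left hα u (smAt_extendVec (Y x))).pointwise
    (smAt_extendVec (X x)) hX (extendVec_self _)
  have h2 := (covTwo_tensorial_right hα u hX).pointwise
    (smAt_extendVec (Y x)) hY (extendVec_self _)
  simp only [extendVec_self] at h1 h2
  rw [covTwo, h1, h2]

theorem covTwo_swap {α : TwoTensor I M} (x : M) (u v w : TangentSpace I x) :
    covTwo (fun x u v => α x v u) x u v w = covTwo α x u w v := by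
  simp only [covTwo]; abel

end Tensors
section Contraction

variable {E : Type*} [NormedAddCommGroup E] [NormedSpace ℝ E] [FiniteDimensional ℝ E]
  {H : Type*} [TopologicalSpace H] {I : ModelWithCorners ℝ E H}
  {M : Type*} [TopologicalSpace M] [ChartedSpace H M] [IsManifold I ∞ M]
  [RiemannianBundle (fun x : M => TangentSpace I x)]
  [IsContMDiffRiemannianBundle I ∞ E (fun x : M => TangentSpace I x)]
  {x : M} {X Y Z : VecField I M}

/-- The metric trace of a tensor. -/
noncomputable def trField (α : TwoTensor I M) : VecField I M :=
  fun x => ∑ i, α x (orthoFrame x i) (orthoFrame x i)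

/-- The divergence of a vector field. -/
noncomputable def divField (X : VecField I M) (x : M) : ℝ :=
  ∑ i, inner ℝ (leviCivita I M X x (orthoFrame x i)) (orthoFrame x i)

theorem SmoothTwo.trField_eq {α : TwoTensor I M} (hα : SmoothTwo α) {ι : Type*} [Fintype ι]
    (b : OrthonormalBasis ι ℝ (TangentSpace I x)) : trField α x = ∑ i, α x (b i) (b i) :=
  sum_bilin_eq (hα.toBilin x) _ b

/-- The bilinear form `(u, v) ↦ g(A u, v)`. -/
noncomputable def innerForm (A : TangentSpace I x →ₗ[ℝ] TangentSpace I x) :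
    TangentSpace I x →ₗ[ℝ] TangentSpace I x →ₗ[ℝ] ℝ :=
  (innerₗ (TangentSpace I x)).comp A

theorem divField_eq {ι : Type*} [Fintype ι] (b : OrthonormalBasis ι ℝ (TangentSpace I x)) :
    divField X x = ∑ i, inner ℝ (leviCivita I M X x (b i)) (b i) :=
  sum_bilin_eq (innerForm (leviCivita I M X x : TangentSpace I x →ₗ[ℝ] TangentSpace I x)) _ b

theorem SmoothTwo.smAt_trField {α : TwoTensor I M} (hα : SmoothTwo α) (x : M) :
    SmAt (trField α) x := by
  obtain ⟨e, hex, hes, hev⟩ := exists_orthoFrame (orthoFrame (I := I) x)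
  have he := hes.self_of_nhds
  refine (SmAt.sum (s := Finset.univ) fun i _ => hα.smooth (he i) (he i)).congr ?_
  filter_upwards [hev] with p ⟨b, hb⟩
  rw [hα.trField_eq b]
  simp only [hb]

theorem fnAt_divField (hX : SmAt X x) : FnAt I (divField X) x := by
  obtain ⟨e, hex, hes, hev⟩ := exists_orthoFrame (orthoFrame (I := I) x)
  have he := hes.self_of_nhds
  have h : FnAt I (fun p => ∑ i, (inner ℝ (nabla (e i) X p) (e i p) : ℝ)) x :=
    ContMDiffAt.sum fun i _ => ((he i).nabla hX).inner (he i)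
  refine h.congr_of_eventuallyEq ?_
  filter_upwards [hev] with p ⟨b, hb⟩
  rw [divField_eq b]
  simp only [hb, nabla_apply]

/-- The connection form of an orthonormal frame is skew, hence does not contribute to traces. -/
theorem sum_frame_deriv {n : ℕ} {e : Fin n → VecField I M} (he : ∀ i, SmAt (e i) x)
    (hev : ∀ᶠ p in 𝓝 x, ∃ b' : OrthonormalBasis (Fin n) ℝ (TangentSpace I p), ∀ i, b' i = e i p)
    {A : Type*} [AddCommGroup A] [Module ℝ A]
    (F : TangentSpace I x →ₗ[ℝ] TangentSpace I x →ₗ[ℝ] A) (u : TangentSpace I x) :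
    ∑ i, (F (leviCivita I M (e i) x u) (e i x) + F (e i x) (leviCivita I M (e i) x u)) = 0 := by
  obtain ⟨b, hb⟩ := hev.self_of_nhds
  have skew : ∀ i j, (inner ℝ (leviCivita I M (e i) x u) (e j x) : ℝ)
      = - inner ℝ (e i x) (leviCivita I M (e j) x u) := by
    intro i j
    have h := mvfderiv_inner (he i) (he j) u
    have hc : (fun p => (inner ℝ (e i p) (e j p) : ℝ)) =ᶠ[𝓝 x] fun _ => if i = j then 1 else 0 := by
      filter_upwards [hev] with p ⟨b', hb'⟩
      rw [← hb', ← hb', b'.inner_eq_ite]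
    have h0 : mvfderiv I (fun p => (inner ℝ (e i p) (e j p) : ℝ)) x = 0 := by
      have := hc.mfderiv_eq (I := I) (I' := 𝓘(ℝ, ℝ))
      ext v
      simp only [mvfderiv, this, mfderiv_const]
      exact (NormedSpace.fromTangentSpace (𝕜 := ℝ) (inner ℝ (e i x) (e j x) : ℝ)).map_zero
    rw [h0] at h
    simp only [zero_apply] at h
    linarith
  have h1 : ∀ i, F (leviCivita I M (e i) x u) (e i x)
      = ∑ j, (inner ℝ (leviCivita I M (e i) x u) (e j x) : ℝ) • F (e j x) (e i x) := by
    intro i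
    conv_lhs => rw [← b.sum_repr' (leviCivita I M (e i) x u)]
    simp only [map_sum, map_smul, LinearMap.sum_apply, LinearMap.smul_apply, hb]
    exact Finset.sum_congr rfl fun j _ => by rw [real_inner_comm]
  have h2 : ∀ i, F (e i x) (leviCivita I M (e i) x u)
      = ∑ j, (inner ℝ (e j x) (leviCivita I M (e i) x u) : ℝ) • F (e i x) (e j x) := by
    intro i
    conv_lhs => rw [← b.sum_repr' (leviCivita I M (e i) x u)]
    simp only [map_sum, map_smul, hb]
  rw [Finset.sum_add_distrib]
  simp only [h1, h2]
  rw [Finset.sum_comm, ← Finset.sum_add_distrib]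
  refine Finset.sum_eq_zero fun i _ => ?_
  rw [← Finset.sum_add_distrib]
  refine Finset.sum_eq_zero fun j _ => ?_
  rw [skew, neg_smul, neg_add_cancel]

/-- Covariant differentiation commutes with the metric trace. -/
theorem SmoothTwo.cov_trField {α : TwoTensor I M} (hα : SmoothTwo α) (x : M)
    (u : TangentSpace I x) :
    leviCivita I M (trField α) x u = ∑ i, covTwo α x u (orthoFrame x i) (orthoFrame x i) := by
  obtain ⟨e, hex, hes, hev⟩ := exists_orthoFrame (orthoFrame (I := I) x)
  have he := hes.self_of_nhds
  have h1 : leviCivita I M (trField α) x = ∑ i, leviCivita I M (fun p => α p (e i p) (e i p)) x := by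
    rw [← cov_sum fun i _ => hα.smooth (he i) (he i)]
    refine cov_congr (SmAt.sum fun i _ => hα.smooth (he i) (he i)) ?_
    filter_upwards [hev] with p ⟨b, hb⟩
    rw [hα.trField_eq b]
    simp only [hb]
  have h2 := sum_frame_deriv he hev (hα.toBilin x) u
  simp only [SmoothTwo.toBilin_apply] at h2
  rw [h1, sum_apply, ← sub_eq_zero, ← h2, ← Finset.sum_sub_distrib]
  refine Finset.sum_congr rfl fun i _ => ?_
  rw [← hex, covTwo_apply hα u (he i) (he i)]
  abel

theorem covTwo_comp {α : TwoTensor I M} (hα : SmoothTwo α) {h k : EndField I M}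
    (hh : SmEnd h) (hk : SmEnd k) (x : M) (u v w : TangentSpace I x) :
    covTwo (fun x u v => h x (α x u (k x v))) x u v w = covEnd h x u (α x v (k x w))
      + h x (covTwo α x u v (k x w)) + h x (α x v (covEnd k x u w)) := by
  have hv := smAt_extendVec v
  have hw := smAt_extendVec w
  have e1 := covEnd_apply hh u (hα.smooth hv (hk hw))
  have e2 := covTwo_apply hα u hv (hk hw)
  have e3 := covEnd_apply hk u hw
  simp only [extendVec_self] at e1 e2 e3
  rw [e1, e2, e3, covTwo]
  have h4 := (hα.toBilin x v).map_sub (leviCivita I M (fun p => k p (extendVec w p)) x u)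
    (k x (leviCivita I M (extendVec w) x u))
  simp only [SmoothTwo.toBilin_apply] at h4
  rw [h4]
  simp only [map_sub]
  abel

/-- The fibrewise adjoint `g(adj α v w, X) = g(α(X, v), w)`. -/
noncomputable def adjTwo (α : TwoTensor I M) : TwoTensor I M :=
  fun x v w => ∑ k, (inner ℝ (α x (orthoFrame x k) v) w : ℝ) • orthoFrame x k

theorem inner_adjTwo {α : TwoTensor I M} (hα : SmoothTwo α) (x : M) (u v w : TangentSpace I x) :
    (inner ℝ (adjTwo α x v w) u : ℝ) = inner ℝ (α x u v) w := by
  have h1 : α x u v = ∑ k, (inner ℝ (orthoFrame x k) u : ℝ) • α x (orthoFrame x k) v := by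
    conv_lhs => rw [← (orthoFrame x).sum_repr' u]
    have : ∀ u, α x u v = (hα.toBilin x).flip v u := fun u => rfl
    simp only [this, map_sum, map_smul]
  rw [h1, adjTwo, sum_inner, sum_inner]
  refine Finset.sum_congr rfl fun k _ => ?_
  rw [real_inner_smul_left, real_inner_smul_left, mul_comm]

theorem SmoothTwo.adj {α : TwoTensor I M} (hα : SmoothTwo α) : SmoothTwo (adjTwo α) where
  add_left x v v' w := by
    simp only [adjTwo, hα.add_right, inner_add_left, add_smul, Finset.sum_add_distrib]
  smul_left x r v w := by
    simp only [adjTwo, hα.smul_right, real_inner_smul_left, mul_smul, Finset.smul_sum]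
  add_right x v w w' := by
    simp only [adjTwo, inner_add_right, add_smul, Finset.sum_add_distrib]
  smul_right x r v w := by
    simp only [adjTwo, real_inner_smul_right, mul_smul, Finset.smul_sum]
  smooth x X Y hX hY := by
    obtain ⟨e, hex, hes, hev⟩ := exists_orthoFrame (orthoFrame (I := I) x)
    have he := hes.self_of_nhds
    refine (SmAt.sum (s := Finset.univ) fun i _ =>
      ((hα.smooth (he i) hX).inner hY).smul (he i)).congr ?_
    filter_upwards [hev] with p ⟨b, hb⟩
    simp only [Pi.smul_apply', ← hb, ← inner_adjTwo hα]
    conv_lhs => rw [← b.sum_repr' (adjTwo α p (X p) (Y p))]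
    exact Finset.sum_congr rfl fun i _ => by rw [real_inner_comm]

theorem inner_covTwo_adjTwo {α : TwoTensor I M} (hα : SmoothTwo α) (x : M)
    (t u v w : TangentSpace I x) :
    (inner ℝ (covTwo (adjTwo α) x t v w) u : ℝ) = inner ℝ (covTwo α x t u v) w := by
  have hu := smAt_extendVec u
  have hv := smAt_extendVec v
  have hw := smAt_extendVec w
  have h1 := mvfderiv_inner (hα.adj.smooth hv hw) hu t
  have h2 := mvfderiv_inner (hα.smooth hu hv) hw t
  simp only [inner_adjTwo hα, extendVec_self] at h1 h2
  rw [h2] at h1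
  simp only [covTwo, inner_sub_left, inner_adjTwo hα]
  linarith

/-- The vector field whose divergence computes the formal adjoint of the divergence of `2`-tensors. -/
theorem divField_trField_adjTwo {α : TwoTensor I M} (hα : SmoothTwo α) {h : EndField I M}
    (hh : SmEnd h) (x : M) :
    divField (trField fun x v w => adjTwo α x v (h x w)) x
      = ∑ k, ∑ j, ((inner ℝ (covTwo α x (orthoFrame x k) (orthoFrame x k) (orthoFrame x j))
            (h x (orthoFrame x j)) : ℝ)
          + inner ℝ (α x (orthoFrame x k) (orthoFrame x j))
            (covEnd h x (orthoFrame x k) (orthoFrame x j))) := by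
  have hs : SmoothTwo fun x v w => adjTwo α x v (h x w) := hα.adj.comp smEnd_id smEnd_id hh
  rw [divField]
  refine Finset.sum_congr rfl fun k _ => ?_
  rw [hs.cov_trField, sum_inner]
  refine Finset.sum_congr rfl fun j _ => ?_
  have := covTwo_comp hα.adj smEnd_id hh x (orthoFrame x k) (orthoFrame x j) (orthoFrame x j)
  simp only [idEnd_apply] at this
  rw [this]
  have h0 : ∀ v, covEnd (idEnd : EndField I M) x (orthoFrame x k) v = 0 := fun v => by
    simp [covEnd]
  rw [h0, zero_add, inner_add_left, inner_covTwo_adjTwo hα, inner_adjTwo hα]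

end Contraction
section Curvature

variable {E : Type*} [NormedAddCommGroup E] [NormedSpace ℝ E] [FiniteDimensional ℝ E]
  {H : Type*} [TopologicalSpace H] {I : ModelWithCorners ℝ E H}
  {M : Type*} [TopologicalSpace M] [ChartedSpace H M] [IsManifold I ∞ M]
  [RiemannianBundle (fun x : M => TangentSpace I x)]
  [IsContMDiffRiemannianBundle I ∞ E (fun x : M => TangentSpace I x)]
  {x : M} {U V W X Y Z : VecField I M}

/-! ### The Frölicher-Nijenhuis bracket in terms of the Levi-Civita connection -/

theorem fnSquare_eq {h : EndField I M} (hh : SmEnd h) (x : M) (u v : TangentSpace I x) :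
    fnSquare h x u v = h x (dNabla h x u v) - covEnd h x (h x u) v + covEnd h x (h x v) u := by
  have hu := smAt_extendVec u
  have hv := smAt_extendVec v
  have a1 := cov_bracket hu hv
  have a2 := cov_bracket (hh hu) hv
  have a3 := cov_bracket hu (hh hv)
  have a4 := cov_bracket (hh hu) (hh hv)
  simp only [fnSquare, ← a1, ← a2, ← a3, ← a4, dNabla, covEnd, extendVec_self, map_sub, map_add]
  abel

theorem covEnd_add {h k : EndField I M} (hh : SmEnd h) (hk : SmEnd k) (x : M)
    (u v : TangentSpace I x) : covEnd (h + k) x u v = covEnd h x u v + covEnd k x u v := by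
  have hv := smAt_extendVec v
  have e : (fun p => (h + k) p (extendVec v p))
      = (fun p => h p (extendVec v p)) + fun p => k p (extendVec v p) := by funext p; simp
  simp only [covEnd, e, cov_add (hh hv) (hk hv)]
  simp only [Pi.add_apply, add_apply]
  abel

theorem fnBracket_eq {h k : EndField I M} (hh : SmEnd h) (hk : SmEnd k) (x : M)
    (u v : TangentSpace I x) :
    fnBracket h k x u v = (1 / 2 : ℝ) • (h x (dNabla k x u v) + k x (dNabla h x u v)
      - covEnd k x (h x u) v - covEnd h x (k x u) v + covEnd k x (h x v) u
      + covEnd h x (k x v) u) := by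
  have l1 := (smoothTwo_covEnd hh).add_left x
  have l2 := (smoothTwo_covEnd hk).add_left x
  simp only [fnBracket, fnSquare_eq (hh.add hk), fnSquare_eq hh, fnSquare_eq hk, dNabla,
    covEnd_add hh hk, Pi.add_apply, add_apply, map_add, map_sub, l1, l2]
  congr 1
  abel

theorem smoothTwo_dNabla {h : EndField I M} (hh : SmEnd h) : SmoothTwo (dNabla h) :=
  (smoothTwo_covEnd hh).sub (smoothTwo_covEnd hh).swap

theorem smoothTwo_fnBracket {h k : EndField I M} (hh : SmEnd h) (hk : SmEnd k) :
    SmoothTwo (fnBracket h k) := by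
  have e : fnBracket h k = (1 / 2 : ℝ) • ((fun x u v => h x (dNabla k x u v))
      + (fun x u v => k x (dNabla h x u v)) - (fun x u v => covEnd k x (h x u) v)
      - (fun x u v => covEnd h x (k x u) v) + (fun x u v => covEnd k x (h x v) u)
      + (fun x u v => covEnd h x (k x v) u)) := by
    funext x u v
    exact fnBracket_eq hh hk x u v
  rw [e]
  have d1 : SmoothTwo (fun x u v => covEnd k x (h x u) v) :=
    (smoothTwo_covEnd hk).comp (h := idEnd) (l := idEnd) smEnd_id hh smEnd_id
  have d2 : SmoothTwo (fun x u v => covEnd h x (k x u) v) :=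
    (smoothTwo_covEnd hh).comp (h := idEnd) (l := idEnd) smEnd_id hk smEnd_id
  have d3 : SmoothTwo (fun x u v => h x (dNabla k x u v)) :=
    (smoothTwo_dNabla hk).comp (k := idEnd) (l := idEnd) hh smEnd_id smEnd_id
  have d4 : SmoothTwo (fun x u v => k x (dNabla h x u v)) :=
    (smoothTwo_dNabla hh).comp (k := idEnd) (l := idEnd) hk smEnd_id smEnd_id
  have d5 : SmoothTwo (fun x u v => covEnd k x (h x v) u) := d1.swap
  have d6 : SmoothTwo (fun x u v => covEnd h x (k x v) u) := d2.swap
  exact (((((d3.add d4).sub d1).sub d2).add d5).add d6).const_smul _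

/-! ### Covariant derivatives of endomorphism fields with symmetries -/

theorem covEnd_symm {h : EndField I M} (hh : SmEnd h)
    (hs : ∀ (x : M) (u v : TangentSpace I x), (inner ℝ (h x u) v : ℝ) = inner ℝ u (h x v))
    (x : M) (t u v : TangentSpace I x) :
    (inner ℝ (covEnd h x t u) v : ℝ) = inner ℝ u (covEnd h x t v) := by
  have hu := smAt_extendVec u
  have hv := smAt_extendVec v
  have h1 := mvfderiv_inner (hh hu) hv t
  have h2 := mvfderiv_inner hu (hh hv) t
  simp only [hs, extendVec_self] at h1 h2
  rw [h2] at h1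
  simp only [covEnd, inner_sub_left, inner_sub_right, hs]
  linarith

theorem cov_parallel {J : EndField I M} (hJ : IsKaehler J) (hX : SmAt X x)
    (u : TangentSpace I x) :
    leviCivita I M (fun p => J p (X p)) x u = J x (leviCivita I M X x u) := by
  have h := covEnd_apply hJ.smooth.smEnd u hX
  rw [hJ.parallel] at h
  exact (sub_eq_zero.1 h.symm)

theorem covEnd_anti {J h : EndField I M} (hJ : IsKaehler J) (hh : SmEnd h)
    (ha : ∀ (x : M) (v : TangentSpace I x), h x (J x v) = -J x (h x v))
    (x : M) (u v : TangentSpace I x) :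
    covEnd h x u (J x v) = -J x (covEnd h x u v) := by
  have hv := smAt_extendVec v
  have hJs := hJ.smooth.smEnd
  have h1 := covEnd_apply hh u (hJs hv)
  have e : (fun p => h p (J p (extendVec v p))) = -fun p => J p (h p (extendVec v p)) := by
    funext p; simp [ha]
  rw [e, cov_neg (hJs (hh hv)), cov_parallel hJ hv, ha] at h1
  simp only [neg_apply, cov_parallel hJ (hh hv), extendVec_self] at h1
  rw [h1, covEnd, map_sub]
  abel

theorem covEnd_antiComm {h k : EndField I M} (hh : SmEnd h) (hk : SmEnd k) (x : M)
    (u v : TangentSpace I x) :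
    covEnd (antiComm h k) x u v = covEnd h x u (k x v) + h x (covEnd k x u v)
      + (covEnd k x u (h x v) + k x (covEnd h x u v)) := by
  have hv := smAt_extendVec v
  have e : (fun p => antiComm h k p (extendVec v p))
      = (fun p => h p (k p (extendVec v p))) + fun p => k p (h p (extendVec v p)) := by
    funext p; simp [antiComm]
  have h1 := covEnd_apply hh u (hk hv)
  have h2 := covEnd_apply hk u (hh hv)
  simp only [extendVec_self] at h1 h2
  rw [h1, h2]
  rw [covEnd, e, cov_add (hh (hk hv)) (hk (hh hv))]
  simp only [covEnd, antiComm, map_sub, add_apply, ContinuousLinearMap.comp_apply]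
  abel

/-! ### Curvature -/

/-- The curvature `R(U, V) Z` of the Levi-Civita connection on vector fields. -/
noncomputable def curvField (U V Z : VecField I M) (x : M) : TangentSpace I x :=
  leviCivita I M (nabla V Z) x (U x) - leviCivita I M (nabla U Z) x (V x)
    - leviCivita I M Z x (mlieBracket I U V x)

theorem curvField_swap (U V Z : VecField I M) (x : M) :
    curvField U V Z x = -curvField V U Z x := by
  simp only [curvField, mlieBracket_swap_apply (V := U) (W := V), map_neg]
  abel

theorem curvField_tensorial_left (hV : SmAt V x) (hZ : SmAt Z x) :
    SmTensorialAt (fun U => curvField U V Z x) x where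
  smul {f U} hf hU := by
    have e : nabla (f • U) Z = f • nabla U Z := by funext p; simp [nabla]
    simp only [curvField, e, cov_smul hf (hU.nabla hZ), mlieBracket_smul_left hf.mdiff hU.mdiff,
      map_add, map_smul, Pi.smul_apply', nabla_apply]
    module
  add {U U'} hU hU' := by
    have e : nabla (U + U') Z = nabla U Z + nabla U' Z := by funext p; simp [nabla]
    simp only [curvField, e, cov_add (hU.nabla hZ) (hU'.nabla hZ),
      mlieBracket_add_left hU.mdiff hU'.mdiff, map_add, Pi.add_apply, add_apply]
    abel

theorem curvField_tensorial_mid (hU : SmAt U x) (hZ : SmAt Z x) :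
    SmTensorialAt (fun V => curvField U V Z x) x := by
  have h := curvField_tensorial_left hU hZ
  refine ⟨fun hf hV => ?_, fun hV hW => ?_⟩
  · simp only [curvField_swap U, h.smul hf hV, smul_neg]
  · simp only [curvField_swap U, h.add hV hW, neg_add]

theorem curvField_tensorial_right (hU : SmAt U x) (hV : SmAt V x) :
    SmTensorialAt (fun Z => curvField U V Z x) x where
  smul {f Z} hf hZ := by
    have e : ∀ {V : VecField I M}, SmAt V x → ∀ᶠ p in 𝓝 x, nabla V (f • Z) p
        = (f • nabla V Z + (fun p => mvfderiv I f p (V p)) • Z) p := by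
      intro V hV
      filter_upwards [hf.eventually_mdiff, hZ.eventually_mdiff] with p hfp hZp
      rw [nabla_apply, (leviCivita I M).isCovariantDerivativeOnUniv.leibniz hZp hfp]
      simp [nabla]
    have s : ∀ {V : VecField I M}, SmAt V x →
        SmAt (f • nabla V Z + (fun p => mvfderiv I f p (V p)) • Z) x := fun hV =>
      (hf.smul (hV.nabla hZ)).add (FnAt.smul (SmAt.mvfderiv hf hV) hZ)
    have c := mvfderiv_commutator hf hU hV
    simp only [curvField, cov_congr (s hV) (e hV), cov_congr (s hU) (e hU),
      cov_add (hf.smul (hV.nabla hZ)) (FnAt.smul (SmAt.mvfderiv hf hV) hZ),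
      cov_add (hf.smul (hU.nabla hZ)) (FnAt.smul (SmAt.mvfderiv hf hU) hZ),
      add_apply, cov_smul hf (hV.nabla hZ), cov_smul hf (hU.nabla hZ), cov_smul hf hZ,
      cov_smul (SmAt.mvfderiv hf hV) hZ, cov_smul (SmAt.mvfderiv hf hU) hZ, ← c, nabla_apply]
    module
  add {Z Z'} hZ hZ' := by
    have e : ∀ V : VecField I M, ∀ᶠ p in 𝓝 x, nabla V (Z + Z') p
        = (nabla V Z + nabla V Z') p := by
      intro V
      filter_upwards [hZ.eventually_mdiff, hZ'.eventually_mdiff] with p hp hp'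
      rw [nabla_apply, (leviCivita I M).isCovariantDerivativeOnUniv.add hp hp']
      simp [nabla]
    simp only [curvField, cov_congr ((hV.nabla hZ).add (hV.nabla hZ')) (e V),
      cov_congr ((hU.nabla hZ).add (hU.nabla hZ')) (e U), cov_add (hV.nabla hZ) (hV.nabla hZ'),
      cov_add (hU.nabla hZ) (hU.nabla hZ'), cov_add hZ hZ', add_apply]
    abel

/-- The curvature tensor `R(u, v) w`. -/
noncomputable def curv (x : M) (u v w : TangentSpace I x) : TangentSpace I x :=
  curvField (extendVec u) (extendVec v) (extendVec w) x

theorem curvField_eq (hU : SmAt U x) (hV : SmAt V x) (hZ : SmAt Z x) :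
    curvField U V Z x = curv x (U x) (V x) (Z x) := by
  have eu := smAt_extendVec (U x)
  have ev := smAt_extendVec (V x)
  have ez := smAt_extendVec (Z x)
  rw [curv, (curvField_tensorial_left hV hZ).pointwise hU eu (extendVec_self _).symm,
    (curvField_tensorial_mid eu hZ).pointwise hV ev (extendVec_self _).symm,
    (curvField_tensorial_right eu ev).pointwise hZ ez (extendVec_self _).symm]

theorem curv_swap (x : M) (u v w : TangentSpace I x) : curv x u v w = -curv x v u w :=
  curvField_swap _ _ _ _

/-- The curvature as a trilinear map. -/
theorem exists_curv_trilinear (x : M) :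
    ∃ R : TangentSpace I x →ₗ[ℝ] TangentSpace I x →ₗ[ℝ] TangentSpace I x →ₗ[ℝ] TangentSpace I x,
      ∀ u v w, R u v w = curv x u v w := by
  have ar : ∀ u v w w' : TangentSpace I x, curv x u v (w + w') = curv x u v w + curv x u v w' := by
    intro u v w w'
    obtain ⟨L, hL⟩ := (curvField_tensorial_right (smAt_extendVec u) (smAt_extendVec v)).exists_linear
    simp only [curv, hL _ (smAt_extendVec _), extendVec_self, map_add]
  have sr : ∀ (r : ℝ) (u v w : TangentSpace I x), curv x u v (r • w) = r • curv x u v w := by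
    intro r u v w
    obtain ⟨L, hL⟩ := (curvField_tensorial_right (smAt_extendVec u) (smAt_extendVec v)).exists_linear
    simp only [curv, hL _ (smAt_extendVec _), extendVec_self, map_smul]
  have al : ∀ u u' v w : TangentSpace I x, curv x (u + u') v w = curv x u v w + curv x u' v w := by
    intro u u' v w
    obtain ⟨L, hL⟩ := (curvField_tensorial_left (smAt_extendVec v) (smAt_extendVec w)).exists_linear
    simp only [curv, hL _ (smAt_extendVec _), extendVec_self, map_add]
  have sl : ∀ (r : ℝ) (u v w : TangentSpace I x), curv x (r • u) v w = r • curv x u v w := by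
    intro r u v w
    obtain ⟨L, hL⟩ := (curvField_tensorial_left (smAt_extendVec v) (smAt_extendVec w)).exists_linear
    simp only [curv, hL _ (smAt_extendVec _), extendVec_self, map_smul]
  let R2 : TangentSpace I x → TangentSpace I x → TangentSpace I x →ₗ[ℝ] TangentSpace I x :=
    fun u v => { toFun := curv x u v, map_add' := ar u v, map_smul' := fun r => sr r u v }
  refine ⟨LinearMap.mk₂ ℝ R2 ?_ ?_ ?_ ?_, fun u v w => rfl⟩
  · intro u u' v; ext w; exact al u u' v w
  · intro r u v; ext w; exact sl r u v w
  · intro u v v'; ext w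
    change curv x u (v + v') w = curv x u v w + curv x u v' w
    rw [curv_swap x u, al, curv_swap x u, curv_swap x u]; abel
  · intro r u v; ext w
    change curv x u (r • v) w = r • curv x u v w
    rw [curv_swap x u, sl, curv_swap x u, smul_neg]

theorem curv_complex {J : EndField I M} (hJ : IsKaehler J) (x : M) (u v w : TangentSpace I x) :
    curv x u v (J x w) = J x (curv x u v w) := by
  have hu := smAt_extendVec u
  have hv := smAt_extendVec v
  have hw := smAt_extendVec w
  have hJs := hJ.smooth.smEnd
  have e : ∀ V : VecField I M, ∀ᶠ p in 𝓝 x, nabla V (fun p => J p (extendVec w p)) p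
      = J p (nabla V (extendVec w) p) := by
    intro V
    filter_upwards [eventually_smAt_extendVec w] with p hp
    exact cov_parallel hJ hp _
  have h1 := curvField_eq hu hv (hJs hw)
  simp only [extendVec_self] at h1
  rw [← h1, curv]
  simp only [curvField, cov_congr (hJs (hv.nabla hw)) (e _), cov_congr (hJs (hu.nabla hw)) (e _),
    cov_parallel hJ (hv.nabla hw), cov_parallel hJ (hu.nabla hw), cov_parallel hJ hw, map_sub]

theorem curv_skew (x : M) (u v w z : TangentSpace I x) :
    (inner ℝ (curv x u v w) z : ℝ) = -inner ℝ w (curv x u v z) := by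
  have hu := smAt_extendVec u
  have hv := smAt_extendVec v
  have hw := smAt_extendVec w
  have hz := smAt_extendVec z
  have c := mvfderiv_commutator (hw.inner hz) hu hv
  have e : ∀ {V : VecField I M}, SmAt V x →
      mvfderiv I (fun p => mvfderiv I (fun p => (inner ℝ (extendVec w p) (extendVec z p) : ℝ)) p
        (V p)) x = mvfderiv I (fun p => (inner ℝ (nabla V (extendVec w) p) (extendVec z p) : ℝ)) x
        + mvfderiv I (fun p => (inner ℝ (extendVec w p) (nabla V (extendVec z) p) : ℝ)) x := by
    intro V hV
    rw [← mvfderiv_fun_add ((hV.nabla hw).inner hz).mdiff (hw.inner (hV.nabla hz)).mdiff]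
    have : (fun p => mvfderiv I (fun p => (inner ℝ (extendVec w p) (extendVec z p) : ℝ)) p
        (V p)) =ᶠ[𝓝 x] fun p => (inner ℝ (nabla V (extendVec w) p) (extendVec z p) : ℝ)
          + inner ℝ (extendVec w p) (nabla V (extendVec z) p) := by
      filter_upwards [eventually_smAt_extendVec w, eventually_smAt_extendVec z] with p hp hp'
      exact mvfderiv_inner hp hp' _
    have h2 := this.mfderiv_eq (I := I) (I' := 𝓘(ℝ, ℝ))
    ext t
    exact congrArg (fun L : TangentSpace I x →L[ℝ] ℝ => L t) h2
  rw [e hu, e hv, mvfderiv_inner hw hz] at c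
  rw [add_apply, add_apply, mvfderiv_inner (hu.nabla hw) hz, mvfderiv_inner (hv.nabla hw) hz,
    mvfderiv_inner hw (hu.nabla hz), mvfderiv_inner hw (hv.nabla hz)] at c
  simp only [nabla_apply, extendVec_self] at c
  simp only [curv, curvField, inner_sub_left, inner_sub_right, extendVec_self]
  linarith

/-- The first Bianchi identity. -/
theorem curv_bianchi (x : M) (u v w : TangentSpace I x) :
    curv x u v w + curv x v w u + curv x w u v = 0 := by
  have hu := smAt_extendVec u
  have hv := smAt_extendVec v
  have hw := smAt_extendVec w
  have hI3 : IsManifold I (minSmoothness ℝ 3) M :=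
    IsManifold.of_le (n := ∞) (by simp only [minSmoothness_of_isRCLikeNormedField]; norm_cast)
  have le2 : minSmoothness ℝ 2 ≤ ∞ := by
    simp only [minSmoothness_of_isRCLikeNormedField]; norm_cast
  have e : ∀ {U V : VecField I M}, SmAt U x → SmAt V x →
      leviCivita I M (nabla U V) x - leviCivita I M (nabla V U) x
        = leviCivita I M (mlieBracket I U V) x := by
    intro U V hU hV
    rw [← cov_sub (hU.nabla hV) (hV.nabla hU)]
    refine (cov_congr ((hU.nabla hV).sub (hV.nabla hU)) ?_).symm
    filter_upwards [hU.eventually_mdiff, hV.eventually_mdiff] with p hp hp'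
    exact ((CovariantDerivative.torsion_eq_zero_iff _ |>.1 leviCivita_torsion) hp hp').symm
  have b1 := cov_bracket hu (hv.bracket hw)
  have b2 := cov_bracket hv (hw.bracket hu)
  have b3 := cov_bracket hw (hu.bracket hv)
  have e1 := congrArg (fun L => L u) (e hv hw)
  have e2 := congrArg (fun L => L v) (e hw hu)
  have e3 := congrArg (fun L => L w) (e hu hv)
  have j := leibniz_identity_mlieBracket_apply (ContMDiffAt.of_le hu le2)
    (ContMDiffAt.of_le hv le2) (ContMDiffAt.of_le hw le2)
  rw [mlieBracket_swap_apply (V := mlieBracket I _ _)] at j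
  have k : mlieBracket I (extendVec v) (mlieBracket I (extendVec u) (extendVec w)) x
      = -mlieBracket I (extendVec v) (mlieBracket I (extendVec w) (extendVec u)) x := by
    rw [mlieBracket_swap (V := extendVec u) (W := extendVec w)]
    have := mlieBracket_const_smul_right (V := extendVec v) (c := (-1 : ℝ)) (hw.bracket hu).mdiff
    simpa using this
  rw [k] at j
  simp only [extendVec_self, sub_apply] at b1 b2 b3 e1 e2 e3
  simp only [curv, curvField, extendVec_self]
  rw [← b1, ← b2, ← b3, ← e1, ← e2, ← e3, ← sub_eq_zero] at j
  rw [← j]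
  abel

/-- The second covariant derivatives of an endomorphism field commute up to curvature. -/
theorem covTwo_covEnd_comm {h : EndField I M} (hh : SmEnd h) (x : M)
    (u v w : TangentSpace I x) :
    covTwo (covEnd h) x u v w - covTwo (covEnd h) x v u w
      = curv x u v (h x w) - h x (curv x u v w) := by
  have hu := smAt_extendVec u
  have hv := smAt_extendVec v
  have hw := smAt_extendVec w
  have e : ∀ {V : VecField I M}, SmAt V x →
      leviCivita I M (fun p => covEnd h p (V p) (extendVec w p)) x
        = leviCivita I M (nabla V fun p => h p (extendVec w p)) x
          - leviCivita I M (fun p => h p (nabla V (extendVec w) p)) x := by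
    intro V hV
    rw [← cov_sub (hV.nabla (hh hw)) (hh (hV.nabla hw))]
    refine cov_congr ((hV.nabla (hh hw)).sub (hh (hV.nabla hw))) ?_
    filter_upwards [eventually_smAt_extendVec w] with p hp
    exact covEnd_apply hh _ hp
  have h1 := curvField_eq hu hv (hh hw)
  simp only [extendVec_self] at h1
  have b := cov_bracket hu hv
  have k1 : covEnd h x (leviCivita I M (extendVec v) x u) w - covEnd h x
      (leviCivita I M (extendVec u) x v) w = covEnd h x (mlieBracket I (extendVec u) (extendVec v) x) w := by
    rw [← b]
    simp only [covEnd, map_sub, extendVec_self]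
    abel
  have c1 := covEnd_apply hh v (hu.nabla hw)
  have c2 := covEnd_apply hh u (hv.nabla hw)
  simp only [nabla_apply, extendVec_self] at c1 c2
  have k2 : covEnd h x (leviCivita I M (extendVec v) x u) w
      = covEnd h x (leviCivita I M (extendVec u) x v) w
        + covEnd h x (mlieBracket I (extendVec u) (extendVec v) x) w := by rw [← k1]; abel
  rw [← h1]
  simp only [covTwo, e hu, e hv, c1, c2, k2, curv, curvField, extendVec_self, map_sub, sub_apply]
  simp only [covEnd, nabla_apply]
  abel

end Curvature
section HermitianAlgebra

variable {V : Type*} [NormedAddCommGroup V] [InnerProductSpace ℝ V] {ι : Type*} [Fintype ι]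

/-- An orthogonal complex structure on a Euclidean vector space. -/
structure IsHermitian (J : V →ₗ[ℝ] V) : Prop where
  sq : ∀ v, J (J v) = -v
  orth : ∀ u v, (inner ℝ (J u) (J v) : ℝ) = inner ℝ u v

variable {J : V →ₗ[ℝ] V} (b : OrthonormalBasis ι ℝ V)

theorem IsHermitian.skew (hJ : IsHermitian J) (u v : V) :
    (inner ℝ (J u) v : ℝ) = -inner ℝ u (J v) := by
  rw [← hJ.orth u (J v), hJ.sq, inner_neg_right, neg_neg]

theorem IsHermitian.sum_inner (hJ : IsHermitian J) (L L' : V →ₗ[ℝ] V) :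
    ∑ i, (inner ℝ (L (J (b i))) (L' (J (b i))) : ℝ) = ∑ i, inner ℝ (L (b i)) (L' (b i)) :=
  sum_bilin_complex ((innerₗ V).compl₁₂ L L') b hJ.sq hJ.orth

theorem sum_inner_symm {a : V →ₗ[ℝ] V} (ha : ∀ u v, (inner ℝ (a u) v : ℝ) = inner ℝ u (a v))
    (L L' : V →ₗ[ℝ] V) :
    ∑ i, (inner ℝ (L (a (b i))) (L' (b i)) : ℝ) = ∑ i, inner ℝ (L (b i)) (L' (a (b i))) :=
  sum_bilin_symm ((innerₗ V).compl₁₂ L L') b ha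

/-- Symmetric endomorphisms which anti-commute with the complex structure. -/
structure IsSymAntiLin (J a : V →ₗ[ℝ] V) : Prop where
  symm : ∀ u v, (inner ℝ (a u) v : ℝ) = inner ℝ u (a v)
  anti : ∀ v, a (J v) = -J (a v)

variable {a c : V →ₗ[ℝ] V} {A B C : V →ₗ[ℝ] V →ₗ[ℝ] V}

/-- Invariance of the product of two tensors under the complex structure. -/
theorem IsHermitian.sum_two (hJ : IsHermitian J) (α β : V →ₗ[ℝ] V →ₗ[ℝ] V) :
    ∑ i, ∑ j, (inner ℝ (α (J (b i)) (J (b j))) (β (J (b i)) (J (b j))) : ℝ)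
      = ∑ i, ∑ j, inner ℝ (α (b i) (b j)) (β (b i) (b j)) := by
  simp only [hJ.sum_inner b (α _) (β _)]
  rw [Finset.sum_comm, Finset.sum_comm (f := fun i j => (inner ℝ (α (b i) (b j)) _ : ℝ))]
  exact Finset.sum_congr rfl fun j _ => hJ.sum_inner b (α.flip (b j)) (β.flip (b j))

theorem sum_comp_left (hJ : IsHermitian J) (ha : IsSymAntiLin J a)
    (hB : ∀ u v, B u (J v) = -J (B u v)) (hC : ∀ u v, C u (J v) = -J (C u v)) :
    ∑ i, ∑ j, (inner ℝ (a (B (b i) (b j))) (C (J (b i)) (J (b j))) : ℝ) = 0 := by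
  refine Finset.sum_eq_zero fun i _ => ?_
  have h := hJ.sum_inner b (a ∘ₗ B (b i)) (C (J (b i)) ∘ₗ J)
  simp only [LinearMap.comp_apply, hB, hC, map_neg, ha.anti, neg_neg, hJ.orth, inner_neg_right]
    at h ⊢
  simp only [Finset.sum_neg_distrib] at h ⊢
  linarith

theorem sum_precomp (hJ : IsHermitian J) (ha : IsSymAntiLin J a)
    (hB : ∀ u v, B u (J v) = -J (B u v)) (hC : ∀ u v, C u (J v) = -J (C u v)) :
    ∑ i, ∑ j, (inner ℝ (C (a (b i)) (b j)) (B (J (b i)) (J (b j))) : ℝ)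
      = -∑ i, ∑ j, inner ℝ (B (a (b i)) (b j)) (C (J (b i)) (J (b j))) := by
  rw [Finset.sum_comm]
  have h1 : ∀ j, ∑ i, (inner ℝ (C (a (b i)) (b j)) (B (J (b i)) (J (b j))) : ℝ)
      = ∑ i, inner ℝ (C (J (b i)) (b j)) (B (a (b i)) (J (b j))) := by
    intro j
    have h := sum_inner_symm b ha.symm (C.flip (b j)) (B.flip (J (b j)) ∘ₗ J)
    have h' := hJ.sum_inner b (C.flip (b j)) (B.flip (J (b j)) ∘ₗ J ∘ₗ a)
    simp only [LinearMap.comp_apply, LinearMap.flip_apply, ha.anti, map_neg, hJ.sq, neg_neg]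
      at h h'
    rw [h, ← h']
  simp only [h1]
  rw [Finset.sum_comm, ← Finset.sum_neg_distrib]
  refine Finset.sum_congr rfl fun i _ => ?_
  rw [← Finset.sum_neg_distrib]
  refine Finset.sum_congr rfl fun j _ => ?_
  rw [hB, hC, inner_neg_right, inner_neg_right, ← hJ.skew, neg_neg, real_inner_comm]

theorem sum_swap_left (hJ : IsHermitian J) (ha : IsSymAntiLin J a)
    (hB : ∀ u v, B u (J v) = -J (B u v)) (hC : ∀ u v, C u (J v) = -J (C u v)) :
    ∑ i, ∑ j, (inner ℝ (a (B (b j) (b i))) (C (J (b i)) (J (b j))) : ℝ)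
      = ∑ i, ∑ j, inner ℝ (a (B (b j) (b i))) (C (b i) (b j)) := by
  rw [Finset.sum_comm, Finset.sum_comm (f := fun i j => (inner ℝ (a (B (b j) (b i))) _ : ℝ))]
  refine Finset.sum_congr rfl fun j _ => ?_
  have h := hJ.sum_inner b (a ∘ₗ B (b j)) (C.flip (b j))
  simp only [LinearMap.comp_apply, LinearMap.flip_apply] at h
  rw [← h]
  refine Finset.sum_congr rfl fun i _ => ?_
  rw [hB, hC, map_neg, ha.anti, neg_neg, inner_neg_right, hJ.skew]

theorem sum_swap_precomp (hJ : IsHermitian J) (ha : IsSymAntiLin J a)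
    (hB : ∀ u v, B u (J v) = -J (B u v)) (hC : ∀ u v, C u (J v) = -J (C u v)) :
    ∑ i, ∑ j, (inner ℝ (B (a (b j)) (b i)) (C (J (b i)) (J (b j))) : ℝ)
      = -∑ i, ∑ j, inner ℝ (C (b j) (a (b i))) (B (b i) (b j)) := by
  rw [Finset.sum_comm]
  have h1 : ∀ j, ∑ i, (inner ℝ (B (a (b j)) (b i)) (C (J (b i)) (J (b j))) : ℝ)
      = -∑ i, inner ℝ (B (a (b j)) (b i)) (C (b i) (b j)) := by
    intro j
    have h := hJ.sum_inner b (B (a (b j))) (C.flip (b j))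
    simp only [LinearMap.flip_apply] at h
    rw [← h, ← Finset.sum_neg_distrib]
    refine Finset.sum_congr rfl fun i _ => ?_
    rw [hB, hC, inner_neg_right, inner_neg_left, hJ.skew, neg_neg]
  simp only [h1]
  rw [Finset.sum_neg_distrib, Finset.sum_comm, Finset.sum_comm (f := fun i j =>
    (inner ℝ (C (b j) (a (b i))) (B (b i) (b j)) : ℝ))]
  congr 1
  refine Finset.sum_congr rfl fun i _ => ?_
  have h := sum_inner_symm b ha.symm (B.flip (b i)) (C (b i))
  simp only [LinearMap.flip_apply] at h
  rw [h]
  exact Finset.sum_congr rfl fun j _ => real_inner_comm _ _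

/-- Twice the Frölicher-Nijenhuis bracket, at a point, in terms of covariant derivatives. -/
def bracketLin (a b : V →ₗ[ℝ] V) (A B : V →ₗ[ℝ] V →ₗ[ℝ] V) (u v : V) : V :=
  a (B u v - B v u) + b (A u v - A v u) - B (a u) v - A (b u) v + B (a v) u + A (b v) u

/-- The covariant derivative of the anti-commutator at a point. -/
def antiCommLin (a b : V →ₗ[ℝ] V) (A B : V →ₗ[ℝ] V →ₗ[ℝ] V) (u v : V) : V :=
  A u (b v) + a (B u v) + (B u (a v) + b (A u v))

variable {k l : V →ₗ[ℝ] V}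

theorem sum_bracketLin (hJ : IsHermitian J) (ha : IsSymAntiLin J a) (hk : IsSymAntiLin J k)
    (hA : ∀ u v, A u (J v) = -J (A u v)) (hB : ∀ u v, B u (J v) = -J (B u v))
    (hC : ∀ u v, C u (J v) = -J (C u v)) :
    ∑ i, ∑ j, (inner ℝ (bracketLin a k A B (b i) (b j)) (C (J (b i)) (J (b j))) : ℝ)
      = -∑ i, ∑ j, inner ℝ (a (B (b j) (b i))) (C (b i) (b j))
        - ∑ i, ∑ j, inner ℝ (k (A (b j) (b i))) (C (b i) (b j))
        - ∑ i, ∑ j, inner ℝ (C (b j) (a (b i))) (B (b i) (b j))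
        - ∑ i, ∑ j, inner ℝ (C (b j) (k (b i))) (A (b i) (b j))
        - ∑ i, ∑ j, inner ℝ (B (a (b i)) (b j)) (C (J (b i)) (J (b j)))
        - ∑ i, ∑ j, inner ℝ (A (k (b i)) (b j)) (C (J (b i)) (J (b j))) := by
  have e1 := sum_comp_left b hJ ha hB hC
  have e2 := sum_comp_left b hJ hk hA hC
  have e3 := sum_swap_left b hJ ha hB hC
  have e4 := sum_swap_left b hJ hk hA hC
  have e5 := sum_swap_precomp b hJ ha hB hC
  have e6 := sum_swap_precomp b hJ hk hA hC
  simp only [bracketLin, map_sub, inner_add_left, inner_sub_left, Finset.sum_add_distrib,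
    Finset.sum_sub_distrib, e1, e2, e3, e4, e5, e6]
  ring

/-- The cyclic sum of the pointwise products of the bracket with `d_∇(J·, J·)`. -/
theorem cyclic_sum_bracketLin (hJ : IsHermitian J) (ha : IsSymAntiLin J a)
    (hk : IsSymAntiLin J k) (hc : IsSymAntiLin J c)
    (hA : ∀ u v, A u (J v) = -J (A u v)) (hB : ∀ u v, B u (J v) = -J (B u v))
    (hC : ∀ u v, C u (J v) = -J (C u v)) :
    ∑ i, ∑ j, (inner ℝ (bracketLin a k A B (b i) (b j)) (C (J (b i)) (J (b j))) : ℝ)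
      + ∑ i, ∑ j, (inner ℝ (bracketLin k c B C (b i) (b j)) (A (J (b i)) (J (b j))) : ℝ)
      + ∑ i, ∑ j, (inner ℝ (bracketLin c a C A (b i) (b j)) (B (J (b i)) (J (b j))) : ℝ)
      = -(∑ i, ∑ j, (inner ℝ (antiCommLin a k A B (b j) (b i)) (C (b i) (b j)) : ℝ)
        + ∑ i, ∑ j, (inner ℝ (antiCommLin k c B C (b j) (b i)) (A (b i) (b j)) : ℝ)
        + ∑ i, ∑ j, (inner ℝ (antiCommLin c a C A (b j) (b i)) (B (b i) (b j)) : ℝ)) := by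
  rw [sum_bracketLin b hJ ha hk hA hB hC, sum_bracketLin b hJ hk hc hB hC hA,
    sum_bracketLin b hJ hc ha hC hA hB, sum_precomp b hJ ha hB hC, sum_precomp b hJ hk hC hA,
    sum_precomp b hJ hc hA hB]
  simp only [antiCommLin, inner_add_left, Finset.sum_add_distrib]
  ring

/-- A tensor of type `λ²₋` is orthogonal to the complement of `λ²₋`. -/
theorem sum_inner_lambdaMinus (hJ : IsHermitian J) (α β : V →ₗ[ℝ] V →ₗ[ℝ] V)
    (h1 : ∀ u v, β (J u) (J v) = -β u v) (h2 : ∀ u v, β u (J v) = -J (β u v)) :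
    ∑ i, ∑ j, (inner ℝ ((1 / 2 : ℝ) • ((1 / 2 : ℝ) • (α (b i) (b j) - α (J (b i)) (J (b j)))
        + J ((1 / 2 : ℝ) • (α (b i) (J (b j)) - α (J (b i)) (J (J (b j)))))))
        (β (b i) (b j)) : ℝ)
      = ∑ i, ∑ j, inner ℝ (α (b i) (b j)) (β (b i) (b j)) := by
  have e1 : ∑ i, ∑ j, (inner ℝ (α (J (b i)) (J (b j))) (β (b i) (b j)) : ℝ)
      = -∑ i, ∑ j, inner ℝ (α (b i) (b j)) (β (b i) (b j)) := by
    rw [← hJ.sum_two b α β]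
    simp only [h1, inner_neg_right, Finset.sum_neg_distrib, neg_neg]
  have e2 : ∑ i, ∑ j, (inner ℝ (J (α (b i) (J (b j)))) (β (b i) (b j)) : ℝ)
      = ∑ i, ∑ j, inner ℝ (α (b i) (b j)) (β (b i) (b j)) := by
    refine Finset.sum_congr rfl fun i _ => ?_
    rw [← hJ.sum_inner b (α (b i)) (β (b i))]
    refine Finset.sum_congr rfl fun j _ => ?_
    rw [h2, inner_neg_right, hJ.skew]
  have e3 : ∑ i, ∑ j, (inner ℝ (J (α (J (b i)) (b j))) (β (b i) (b j)) : ℝ)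
      = ∑ i, ∑ j, inner ℝ (α (b i) (b j)) (β (b i) (b j)) := by
    rw [Finset.sum_comm, Finset.sum_comm (f := fun i j =>
      (inner ℝ (α (b i) (b j)) (β (b i) (b j)) : ℝ))]
    refine Finset.sum_congr rfl fun j _ => ?_
    have h := hJ.sum_inner b (α.flip (b j)) (β.flip (b j))
    simp only [LinearMap.flip_apply] at h
    rw [← h]
    refine Finset.sum_congr rfl fun i _ => ?_
    have : β (J (b i)) (b j) = -J (β (b i) (b j)) := by
      have := h2 (J (b i)) (b j)
      rw [h1] at this
      rw [← neg_eq_iff_eq_neg] at this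
      have h3 := congrArg J this
      rw [neg_neg, hJ.sq] at h3
      rw [h3, neg_neg]
    rw [this, inner_neg_right, hJ.skew]
  simp only [hJ.sq, map_neg, sub_neg_eq_add, map_add, map_smul, inner_add_left, inner_sub_left,
    real_inner_smul_left, Finset.sum_add_distrib, Finset.sum_sub_distrib, ← Finset.mul_sum,
    e1, e2, e3]
  ring

/-- An algebraic curvature operator which commutes with the complex structure is of type `(1,1)`. -/
theorem curvature_type (hJ : IsHermitian J) (R : V →ₗ[ℝ] V →ₗ[ℝ] V →ₗ[ℝ] V)
    (hc : ∀ u v w, R u v (J w) = J (R u v w))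
    (hs : ∀ u v w z, (inner ℝ (R u v w) z : ℝ) = -inner ℝ w (R u v z))
    (hb : ∀ u v w, R u v w + R v w u + R w u v = 0) (u v w : V) :
    R (J u) (J v) w = R u v w := by
  have key : ∀ u v w, R u v w - R (J u) (J v) w + J (R (J u) v w + R u (J v) w) = 0 := by
    intro u v w
    have b1 := hb u v w
    have b2 := hb (J u) (J v) w
    have b3 := congrArg J (hb (J u) v w)
    have b4 := congrArg J (hb u (J v) w)
    simp only [hc, map_add, map_zero, hJ.sq] at b2 b3 b4
    rw [map_add]
    have : R u v w - R (J u) (J v) w + (J (R (J u) v w) + J (R u (J v) w))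
      = (R u v w + R v w u + R w u v)
        - (R (J u) (J v) w + J (R (J v) w u) + J (R w (J u) v))
        + (J (R (J u) v w) + -(R v w u) + J (R w (J u) v))
        + (J (R u (J v) w) + J (R (J v) w u) + -(R w u v)) := by abel
    rw [this, b1, b2, b3, b4]
    simp
  have key2 : ∀ w, R u v w - R (J u) (J v) w = J (R (J u) v w + R u (J v) w) := by
    intro w
    refine ext_inner_right ℝ fun z => ?_
    have h := congrArg (fun t => (inner ℝ w t : ℝ)) (key u v z)
    simp only [inner_add_right, inner_sub_right, map_add, inner_zero_right] at h
    have q : ∀ u v, (inner ℝ w (J (R u v z)) : ℝ) = inner ℝ (J (R u v w)) z := by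
      intro u v
      rw [hJ.skew, hs, hc, neg_neg]
    simp only [inner_sub_left, map_add, inner_add_left, hs, ← q]
    linarith
  have h1 := key u v w
  rw [← key2, ← two_smul ℝ, smul_eq_zero] at h1
  exact (sub_eq_zero.1 (h1.resolve_left two_ne_zero)).symm

theorem sum_curvature_eq_zero (hJ : IsHermitian J) (R : V →ₗ[ℝ] V →ₗ[ℝ] V →ₗ[ℝ] V)
    (hc : ∀ u v w, R u v (J w) = J (R u v w)) (ht : ∀ u v w, R (J u) (J v) w = R u v w)
    (ha : ∀ v, a (J v) = -J (a v)) (hk : ∀ v, k (J v) = J (k v)) :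
    ∑ i, ∑ j, (inner ℝ (R (b i) (b j) (a (b i)) - a (R (b i) (b j) (b i))) (k (b j)) : ℝ)
      = 0 := by
  have h1 : ∀ j, ∑ i, (R (b i) (b j) (a (b i)) - a (R (b i) (b j) (b i)))
      = ∑ i, (R (J (b i)) (b j) (a (J (b i))) - a (R (J (b i)) (b j) (J (b i)))) := by
    intro j
    exact (sum_bilin_complex ((R.flip (b j)).compl₂ a - (R.flip (b j)).compr₂ a) b hJ.sq
      hJ.orth).symm
  have h2 : ∑ j, ∑ i, (inner ℝ (R (b i) (b j) (a (b i)) - a (R (b i) (b j) (b i)))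
        (k (b j)) : ℝ)
      = ∑ j, ∑ i, inner ℝ (R (b i) (J (b j)) (a (b i)) - a (R (b i) (J (b j)) (b i)))
        (k (J (b j))) := by
    rw [Finset.sum_comm, Finset.sum_comm (f := fun j i => (inner ℝ (R (b i) (J (b j)) _ - _) _ : ℝ))]
    refine Finset.sum_congr rfl fun i _ => ?_
    exact (hJ.sum_inner b ((R (b i)).flip (a (b i)) - a ∘ₗ (R (b i)).flip (b i)) k).symm
  have h3 : ∀ j, ∑ i, (R (b i) (J (b j)) (a (b i)) - a (R (b i) (J (b j)) (b i)))
      = ∑ i, (R (J (b i)) (J (b j)) (a (J (b i))) - a (R (J (b i)) (J (b j)) (J (b i)))) := by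
    intro j
    exact (sum_bilin_complex ((R.flip (J (b j))).compl₂ a - (R.flip (J (b j))).compr₂ a) b hJ.sq
      hJ.orth).symm
  rw [Finset.sum_comm]
  have h4 : ∑ j, ∑ i, (inner ℝ (R (b i) (b j) (a (b i)) - a (R (b i) (b j) (b i)))
      (k (b j)) : ℝ) = -∑ j, ∑ i, (inner ℝ (R (b i) (b j) (a (b i)) - a (R (b i) (b j) (b i)))
      (k (b j)) : ℝ) := by
    conv_lhs => rw [h2]
    simp only [← sum_inner, h3]
    simp only [ht, hc, ha, hk, map_neg, sum_inner]
    rw [← Finset.sum_neg_distrib]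
    refine Finset.sum_congr rfl fun j _ => ?_
    rw [← Finset.sum_neg_distrib]
    refine Finset.sum_congr rfl fun i _ => ?_
    rw [← hJ.orth (R (b i) (b j) (a (b i)) - a (R (b i) (b j) (b i))), ← inner_neg_left]
    congr 1
    rw [map_sub]
    abel
  linarith

end HermitianAlgebra
section Pointwise

variable {E : Type*} [NormedAddCommGroup E] [NormedSpace ℝ E] [FiniteDimensional ℝ E]
  {H : Type*} [TopologicalSpace H] {I : ModelWithCorners ℝ E H}
  {M : Type*} [TopologicalSpace M] [ChartedSpace H M] [IsManifold I ∞ M]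
  [RiemannianBundle (fun x : M => TangentSpace I x)]
  [IsContMDiffRiemannianBundle I ∞ E (fun x : M => TangentSpace I x)]
  {J a b c K : EndField I M}

theorem innerTwo_eq {α β : TwoTensor I M} (hα : SmoothTwo α) (hβ : SmoothTwo β) {x : M}
    {ι : Type*} [Fintype ι] (b : OrthonormalBasis ι ℝ (TangentSpace I x)) :
    innerTwo x (α x) (β x) = 1 / 2 * ∑ i, ∑ j, inner ℝ (α x (b i) (b j)) (β x (b i) (b j)) := by
  have h1 : ∀ i, ∑ j, (inner ℝ (α x (orthoFrame x i) (orthoFrame x j))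
      (β x (orthoFrame x i) (orthoFrame x j)) : ℝ)
      = ∑ j, inner ℝ (α x (orthoFrame x i) (b j)) (β x (orthoFrame x i) (b j)) := fun i =>
    sum_bilin_eq ((innerₗ _).compl₁₂ (hα.toBilin x (orthoFrame x i))
      (hβ.toBilin x (orthoFrame x i))) _ b
  have h2 : ∀ j, ∑ i, (inner ℝ (α x (orthoFrame x i) (b j)) (β x (orthoFrame x i) (b j)) : ℝ)
      = ∑ i, inner ℝ (α x (b i) (b j)) (β x (b i) (b j)) := fun j =>
    sum_bilin_eq ((innerₗ _).compl₁₂ ((hα.toBilin x).flip (b j))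
      ((hβ.toBilin x).flip (b j))) _ b
  rw [innerTwo]
  congr 1
  simp only [h1]
  rw [Finset.sum_comm]
  simp only [h2]
  rw [Finset.sum_comm]

theorem fnAt_innerTwo {α β : TwoTensor I M} (hα : SmoothTwo α) (hβ : SmoothTwo β) (x : M) :
    FnAt I (fun p => innerTwo p (α p) (β p)) x := by
  obtain ⟨e, hex, hes, hev⟩ := exists_orthoFrame (orthoFrame (I := I) x)
  have he := hes.self_of_nhds
  have h : FnAt I (fun p => 1 / 2 * ∑ i, ∑ j,
      (inner ℝ (α p (e i p) (e j p)) (β p (e i p) (e j p)) : ℝ)) x :=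
    contMDiffAt_const.mul (ContMDiffAt.sum fun i _ => ContMDiffAt.sum fun j _ =>
      (hα.smooth (he i) (he j)).inner (hβ.smooth (he i) (he j)))
  refine h.congr_of_eventuallyEq ?_
  filter_upwards [hev] with p ⟨b, hb⟩
  rw [innerTwo_eq hα hβ b]
  simp only [hb]

/-- The divergence on `2`-forms is the formal adjoint of `d_∇`, up to a divergence. -/
theorem innerEnd_divTwo {α : TwoTensor I M} (hα : SmoothTwo α)
    (hs : ∀ x u v, α x u v = -α x v u) {h : EndField I M} (hh : SmEnd h) (x : M) :
    innerEnd x (divTwo α x) (fun v => h x v) = innerTwo x (α x) (dNabla h x)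
      - divField (trField fun x v w => adjTwo α x v (h x w)) x := by
  rw [divField_trField_adjTwo hα hh]
  have h1 : innerTwo x (α x) (dNabla h x) = ∑ k, ∑ j,
      inner ℝ (α x (orthoFrame x k) (orthoFrame x j))
        (covEnd h x (orthoFrame x k) (orthoFrame x j)) := by
    have e : ∑ k, ∑ j, (inner ℝ (α x (orthoFrame x k) (orthoFrame x j))
        (covEnd h x (orthoFrame x j) (orthoFrame x k)) : ℝ) = -∑ k, ∑ j,
        inner ℝ (α x (orthoFrame x k) (orthoFrame x j))
          (covEnd h x (orthoFrame x k) (orthoFrame x j)) := by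
      rw [Finset.sum_comm]
      simp only [← Finset.sum_neg_distrib]
      refine Finset.sum_congr rfl fun k _ => Finset.sum_congr rfl fun j _ => ?_
      rw [hs x, inner_neg_left]
    simp only [innerTwo, dNabla, inner_sub_right, Finset.sum_sub_distrib, e]
    ring
  have h2 : innerEnd x (divTwo α x) (fun v => h x v) = -∑ k, ∑ j,
      inner ℝ (covTwo α x (orthoFrame x k) (orthoFrame x k) (orthoFrame x j))
        (h x (orthoFrame x j)) := by
    simp only [innerEnd, divTwo, inner_neg_left, sum_inner, Finset.sum_neg_distrib]
    rw [Finset.sum_comm]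
  rw [h1, h2]
  simp only [Finset.sum_add_distrib]
  ring

theorem IsKaehler.isHermitian (hJ : IsKaehler J) (x : M) :
    IsHermitian (J x : TangentSpace I x →ₗ[ℝ] TangentSpace I x) :=
  ⟨hJ.sq x, hJ.orthogonal x⟩

theorem IsSymAnti.smEnd (ha : IsSymAnti J a) : SmEnd a := ha.smooth.smEnd

theorem IsSymAnti.isSymAntiLin (ha : IsSymAnti J a) (x : M) :
    IsSymAntiLin (J x : TangentSpace I x →ₗ[ℝ] TangentSpace I x) (a x) :=
  ⟨ha.symm x, ha.anti x⟩

theorem IsSymAnti.antiComm_complex (ha : IsSymAnti J a) (hb : IsSymAnti J b) (x : M)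
    (v : TangentSpace I x) : antiComm a b x (J x v) = J x (antiComm a b x v) := by
  simp [antiComm, ha.anti, hb.anti]

theorem IsSymAnti.antiComm_symm (ha : IsSymAnti J a) (hb : IsSymAnti J b) (x : M)
    (u v : TangentSpace I x) :
    (inner ℝ (antiComm a b x u) v : ℝ) = inner ℝ u (antiComm a b x v) := by
  simp [antiComm, inner_add_left, inner_add_right, ha.symm, hb.symm, add_comm]

/-- The vector field `∑ (∇_{e_k} c) (K e_k)`, written as a trace. -/
noncomputable def ibpField (K c : EndField I M) : VecField I M :=
  trField (fun x v w => adjTwo (fun x u v => covEnd c x v u) x v (K x w))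
    - fun x => K x (trField (covEnd c) x)

theorem smAt_ibpField (hK : SmEnd K) (hc : SmEnd c) (x : M) : SmAt (ibpField K c) x :=
  (SmoothTwo.smAt_trField ((smoothTwo_covEnd hc).swap.adj.comp smEnd_id smEnd_id hK) x).sub
    (hK ((smoothTwo_covEnd hc).smAt_trField x))

/-- On a Kähler manifold, interchanging two derivatives in `⟨δK, δc⟩` produces only a divergence. -/
theorem divField_ibpField (hJ : IsKaehler J) (hc : IsSymAnti J c) (hK : SmEnd K)
    (hKs : ∀ (x : M) (u v : TangentSpace I x), (inner ℝ (K x u) v : ℝ) = inner ℝ u (K x v))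
    (hKJ : ∀ (x : M) (v : TangentSpace I x), K x (J x v) = J x (K x v)) (x : M) :
    divField (ibpField K c) x = ∑ i, ∑ j,
      (inner ℝ (covEnd K x (orthoFrame x j) (orthoFrame x i))
        (covEnd c x (orthoFrame x i) (orthoFrame x j)) : ℝ)
      - inner ℝ (divEnd K x) (divEnd c x) := by
  have hB := smoothTwo_covEnd hc.smEnd
  have s1 : SmAt (trField (fun x v w => adjTwo (fun x u v => covEnd c x v u) x v (K x w))) x :=
    SmoothTwo.smAt_trField (hB.swap.adj.comp (h := idEnd) (k := idEnd) smEnd_id smEnd_id hK) x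
  have s2 := hB.smAt_trField x
  have d1 : divField (ibpField K c) x
      = divField (trField (fun x v w => adjTwo (fun x u v => covEnd c x v u) x v (K x w))) x
        - divField (fun x => K x (trField (covEnd c) x)) x := by
    rw [divField, ibpField, cov_sub s1 (hK s2)]
    simp only [sub_apply, inner_sub_left, Finset.sum_sub_distrib]
    rfl
  have d2 : divField (fun x => K x (trField (covEnd c) x)) x
      = inner ℝ (divEnd K x) (divEnd c x) + ∑ k, ∑ j,
        inner ℝ (covTwo (covEnd c) x (orthoFrame x k) (orthoFrame x j) (orthoFrame x j))
          (K x (orthoFrame x k)) := by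
    have e : ∀ u, leviCivita I M (fun x => K x (trField (covEnd c) x)) x u
        = covEnd K x u (trField (covEnd c) x) + K x (leviCivita I M (trField (covEnd c)) x u) := by
      intro u
      rw [covEnd_apply hK u s2]
      abel
    have e2 : divEnd c x = -trField (covEnd c) x := rfl
    have e3 : (inner ℝ (divEnd K x) (divEnd c x) : ℝ)
        = ∑ k, inner ℝ (covEnd K x (orthoFrame x k) (trField (covEnd c) x)) (orthoFrame x k) := by
      rw [e2, divEnd, inner_neg_neg, sum_inner]
      exact Finset.sum_congr rfl fun k _ => by
        rw [covEnd_symm hK hKs]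
        exact real_inner_comm _ _
    rw [e3]
    simp only [divField, e, inner_add_left, Finset.sum_add_distrib, hKs, hB.cov_trField, sum_inner]
  have d3 := divField_trField_adjTwo hB.swap hK x
  obtain ⟨R, hR⟩ := exists_curv_trilinear (I := I) x
  have hH := hJ.isHermitian x
  have d4 := sum_curvature_eq_zero (orthoFrame x) (a := (c x : TangentSpace I x →ₗ[ℝ] _))
    (k := (K x : TangentSpace I x →ₗ[ℝ] _)) hH R
    (fun u v w => by simp only [hR]; exact curv_complex hJ x u v w)
    (curvature_type hH R (fun u v w => by simp only [hR]; exact curv_complex hJ x u v w)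
      (fun u v w z => by simp only [hR]; exact curv_skew x u v w z)
      (fun u v w => by simp only [hR]; exact curv_bianchi x u v w)) (hc.anti x) (hKJ x)
  simp only [hR, ContinuousLinearMap.coe_coe, ← covTwo_covEnd_comm hc.smEnd, inner_sub_left,
    Finset.sum_sub_distrib] at d4
  rw [d1, d2, d3]
  simp only [covTwo_swap, Finset.sum_add_distrib]
  rw [Finset.sum_comm (f := fun k j => (inner ℝ (covTwo (covEnd c) x (orthoFrame x k)
    (orthoFrame x j) (orthoFrame x j)) _ : ℝ))]
  have d5 : ∑ k, ∑ j, (inner ℝ (covEnd c x (orthoFrame x j) (orthoFrame x k))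
      (covEnd K x (orthoFrame x k) (orthoFrame x j)) : ℝ) = ∑ i, ∑ j,
      (inner ℝ (covEnd K x (orthoFrame x j) (orthoFrame x i))
        (covEnd c x (orthoFrame x i) (orthoFrame x j)) : ℝ) := by
    rw [Finset.sum_comm]
    exact Finset.sum_congr rfl fun i _ => Finset.sum_congr rfl fun j _ => real_inner_comm _ _
  rw [d5]
  linarith

theorem smoothTwo_lambdaPart (hJ : SmEnd J) {α : TwoTensor I M} (hα : SmoothTwo α) :
    SmoothTwo (lambdaPart J α) :=
  (hα.sub (hα.comp smEnd_id hJ hJ)).const_smul (1 / 2)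

theorem smoothTwo_lambdaMinusPart (hJ : SmEnd J) {α : TwoTensor I M} (hα : SmoothTwo α) :
    SmoothTwo (lambdaMinusPart J α) :=
  (hα.add (hα.comp hJ smEnd_id hJ)).const_smul (1 / 2)

theorem dbar_complex_complex (hJ : IsKaehler J) (hc : SmEnd c) (x : M)
    (u v : TangentSpace I x) : dbar J c x (J x u) (J x v) = -dbar J c x u v := by
  have h : ∀ w w', dNabla c x (-w) (-w') = dNabla c x w w' := fun w w' => by
    have h1 := ((smoothTwo_dNabla hc).toBilin x).map_neg₂ w (-w')
    rw [((smoothTwo_dNabla hc).toBilin x w).map_neg w', neg_neg] at h1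
    exact h1
  simp only [dbar, lambdaPart, hJ.sq, h, ← smul_neg, neg_sub]

theorem dbar_complex_right (hJ : IsKaehler J) (hc : IsSymAnti J c) (x : M)
    (u v : TangentSpace I x) : dbar J c x u (J x v) = -J x (dbar J c x u v) := by
  have h1 := covEnd_anti hJ hc.smEnd hc.anti x
  have h : ∀ w w', covEnd c x w (-w') = -covEnd c x w w' := fun w w' =>
    ((smoothTwo_covEnd hc.smEnd).toBilin x w).map_neg w'
  have h' : ∀ w w', covEnd c x (-w) w' = -covEnd c x w w' := fun w w' =>
    ((smoothTwo_covEnd hc.smEnd).toBilin x).map_neg₂ w w'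
  simp only [dbar, lambdaPart, dNabla, hJ.sq, h, h', h1, map_smul, map_sub, map_neg,
    ← smul_neg]
  congr 1
  abel

theorem smoothTwo_dbar (hJ : IsKaehler J) (hc : SmEnd c) : SmoothTwo (dbar J c) :=
  smoothTwo_lambdaPart hJ.smooth.smEnd (smoothTwo_dNabla hc)

theorem smoothTwo_ksBracket (hJ : IsKaehler J) (ha : SmEnd a) (hb : SmEnd b) :
    SmoothTwo (ksBracket J a b) :=
  smoothTwo_lambdaMinusPart hJ.smooth.smEnd
    (smoothTwo_lambdaPart hJ.smooth.smEnd (smoothTwo_fnBracket ha hb))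

theorem innerTwo_ksBracket (hJ : IsKaehler J) (ha : SmEnd a) (hb : SmEnd b)
    (hc : IsSymAnti J c) (x : M) :
    innerTwo x (ksBracket J a b x) (dbar J c x) = innerTwo x (fnBracket a b x) (dbar J c x) := by
  have h := sum_inner_lambdaMinus (orthoFrame x) (hJ.isHermitian x)
    ((smoothTwo_fnBracket ha hb).toBilin x) ((smoothTwo_dbar hJ hc.smEnd).toBilin x)
    (fun u v => dbar_complex_complex hJ hc.smEnd x u v) (fun u v => dbar_complex_right hJ hc x u v)
  rw [innerTwo, innerTwo]
  exact congrArg _ h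

theorem fnBracket_swap (ha : SmEnd a) (hb : SmEnd b) (x : M) (u v : TangentSpace I x) :
    fnBracket a b x u v = -fnBracket a b x v u := by
  rw [fnBracket_eq ha hb, fnBracket_eq ha hb, ← smul_neg]
  simp only [dNabla, map_sub]
  congr 1
  abel

theorem innerTwo_fnBracket_sub (ha : SmEnd a) (hb : SmEnd b) (hc : SmEnd c) (x : M) :
    innerTwo x (fnBracket a b x) (dNabla c x) - 2 * innerTwo x (fnBracket a b x) (dbar J c x)
      = 1 / 2 * ∑ i, ∑ j, inner ℝ (bracketLin (a x : TangentSpace I x →ₗ[ℝ] TangentSpace I x)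
          (b x) ((smoothTwo_covEnd ha).toBilin x) ((smoothTwo_covEnd hb).toBilin x)
          (orthoFrame x i) (orthoFrame x j))
        (covEnd c x (J x (orthoFrame x i)) (J x (orthoFrame x j))) := by
  have e1 : ∀ u v, bracketLin (a x : TangentSpace I x →ₗ[ℝ] TangentSpace I x)
      (b x) ((smoothTwo_covEnd ha).toBilin x) ((smoothTwo_covEnd hb).toBilin x) u v
      = (2 : ℝ) • fnBracket a b x u v := by
    intro u v
    rw [fnBracket_eq ha hb, smul_smul]
    norm_num
    rfl
  have e2 : ∑ i, ∑ j, (inner ℝ (fnBracket a b x (orthoFrame x i) (orthoFrame x j))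
      (covEnd c x (J x (orthoFrame x j)) (J x (orthoFrame x i))) : ℝ)
      = -∑ i, ∑ j, inner ℝ (fnBracket a b x (orthoFrame x i) (orthoFrame x j))
      (covEnd c x (J x (orthoFrame x i)) (J x (orthoFrame x j))) := by
    rw [Finset.sum_comm]
    simp only [← Finset.sum_neg_distrib]
    refine Finset.sum_congr rfl fun k _ => Finset.sum_congr rfl fun j _ => ?_
    rw [fnBracket_swap ha hb, inner_neg_left]
  simp only [e1, innerTwo, dbar, lambdaPart, dNabla, inner_sub_right, real_inner_smul_left,
    real_inner_smul_right, Finset.sum_sub_distrib, ← Finset.mul_sum, e2]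
  ring

/-- The pointwise form of the identity: the terms missing from the products of the brackets with
`d_∇` are products of derivatives of the anti-commutators. -/
theorem cyclic_innerTwo (hJ : IsKaehler J) (ha : IsSymAnti J a) (hb : IsSymAnti J b)
    (hc : IsSymAnti J c) (x : M) :
    innerTwo x (fnBracket a b x) (dNabla c x) + innerTwo x (fnBracket b c x) (dNabla a x)
      + innerTwo x (fnBracket c a x) (dNabla b x)
    = 2 * (innerTwo x (ksBracket J a b x) (dbar J c x)
        + innerTwo x (ksBracket J b c x) (dbar J a x)
        + innerTwo x (ksBracket J c a x) (dbar J b x))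
      - (innerTwo x (fun u v => covEnd (antiComm a b) x v u) (covEnd c x)
        + innerTwo x (fun u v => covEnd (antiComm b c) x v u) (covEnd a x)
        + innerTwo x (fun u v => covEnd (antiComm c a) x v u) (covEnd b x)) := by
  have h := cyclic_sum_bracketLin (orthoFrame x) (hJ.isHermitian x) (ha.isSymAntiLin x)
    (hb.isSymAntiLin x) (hc.isSymAntiLin x) (A := (smoothTwo_covEnd ha.smEnd).toBilin x)
    (B := (smoothTwo_covEnd hb.smEnd).toBilin x) (C := (smoothTwo_covEnd hc.smEnd).toBilin x)
    (covEnd_anti hJ ha.smEnd ha.anti x) (covEnd_anti hJ hb.smEnd hb.anti x)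
    (covEnd_anti hJ hc.smEnd hc.anti x)
  have h1 := innerTwo_fnBracket_sub (J := J) ha.smEnd hb.smEnd hc.smEnd x
  have h2 := innerTwo_fnBracket_sub (J := J) hb.smEnd hc.smEnd ha.smEnd x
  have h3 := innerTwo_fnBracket_sub (J := J) hc.smEnd ha.smEnd hb.smEnd x
  have e : ∀ {a b c : EndField I M} (ha : SmEnd a) (hb : SmEnd b),
      innerTwo x (fun u v => covEnd (antiComm a b) x v u) (covEnd c x) = 1 / 2 * ∑ i, ∑ j,
      inner ℝ (antiCommLin (a x : TangentSpace I x →ₗ[ℝ] TangentSpace I x) (b x)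
        ((smoothTwo_covEnd ha).toBilin x) ((smoothTwo_covEnd hb).toBilin x)
        (orthoFrame x j) (orthoFrame x i)) (covEnd c x (orthoFrame x i) (orthoFrame x j)) := by
    intro a b c ha hb
    simp only [innerTwo, covEnd_antiComm ha hb]
    rfl
  rw [innerTwo_ksBracket hJ ha.smEnd hb.smEnd hc, innerTwo_ksBracket hJ hb.smEnd hc.smEnd ha,
    innerTwo_ksBracket hJ hc.smEnd ha.smEnd hb, e ha.smEnd hb.smEnd, e hb.smEnd hc.smEnd,
    e hc.smEnd ha.smEnd]
  simp only [SmoothTwo.toBilin_apply, ContinuousLinearMap.coe_coe] at h h1 h2 h3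
  linarith

end Pointwise
/-- The determinant as a continuous multilinear function of the rows. -/
def detMultilinear (ι : Type*) [Fintype ι] [DecidableEq ι] :
    ContinuousMultilinearMap ℝ (fun _ : ι => ι → ℝ) ℝ :=
  { (Matrix.detRowAlternating (R := ℝ) (n := ι)).toMultilinearMap with
    cont := Continuous.matrix_det (A := fun B : ι → ι → ℝ => (B : Matrix ι ι ℝ)) continuous_id }

/-- Jacobi's formula for the derivative of the determinant. -/
theorem hasDerivAt_det {ι : Type*} [Fintype ι] [DecidableEq ι] {A : ℝ → Matrix ι ι ℝ}
    {A' : Matrix ι ι ℝ} {t : ℝ} (h : ∀ i j, HasDerivAt (fun s => A s i j) (A' i j) t) :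
    HasDerivAt (fun s => (A s).det) ((A t).adjugate * A').trace t := by
  let D := detMultilinear ι
  have h1 : HasDerivAt (fun s => (A s : ι → ι → ℝ)) A' t :=
    hasDerivAt_pi.2 fun i => hasDerivAt_pi.2 fun j => h i j
  have h2 := (D.hasFDerivAt (A t)).comp_hasDerivAt t h1
  refine h2.congr_deriv ?_
  refine (ContinuousMultilinearMap.linearDeriv_apply D (A t) A').trans ?_
  have h3 : ∀ i, D (Function.update (A t) i (A' i)) = ((A t).transpose.adjugate.mulVec (A' i)) i := by
    intro i
    rw [← Matrix.cramer_eq_adjugate_mulVec, Matrix.cramer_transpose_apply]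
    rfl
  simp only [h3, Matrix.trace, Matrix.diag, Matrix.mul_apply, Matrix.mulVec, dotProduct,
    ← Matrix.adjugate_transpose, Matrix.transpose_apply]
  rw [Finset.sum_comm]

section CoordFields

variable {E : Type*} [NormedAddCommGroup E] [NormedSpace ℝ E] [FiniteDimensional ℝ E]
  {H : Type*} [TopologicalSpace H] {I : ModelWithCorners ℝ E H}
  {M : Type*} [TopologicalSpace M] [ChartedSpace H M] [IsManifold I ∞ M]
  {x₀ p : M}

/-- A constant vector field on a vector space. -/
def constField (v : E) : VecField 𝓘(ℝ, E) E := fun _ => v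

variable (I) in
/-- The coordinate vector field of the chart at `x₀` in the direction `v`. -/
noncomputable def coordField (x₀ : M) (v : E) : VecField I M :=
  mpullback I 𝓘(ℝ, E) (extChartAt I x₀) (constField v)

/-- The derivative of the chart at `x₀`. -/
noncomputable def chartDiff (x₀ p : M) : TangentSpace I p →L[ℝ] E :=
  mfderiv I 𝓘(ℝ, E) (extChartAt I x₀) p

theorem smAt_const (v : E) (y : E) : SmAt (I := 𝓘(ℝ, E)) (constField v) y :=
  contMDiffAt_vectorSpace_iff_contDiffAt.2 contDiffAt_const

theorem contMDiffAt_extChartAt_source (hp : p ∈ (extChartAt I x₀).source) :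
    CMDiffAt ∞ (extChartAt I x₀) p :=
  contMDiffAt_extChartAt' (by rwa [extChartAt_source] at hp)

theorem chartDiff_coordField (hp : p ∈ (extChartAt I x₀).source) (v : E) :
    chartDiff x₀ p (coordField I x₀ v p) = v :=
  (isInvertible_mfderiv_extChartAt hp).self_apply_inverse v

theorem coordField_chartDiff (hp : p ∈ (extChartAt I x₀).source) (u : TangentSpace I p) :
    coordField I x₀ (chartDiff x₀ p u) p = u :=
  (isInvertible_mfderiv_extChartAt hp).inverse_apply_self u

theorem smAt_coordField (hp : p ∈ (extChartAt I x₀).source) (v : E) :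
    SmAt (coordField I x₀ v) p :=
  ContMDiffAt.mpullback_vectorField_preimage (n := ∞) (smAt_const v _)
    (contMDiffAt_extChartAt_source hp) (isInvertible_mfderiv_extChartAt hp) (by simp)

theorem coordField_bracket (hp : p ∈ (extChartAt I x₀).source) (v w : E) :
    mlieBracket I (coordField I x₀ v) (coordField I x₀ w) p = 0 := by
  have hI2 : IsManifold I (minSmoothness ℝ 2) M :=
    IsManifold.of_le (n := ∞) (by simp only [minSmoothness_of_isRCLikeNormedField]; norm_cast)
  have h := mpullback_mlieBracket (n := ∞) (I := I) (I' := 𝓘(ℝ, E)) (f := extChartAt I x₀)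
    (smAt_const v _).mdiff (smAt_const w _).mdiff (contMDiffAt_extChartAt_source hp)
    (by simp only [minSmoothness_of_isRCLikeNormedField]; norm_cast)
  have h1 : mlieBracket 𝓘(ℝ, E) (constField v) (constField w) = 0 := by
    rw [← mlieBracketWithin_univ, mlieBracketWithin_eq_lieBracketWithin]
    funext y
    have e : ∀ u : E, fderivWithin ℝ (constField u : E → E) Set.univ y = 0 := fun u =>
      (hasFDerivWithinAt_const u y Set.univ).fderivWithin uniqueDiffWithinAt_univ
    simp only [lieBracketWithin]
    exact (congrArg₂ _ (DFunLike.congr_fun (e w) _) (DFunLike.congr_fun (e v) _)).trans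
      (sub_zero _)
  rw [coordField, coordField, ← h, h1, mpullback_zero]
  rfl

/-- The tangent spaces of a chart domain are identified with the model space. -/
noncomputable def chartEquiv (hp : p ∈ (extChartAt I x₀).source) : TangentSpace I p ≃ₗ[ℝ] E :=
  { toFun := chartDiff (I := I) x₀ p
    map_add' := map_add _
    map_smul' := map_smul _
    invFun := fun v => coordField I x₀ v p
    left_inv := coordField_chartDiff hp
    right_inv := chartDiff_coordField hp }

theorem chartEquiv_symm_apply (hp : p ∈ (extChartAt I x₀).source) (v : E) :
    (chartEquiv hp).symm v = coordField I x₀ v p := rfl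

/-- The basis of coordinate vectors. -/
noncomputable def coordBasis {ι : Type*} (b : Module.Basis ι ℝ E)
    (hp : p ∈ (extChartAt I x₀).source) : Module.Basis ι ℝ (TangentSpace I p) :=
  b.map (chartEquiv hp).symm

theorem coordBasis_apply {ι : Type*} (b : Module.Basis ι ℝ E)
    (hp : p ∈ (extChartAt I x₀).source) (i : ι) :
    coordBasis b hp i = coordField I x₀ (b i) p := by
  rw [coordBasis, Module.Basis.map_apply, chartEquiv_symm_apply]

/-- The coefficient of a vector field with respect to a coordinate field. -/
noncomputable def coordCoeff {ι : Type*} (b : Module.Basis ι ℝ E) (x₀ : M) (X : VecField I M)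
    (i : ι) (p : M) : ℝ :=
  b.coord i (chartDiff x₀ p (X p))

theorem sum_coordCoeff {ι : Type*} [Fintype ι] (b : Module.Basis ι ℝ E) (X : VecField I M)
    (hp : p ∈ (extChartAt I x₀).source) :
    ∑ i, coordCoeff b x₀ X i p • coordField I x₀ (b i) p = X p := by
  simp only [← chartEquiv_symm_apply hp, ← map_smul]
  rw [← map_sum]
  simp only [coordCoeff, Module.Basis.coord_apply]
  rw [b.sum_repr, chartEquiv_symm_apply, coordField_chartDiff hp]

theorem fnAt_coordCoeff {ι : Type*} (b : Module.Basis ι ℝ E) {X : VecField I M}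
    (hp : p ∈ (extChartAt I x₀).source) (hX : SmAt X p) (i : ι) :
    FnAt I (coordCoeff b x₀ X i) p := by
  let L : E →L[ℝ] ℝ := (b.coord i).toContinuousLinearMap
  have h1 : ContMDiff 𝓘(ℝ, E) 𝓘(ℝ, ℝ) ∞ L := L.contMDiff
  have h2 : FnAt I (L ∘ extChartAt I x₀) p :=
    h1.contMDiffAt.comp p (contMDiffAt_extChartAt_source hp)
  refine (SmAt.mvfderiv h2 hX).congr_of_eventuallyEq ?_
  filter_upwards [extChartAt_source_mem_nhds' hp] with q hq
  have h3 : mfderiv 𝓘(ℝ, E) 𝓘(ℝ, ℝ) L (extChartAt I x₀ q) = L := mfderiv_eq_fderiv.trans L.fderiv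
  exact ((mfderiv_comp_apply (I' := 𝓘(ℝ, E)) q (h1.mdifferentiableAt (by simp))
    ((contMDiffAt_extChartAt_source hq).mdifferentiableAt (by simp)) (X q)).trans
    (DFunLike.congr_fun h3 _)).symm

variable [I.Boundaryless]

theorem mdifferentiableAt_chart_symm {y : E} (hy : y ∈ (extChartAt I x₀).target) :
    MDifferentiableAt 𝓘(ℝ, E) I (extChartAt I x₀).symm y := by
  have h := mdifferentiableWithinAt_extChartAt_symm (I := I) hy
  rwa [I.range_eq_univ, mdifferentiableWithinAt_univ] at h

theorem mfderiv_chart_symm {y : E} (hy : y ∈ (extChartAt I x₀).target) (v : E) :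
    mfderiv 𝓘(ℝ, E) I (extChartAt I x₀).symm y v
      = coordField I x₀ v ((extChartAt I x₀).symm y) := by
  have h := mfderiv_extChartAt_comp_mfderivWithin_extChartAt_symm (I := I) hy
  rw [I.range_eq_univ, mfderivWithin_univ] at h
  have h2 : chartDiff x₀ ((extChartAt I x₀).symm y)
      (mfderiv 𝓘(ℝ, E) I (extChartAt I x₀).symm y v) = v := DFunLike.congr_fun h v
  have h1 := coordField_chartDiff ((extChartAt I x₀).map_target hy)
    (mfderiv 𝓘(ℝ, E) I (extChartAt I x₀).symm y v)
  rw [h2] at h1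
  exact h1.symm

/-- Differentiation along coordinate lines. -/
theorem fderiv_comp_chart_symm {f : M → ℝ} {y : E} (hy : y ∈ (extChartAt I x₀).target)
    (hf : FnAt I f ((extChartAt I x₀).symm y)) (v : E) :
    fderiv ℝ (f ∘ (extChartAt I x₀).symm) y v
      = mvfderiv I f ((extChartAt I x₀).symm y)
        (coordField I x₀ v ((extChartAt I x₀).symm y)) := by
  rw [← mfderiv_eq_fderiv, ← mfderiv_chart_symm hy]
  exact mfderiv_comp_apply (I := 𝓘(ℝ, E)) (I' := I) y hf.mdiff (mdifferentiableAt_chart_symm hy) v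

theorem contDiffAt_comp_chart_symm {f : M → ℝ} {y : E} (hy : y ∈ (extChartAt I x₀).target)
    (hf : FnAt I f ((extChartAt I x₀).symm y)) :
    ContDiffAt ℝ ∞ (f ∘ (extChartAt I x₀).symm) y := by
  have h1 : ContMDiffAt 𝓘(ℝ, E) I ∞ (extChartAt I x₀).symm y := by
    have h := (contMDiffOn_extChartAt_symm (I := I) (n := ∞) x₀) y hy
    exact h.contMDiffAt ((isOpen_extChartAt_target x₀).mem_nhds hy)
  exact (hf.comp y h1).contDiffAt

end CoordFields
section LocalDivergence

variable {E : Type*} [NormedAddCommGroup E] [NormedSpace ℝ E] [FiniteDimensional ℝ E]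
  {H : Type*} [TopologicalSpace H] {I : ModelWithCorners ℝ E H}
  {M : Type*} [TopologicalSpace M] [ChartedSpace H M] [IsManifold I ∞ M]
  [RiemannianBundle (fun x : M => TangentSpace I x)]
  [IsContMDiffRiemannianBundle I ∞ E (fun x : M => TangentSpace I x)]
  {x x₀ p : M} {X Y : VecField I M} {ι : Type*}

theorem divField_eq_trace : divField X x
    = LinearMap.trace ℝ _ (leviCivita I M X x : TangentSpace I x →ₗ[ℝ] TangentSpace I x) := by
  rw [LinearMap.trace_eq_sum_inner _ (orthoFrame x), divField]
  exact Finset.sum_congr rfl fun i _ => real_inner_comm _ _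

theorem divField_congr (hX : SmAt X x) (h : ∀ᶠ p in 𝓝 x, Y p = X p) :
    divField Y x = divField X x := by
  simp only [divField, cov_congr hX h]

theorem divField_smul {f : M → ℝ} (hf : FnAt I f x) (hX : SmAt X x) :
    divField (f • X) x = mvfderiv I f x (X x) + f x * divField X x := by
  have h : X x = ∑ i, (inner ℝ (orthoFrame x i) (X x) : ℝ) • orthoFrame x i :=
    ((orthoFrame x).sum_repr' (X x)).symm
  have h2 : mvfderiv I f x (X x)
      = ∑ i, mvfderiv I f x (orthoFrame x i) * inner ℝ (X x) (orthoFrame x i) := by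
    conv_lhs => rw [h]
    rw [map_sum]
    refine Finset.sum_congr rfl fun i _ => ?_
    rw [map_smul, smul_eq_mul, mul_comm, real_inner_comm]
  simp only [divField, cov_smul hf hX, inner_add_left, real_inner_smul_left,
    Finset.sum_add_distrib, ← Finset.mul_sum, h2]
  ring

theorem divField_sum {s : Finset ι} {X : ι → VecField I M} (hX : ∀ i ∈ s, SmAt (X i) x) :
    divField (fun p => ∑ i ∈ s, X i p) x = ∑ i ∈ s, divField (X i) x := by
  simp only [divField, cov_sum hX, sum_apply, sum_inner]
  rw [Finset.sum_comm]

variable [Fintype ι] [DecidableEq ι]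

/-- The determinant of the Gram matrix of the coordinate fields. -/
noncomputable def gramDet (b : Module.Basis ι ℝ E) (x₀ p : M) : ℝ :=
  (Matrix.gram ℝ fun i => coordField I x₀ (b i) p).det

/-- The density of the Riemannian volume in a chart. -/
noncomputable def volDensity (b : Module.Basis ι ℝ E) (x₀ p : M) : ℝ :=
  √(gramDet (I := I) b x₀ p)

theorem gramDet_pos (b : Module.Basis ι ℝ E) (hp : p ∈ (extChartAt I x₀).source) :
    0 < gramDet (I := I) b x₀ p := by
  refine (Matrix.posDef_gram_of_linearIndependent ?_).det_pos
  have h := (coordBasis b hp).linearIndependent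
  simpa only [← coordBasis_apply b hp] using h

theorem fnAt_gramDet (b : Module.Basis ι ℝ E) (hp : p ∈ (extChartAt I x₀).source) :
    FnAt I (gramDet (I := I) b x₀) p := by
  have h1 : ContMDiffAt I 𝓘(ℝ, ι → ι → ℝ) ∞ (fun q i j =>
      (inner ℝ (coordField I x₀ (b i) q) (coordField I x₀ (b j) q) : ℝ)) p :=
    contMDiffAt_pi_space.2 fun i => contMDiffAt_pi_space.2 fun j =>
      (smAt_coordField hp _).inner (smAt_coordField hp _)
  exact ((detMultilinear ι).contDiff (n := ∞)).contMDiff.contMDiffAt.comp p h1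

theorem fnAt_volDensity (b : Module.Basis ι ℝ E) (hp : p ∈ (extChartAt I x₀).source) :
    FnAt I (volDensity (I := I) b x₀) p :=
  (Real.contDiffAt_sqrt (gramDet_pos b hp).ne').contMDiffAt.comp p (fnAt_gramDet b hp)

theorem mvfderiv_inner_coordField (hp : p ∈ (extChartAt I x₀).source) (u v w : E) :
    mvfderiv I (fun q => (inner ℝ (coordField I x₀ v q) (coordField I x₀ w q) : ℝ)) p
      (coordField I x₀ u p)
    = inner ℝ (leviCivita I M (coordField I x₀ u) p (coordField I x₀ v p)) (coordField I x₀ w p)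
      + inner ℝ (coordField I x₀ v p)
        (leviCivita I M (coordField I x₀ u) p (coordField I x₀ w p)) := by
  have h : ∀ v, leviCivita I M (coordField I x₀ v) p (coordField I x₀ u p)
      = leviCivita I M (coordField I x₀ u) p (coordField I x₀ v p) := by
    intro v
    have h1 := cov_bracket (smAt_coordField hp u) (smAt_coordField hp v)
    rw [coordField_bracket hp] at h1
    exact sub_eq_zero.1 h1
  rw [mvfderiv_inner (smAt_coordField hp v) (smAt_coordField hp w), h, h]

theorem trace_adjugate_gram {V : Type*} [NormedAddCommGroup V] [InnerProductSpace ℝ V]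
    (B : Module.Basis ι ℝ V) (T : V →ₗ[ℝ] V) :
    ((Matrix.gram ℝ B).adjugate * Matrix.of fun i j =>
      (inner ℝ (T (B i)) (B j) + inner ℝ (B i) (T (B j)) : ℝ)).trace
      = 2 * LinearMap.trace ℝ V T * (Matrix.gram ℝ B).det := by
  set G := Matrix.gram ℝ B
  set Γ := LinearMap.toMatrix B B T
  have hT : ∀ i, T (B i) = ∑ k, Γ k i • B k := fun i => by
    simp only [Γ, LinearMap.toMatrix_apply]
    exact (B.sum_repr _).symm
  have h : (Matrix.of fun i j => (inner ℝ (T (B i)) (B j) + inner ℝ (B i) (T (B j)) : ℝ))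
      = Γ.transpose * G + G * Γ := by
    ext i j
    simp only [hT, sum_inner, inner_sum, real_inner_smul_left, real_inner_smul_right,
      Matrix.of_apply, Matrix.add_apply, Matrix.mul_apply, Matrix.transpose_apply, G,
      Matrix.gram_apply]
    congr 1
    exact Finset.sum_congr rfl fun k _ => mul_comm _ _
  rw [h, Matrix.mul_add, Matrix.trace_add, ← Matrix.mul_assoc, Matrix.trace_mul_comm,
    ← Matrix.mul_assoc, ← Matrix.mul_assoc, Matrix.mul_adjugate, Matrix.adjugate_mul,
    LinearMap.trace_eq_matrix_trace ℝ B]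
  simp only [Matrix.smul_mul, Matrix.one_mul, Matrix.trace_smul, Matrix.trace_transpose,
    smul_eq_mul]
  ring

variable [I.Boundaryless]

theorem hasDerivAt_chart_line {f : M → ℝ} {y : E} (hy : y ∈ (extChartAt I x₀).target)
    (hf : FnAt I f ((extChartAt I x₀).symm y)) (v : E) :
    HasDerivAt (fun s : ℝ => f ((extChartAt I x₀).symm (y + s • v)))
      (mvfderiv I f ((extChartAt I x₀).symm y)
        (coordField I x₀ v ((extChartAt I x₀).symm y))) 0 := by
  have h1 := ((contDiffAt_comp_chart_symm hy hf).differentiableAt (by simp)).hasFDerivAt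
  have h2 : HasDerivAt (fun s : ℝ => y + s • v) v 0 := by
    simpa using ((hasDerivAt_id (0 : ℝ)).smul_const v).const_add y
  rw [← fderiv_comp_chart_symm hy hf]
  have h3 : y = y + (0 : ℝ) • v := by simp
  rw [h3] at h1
  have h4 := h1.comp_hasDerivAt (0 : ℝ) h2
  rwa [← h3] at h4

/-- The divergence of the coordinate fields is the logarithmic derivative of the density. -/
theorem mvfderiv_volDensity (b : Module.Basis ι ℝ E) {y : E} (hy : y ∈ (extChartAt I x₀).target)
    (v : E) :
    mvfderiv I (volDensity (I := I) b x₀) ((extChartAt I x₀).symm y)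
        (coordField I x₀ v ((extChartAt I x₀).symm y))
      = divField (coordField I x₀ v) ((extChartAt I x₀).symm y)
        * volDensity (I := I) b x₀ ((extChartAt I x₀).symm y) := by
  have hp := (extChartAt I x₀).map_target hy
  have h1 := hasDerivAt_chart_line hy (fnAt_volDensity b hp) v
  have h2 : HasDerivAt (fun s : ℝ => gramDet (I := I) b x₀ ((extChartAt I x₀).symm (y + s • v)))
      _ 0 := hasDerivAt_det fun i j => hasDerivAt_chart_line hy
        ((smAt_coordField hp (b i)).inner (smAt_coordField hp (b j))) v
  have h3 := trace_adjugate_gram (coordBasis b hp)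
    (leviCivita I M (coordField I x₀ v) ((extChartAt I x₀).symm y) : _ →ₗ[ℝ] _)
  have h0 := gramDet_pos b hp
  have hs : y + (0 : ℝ) • v = y := by simp
  have h4 := h2.sqrt (by rw [hs]; exact h0.ne')
  rw [h1.unique h4, hs]
  simp only [mvfderiv_inner_coordField hp]
  simp only [funext (coordBasis_apply b hp), coordBasis_apply, ContinuousLinearMap.coe_coe,
    ← divField_eq_trace] at h3
  have h5 := h3.trans (rfl : _ = 2 * divField (coordField I x₀ v) ((extChartAt I x₀).symm y)
    * gramDet (I := I) b x₀ ((extChartAt I x₀).symm y))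
  have h6 : ∀ g d c : ℝ, 0 < g → c = 2 * d * g → c / (2 * √g) = d * √g := by
    intro g d c hg hc
    have := Real.sqrt_pos.2 hg
    rw [hc, div_eq_iff (by positivity)]
    have := Real.mul_self_sqrt hg.le
    linear_combination (-2 * d) * this
  exact h6 _ _ _ h0 h5

/-- The coordinate expression of the divergence. -/
theorem divField_mul_volDensity (b : Module.Basis ι ℝ E) {y : E}
    (hy : y ∈ (extChartAt I x₀).target) (hX : SmAt X ((extChartAt I x₀).symm y)) :
    divField X ((extChartAt I x₀).symm y) * volDensity (I := I) b x₀ ((extChartAt I x₀).symm y)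
      = ∑ i, fderiv ℝ ((fun p => coordCoeff b x₀ X i p * volDensity (I := I) b x₀ p)
          ∘ (extChartAt I x₀).symm) y (b i) := by
  have hp := (extChartAt I x₀).map_target hy
  have hw := fnAt_coordCoeff b hp hX
  have hd := fnAt_volDensity b hp
  have hc := fun v => smAt_coordField hp v
  have h1 : divField X ((extChartAt I x₀).symm y)
      = ∑ i, divField (coordCoeff b x₀ X i • coordField I x₀ (b i)) ((extChartAt I x₀).symm y) := by
    rw [← divField_sum fun i _ => (hw i).smul (hc (b i))]
    refine (divField_congr hX ?_).symm
    filter_upwards [extChartAt_source_mem_nhds' hp] with q hq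
    exact sum_coordCoeff b X hq
  rw [h1, Finset.sum_mul]
  refine Finset.sum_congr rfl fun i _ => ?_
  have hm : FnAt I (fun p => coordCoeff b x₀ X i p * volDensity (I := I) b x₀ p) _ := (hw i).mul hd
  rw [fderiv_comp_chart_symm hy hm, divField_smul (hw i) (hc (b i)),
    mvfderiv_fun_mul (hw i).mdiff hd.mdiff]
  simp only [add_apply, smul_apply, smul_eq_mul, mvfderiv_volDensity b hy]
  ring

end LocalDivergence
section Transition

variable {E : Type*} [NormedAddCommGroup E] [NormedSpace ℝ E] [FiniteDimensional ℝ E]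
  {H : Type*} [TopologicalSpace H] {I : ModelWithCorners ℝ E H} [I.Boundaryless]
  {M : Type*} [TopologicalSpace M] [ChartedSpace H M] [IsManifold I ∞ M]
  [RiemannianBundle (fun x : M => TangentSpace I x)]
  {x₀ x₁ : M} {ι : Type*} [Fintype ι] [DecidableEq ι]

/-- The derivative of a transition map. -/
noncomputable def transitionDiff (I : ModelWithCorners ℝ E H) [IsManifold I ∞ M] (x₀ x₁ : M)
    (y : E) : E →L[ℝ] E :=
  (chartDiff (I := I) x₁ ((extChartAt I x₀).symm y)).comp
    (mfderiv 𝓘(ℝ, E) I (extChartAt I x₀).symm y)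

theorem hasFDerivAt_transition {y : E} (hy : y ∈ (extChartAt I x₀).target)
    (hy' : (extChartAt I x₀).symm y ∈ (extChartAt I x₁).source) :
    HasFDerivAt (extChartAt I x₁ ∘ (extChartAt I x₀).symm) (transitionDiff I x₀ x₁ y) y :=
  hasMFDerivAt_iff_hasFDerivAt.1
    ((((contMDiffAt_extChartAt_source hy').mdifferentiableAt (by simp)).hasMFDerivAt).comp y
      (mdifferentiableAt_chart_symm hy).hasMFDerivAt)

theorem coordField_transition {y : E} (hy : y ∈ (extChartAt I x₀).target)
    (hy' : (extChartAt I x₀).symm y ∈ (extChartAt I x₁).source) (v : E) :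
    coordField I x₀ v ((extChartAt I x₀).symm y)
      = coordField I x₁ (transitionDiff I x₀ x₁ y v) ((extChartAt I x₀).symm y) := by
  rw [← mfderiv_chart_symm hy]
  exact (coordField_chartDiff hy' _).symm

/-- Transformation rule of the Riemannian density. -/
theorem volDensity_transition (b : Module.Basis ι ℝ E) {y : E}
    (hy : y ∈ (extChartAt I x₀).target)
    (hy' : (extChartAt I x₀).symm y ∈ (extChartAt I x₁).source) :
    volDensity (I := I) b x₀ ((extChartAt I x₀).symm y) = |(transitionDiff I x₀ x₁ y).det|
      * volDensity (I := I) b x₁ ((extChartAt I x₀).symm y) := by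
  set T := transitionDiff I x₀ x₁ y with hTdef
  set Γ := LinearMap.toMatrix b b (T : E →ₗ[ℝ] E) with hΓ
  have hdet : T.det = Γ.det := (LinearMap.det_toMatrix b (T : E →ₗ[ℝ] E)).symm
  have hT : ∀ i, T (b i) = ∑ k, Γ k i • b k := fun i => by
    simp only [hΓ, LinearMap.toMatrix_apply]
    exact (b.sum_repr _).symm
  have hc : ∀ i, coordField I x₀ (b i) ((extChartAt I x₀).symm y)
      = ∑ k, Γ k i • coordField I x₁ (b k) ((extChartAt I x₀).symm y) := by
    intro i
    rw [coordField_transition hy hy', ← hTdef, hT]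
    simp only [← chartEquiv_symm_apply hy', map_sum, map_smul]
  have hg : Matrix.gram ℝ (fun i => coordField I x₀ (b i) ((extChartAt I x₀).symm y))
      = Γ.transpose * Matrix.gram ℝ (fun i => coordField I x₁ (b i) ((extChartAt I x₀).symm y))
        * Γ := by
    ext i j
    simp only [Matrix.gram_apply, hc, sum_inner, inner_sum, real_inner_smul_left,
      real_inner_smul_right, Matrix.mul_apply, Matrix.transpose_apply, Finset.sum_mul]
    exact Finset.sum_congr rfl fun k _ => Finset.sum_congr rfl fun l _ => by ring
  rw [volDensity, volDensity, gramDet, gramDet, hg, Matrix.det_mul, Matrix.det_mul,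
    Matrix.det_transpose, hdet, ← Real.sqrt_sq_eq_abs, ← Real.sqrt_mul (sq_nonneg _)]
  congr 1
  ring

end Transition

section Measure

variable {n : ℕ} {M : Type*} [TopologicalSpace M] [ChartedSpace (EuclideanSpace ℝ (Fin n)) M]
  [IsManifold (𝓡 n) ∞ M] [RiemannianBundle (fun x : M => TangentSpace (𝓡 n) x)]
  [IsContMDiffRiemannianBundle (𝓡 n) ∞ (EuclideanSpace ℝ (Fin n))
    (fun x : M => TangentSpace (𝓡 n) x)]
  {x₀ x₁ : M}

/-- The standard basis of Euclidean space. -/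
noncomputable def stdBasis (n : ℕ) : Module.Basis (Fin n) ℝ (EuclideanSpace ℝ (Fin n)) :=
  (EuclideanSpace.basisFun (Fin n) ℝ).toBasis

theorem chartDensity_eq {y : EuclideanSpace ℝ (Fin n)} (hy : y ∈ (extChartAt (𝓡 n) x₀).target) :
    chartDensity x₀ y = volDensity (I := 𝓡 n) (stdBasis n) x₀ ((extChartAt (𝓡 n) x₀).symm y) := by
  simp only [chartDensity, volDensity, gramDet, Matrix.gram, mfderiv_chart_symm hy, stdBasis,
    OrthonormalBasis.coe_toBasis, EuclideanSpace.basisFun_apply]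

theorem continuousOn_chartDensity :
    ContinuousOn (chartDensity x₀) (extChartAt (𝓡 n) x₀).target := by
  refine ContinuousOn.congr (f := volDensity (I := 𝓡 n) (stdBasis n) x₀
    ∘ (extChartAt (𝓡 n) x₀).symm) (fun y hy => ?_) fun y hy => chartDensity_eq hy
  exact (contDiffAt_comp_chart_symm hy
    (fnAt_volDensity _ ((extChartAt _ x₀).map_target hy))).continuousAt.continuousWithinAt

variable [MeasurableSpace M] [BorelSpace M]

theorem aemeasurable_chart_symm : AEMeasurable (extChartAt (𝓡 n) x₀).symm
    (volume.restrict (extChartAt (𝓡 n) x₀).target) :=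
  (continuousOn_extChartAt_symm x₀).aemeasurable (isOpen_extChartAt_target x₀).measurableSet

theorem aemeasurable_chartDensity : AEMeasurable (fun y => ENNReal.ofReal (chartDensity (n := n) x₀ y))
    (volume.restrict (extChartAt (𝓡 n) x₀).target) :=
  (continuousOn_chartDensity.aemeasurable
    (isOpen_extChartAt_target x₀).measurableSet).ennreal_ofReal

theorem lintegral_chartVolume {f : M → ENNReal} (hf : Measurable f) :
    ∫⁻ p, f p ∂(chartVolume (n := n) x₀) = ∫⁻ y in (extChartAt (𝓡 n) x₀).target,
      ENNReal.ofReal (chartDensity (n := n) x₀ y) * f ((extChartAt (𝓡 n) x₀).symm y) := by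
  rw [chartVolume, lintegral_map' hf.aemeasurable
    (aemeasurable_chart_symm.mono_ac (withDensity_absolutelyContinuous _ _))]
  exact lintegral_withDensity_eq_lintegral_mul₀ aemeasurable_chartDensity
    (hf.comp_aemeasurable aemeasurable_chart_symm)

theorem chartVolume_apply {A : Set M} (hA : MeasurableSet A) :
    chartVolume (n := n) x₀ A = ∫⁻ y in (extChartAt (𝓡 n) x₀).target,
      ENNReal.ofReal (chartDensity (n := n) x₀ y) * A.indicator 1 ((extChartAt (𝓡 n) x₀).symm y) := by
  rw [← lintegral_chartVolume (measurable_one.indicator hA), lintegral_indicator_one hA]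

theorem isOpen_chart_source : IsOpen (extChartAt (𝓡 n) x₀).source := isOpen_extChartAt_source x₀

theorem chartVolume_compl_source : chartVolume (n := n) x₀ ((extChartAt (𝓡 n) x₀).source)ᶜ = 0 := by
  rw [chartVolume_apply isOpen_chart_source.measurableSet.compl]
  refine setLIntegral_eq_zero (isOpen_extChartAt_target x₀).measurableSet fun y hy => ?_
  have := (extChartAt (𝓡 n) x₀).map_target hy
  simp only [Set.indicator_of_notMem (Set.notMem_compl_iff.2 this), mul_zero, Pi.zero_apply]

/-- The domain of the transition map. -/
def overlap (x₀ x₁ : M) : Set (EuclideanSpace ℝ (Fin n)) :=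
  (extChartAt (𝓡 n) x₀).target ∩ (extChartAt (𝓡 n) x₀).symm ⁻¹' (extChartAt (𝓡 n) x₁).source

theorem isOpen_overlap : IsOpen (overlap (n := n) x₀ x₁) :=
  (continuousOn_extChartAt_symm x₀).isOpen_inter_preimage (isOpen_extChartAt_target x₀)
    isOpen_chart_source

theorem chartVolume_apply_overlap {A : Set M} (hA : MeasurableSet A)
    (h1 : A ⊆ (extChartAt (𝓡 n) x₁).source) :
    chartVolume (n := n) x₀ A = ∫⁻ y in overlap x₀ x₁,
      ENNReal.ofReal (chartDensity (n := n) x₀ y) * A.indicator 1 ((extChartAt (𝓡 n) x₀).symm y) := by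
  rw [chartVolume_apply hA, ← lintegral_indicator (isOpen_extChartAt_target x₀).measurableSet,
    ← lintegral_indicator isOpen_overlap.measurableSet]
  congr 1
  funext y
  by_cases hy : y ∈ overlap (n := n) x₀ x₁
  · rw [Set.indicator_of_mem hy, Set.indicator_of_mem hy.1]
  · rw [Set.indicator_of_notMem hy]
    by_cases hy' : y ∈ (extChartAt (𝓡 n) x₀).target
    · rw [Set.indicator_of_mem hy', Set.indicator_of_notMem (fun h => hy ⟨hy', h1 h⟩), mul_zero]
    · rw [Set.indicator_of_notMem hy']

theorem image_overlap : (extChartAt (𝓡 n) x₁ ∘ (extChartAt (𝓡 n) x₀).symm) '' overlap x₀ x₁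
    = overlap (n := n) x₁ x₀ := by
  ext z
  constructor
  · rintro ⟨y, ⟨hy, hy'⟩, rfl⟩
    refine ⟨(extChartAt (𝓡 n) x₁).map_source hy', ?_⟩
    simp only [Set.mem_preimage, Function.comp_apply]
    rw [(extChartAt (𝓡 n) x₁).left_inv hy']
    exact (extChartAt (𝓡 n) x₀).map_target hy
  · rintro ⟨hz, hz'⟩
    refine ⟨extChartAt (𝓡 n) x₀ ((extChartAt (𝓡 n) x₁).symm z),
      ⟨(extChartAt (𝓡 n) x₀).map_source hz', ?_⟩, ?_⟩
    · simp only [Set.mem_preimage]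
      rw [(extChartAt (𝓡 n) x₀).left_inv hz']
      exact (extChartAt (𝓡 n) x₁).map_target hz
    · simp only [Function.comp_apply]
      rw [(extChartAt (𝓡 n) x₀).left_inv hz', (extChartAt (𝓡 n) x₁).right_inv hz]

theorem injOn_transition :
    Set.InjOn (extChartAt (𝓡 n) x₁ ∘ (extChartAt (𝓡 n) x₀).symm) (overlap (n := n) x₀ x₁) :=
  ((extChartAt (𝓡 n) x₁).injOn).comp
    (((extChartAt (𝓡 n) x₀).symm.injOn).mono Set.inter_subset_left) fun _ hy => hy.2

/-- The volume measures of two charts agree on the overlap of their domains. -/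
theorem chartVolume_eq {A : Set M} (hA : MeasurableSet A)
    (h0 : A ⊆ (extChartAt (𝓡 n) x₀).source) (h1 : A ⊆ (extChartAt (𝓡 n) x₁).source) :
    chartVolume (n := n) x₀ A = chartVolume (n := n) x₁ A := by
  rw [chartVolume_apply_overlap hA h1, chartVolume_apply_overlap hA h0, ← image_overlap (x₀ := x₀) (x₁ := x₁),
    lintegral_image_eq_lintegral_abs_det_fderiv_mul volume isOpen_overlap.measurableSet
      (fun y hy => (hasFDerivAt_transition hy.1 hy.2).hasFDerivWithinAt) injOn_transition]
  refine setLIntegral_congr_fun isOpen_overlap.measurableSet fun y hy => ?_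
  have e : (extChartAt (𝓡 n) x₁).symm (extChartAt (𝓡 n) x₁ ((extChartAt (𝓡 n) x₀).symm y))
      = (extChartAt (𝓡 n) x₀).symm y := (extChartAt (𝓡 n) x₁).left_inv hy.2
  simp only [Function.comp_apply, e]
  rw [chartDensity_eq hy.1, chartDensity_eq ((extChartAt (𝓡 n) x₁).map_source hy.2), e,
    volDensity_transition (stdBasis n) hy.1 hy.2, ENNReal.ofReal_mul (abs_nonneg _), mul_assoc]

end Measure
section EuclideanDivergence

variable {E : Type*} [NormedAddCommGroup E] [NormedSpace ℝ E] [FiniteDimensional ℝ E]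
  [MeasurableSpace E] [BorelSpace E] {μ : Measure E} [μ.IsAddHaarMeasure]

theorem integral_fderiv_eq_zero {F : E → ℝ} (hF : ContDiff ℝ ∞ F) (hc : HasCompactSupport F)
    (v : E) : ∫ y, fderiv ℝ F y v ∂μ = 0 := by
  have h1 : Continuous fun y => fderiv ℝ F y v :=
    (hF.continuous_fderiv (by simp)).clm_apply continuous_const
  have h := integral_mul_fderiv_eq_neg_fderiv_mul_of_integrable (μ := μ) (f := fun _ : E => (1 : ℝ))
    (g := F) (v := v) (by simp) (by
      simpa using h1.integrable_of_hasCompactSupport (hc.fderiv_apply ℝ v))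
    (by simpa using hF.continuous.integrable_of_hasCompactSupport hc)
    (fun _ _ => differentiableAt_const _) fun y _ => hF.differentiable (by simp) y
  simpa using h

end EuclideanDivergence

section Measure

variable {n : ℕ} {M : Type*} [TopologicalSpace M] [ChartedSpace (EuclideanSpace ℝ (Fin n)) M]
  [IsManifold (𝓡 n) ∞ M] [RiemannianBundle (fun x : M => TangentSpace (𝓡 n) x)]
  [IsContMDiffRiemannianBundle (𝓡 n) ∞ (EuclideanSpace ℝ (Fin n))
    (fun x : M => TangentSpace (𝓡 n) x)]
  [MeasurableSpace M] [BorelSpace M] {x₀ : M}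

theorem measurableSet_chart_source : MeasurableSet (extChartAt (𝓡 n) x₀).source :=
  isOpen_chart_source.measurableSet

theorem chartVolume_inter_source (A : Set M) :
    chartVolume (n := n) x₀ (A ∩ (extChartAt (𝓡 n) x₀).source) = chartVolume (n := n) x₀ A :=
  measure_inter_conull chartVolume_compl_source

/-- The Riemannian volume is glued from the volume measures of the charts of a countable atlas. -/
theorem riemannianVolume_eq_sum {f : ℕ → M} (hf : ⋃ i, (extChartAt (𝓡 n) (f i)).source = Set.univ) :
    riemannianVolume n M = Measure.sum fun i => (chartVolume (n := n) (f i)).restrict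
      (disjointed (fun i => (extChartAt (𝓡 n) (f i)).source) i) := by
  set D := disjointed (fun i => (extChartAt (𝓡 n) (f i)).source) with hD
  have hm : ∀ i, MeasurableSet (D i) := MeasurableSet.disjointed fun i => measurableSet_chart_source
  have hd : Pairwise (Function.onFun Disjoint D) := disjoint_disjointed _
  have hu : ⋃ i, D i = Set.univ := by rw [hD, iUnion_disjointed, hf]
  have hs : ∀ i, D i ⊆ (extChartAt (𝓡 n) (f i)).source := fun i => disjointed_subset _ i
  have key : ∀ (μ : Measure M), μ = Measure.sum fun i => μ.restrict (D i) := fun μ => by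
    rw [← Measure.restrict_iUnion hd hm, hu, Measure.restrict_univ]
  refine le_antisymm (iSup_le fun x => Measure.le_iff.2 fun A hA => ?_) ?_
  · conv_lhs => rw [key (chartVolume x)]
    rw [Measure.sum_apply _ hA, Measure.sum_apply _ hA]
    refine ENNReal.tsum_le_tsum fun i => ?_
    rw [Measure.restrict_apply hA, Measure.restrict_apply hA, ← chartVolume_inter_source,
      chartVolume_eq ((hA.inter (hm i)).inter measurableSet_chart_source) Set.inter_subset_right
        (x₁ := f i) (fun p hp => hs i hp.1.2)]
    exact measure_mono Set.inter_subset_left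
  · conv_rhs => rw [key (riemannianVolume n M)]
    refine Measure.le_iff.2 fun A hA => ?_
    rw [Measure.sum_apply _ hA, Measure.sum_apply _ hA]
    refine ENNReal.tsum_le_tsum fun i => ?_
    rw [Measure.restrict_apply hA, Measure.restrict_apply hA]
    exact le_iSup (fun x : M => chartVolume (n := n) x) (f i) _

variable [CompactSpace M]

variable (n M) in
theorem exists_countable_atlas [Nonempty M] :
    ∃ f : ℕ → M, ⋃ i, (extChartAt (𝓡 n) (f i)).source = Set.univ := by
  obtain ⟨t, ht⟩ := CompactSpace.elim_nhds_subcover (fun x : M => (extChartAt (𝓡 n) x).source)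
    fun x => extChartAt_source_mem_nhds x
  have hne : (t : Set M).Nonempty := by
    by_contra h
    rw [Set.not_nonempty_iff_eq_empty, Finset.coe_eq_empty] at h
    subst h
    simp only [Finset.notMem_empty, Set.iUnion_of_empty, Set.iUnion_empty] at ht
    exact Set.empty_ne_univ ht
  obtain ⟨f, hf⟩ := t.countable_toSet.exists_eq_range hne
  refine ⟨f, Set.eq_univ_of_forall fun p => ?_⟩
  have hp : p ∈ ⋃ x ∈ t, (extChartAt (𝓡 n) x).source := by rw [ht]; trivial
  obtain ⟨x, hx, hpx⟩ := Set.mem_iUnion₂.1 hp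
  have hx' : x ∈ Set.range f := hf ▸ hx
  obtain ⟨i, rfl⟩ := hx'
  exact Set.mem_iUnion.2 ⟨i, hpx⟩

/-- The Riemannian volume restricts to the volume measure of each chart. -/
theorem restrict_riemannianVolume (x₀ : M) :
    (riemannianVolume n M).restrict (extChartAt (𝓡 n) x₀).source = chartVolume (n := n) x₀ := by
  have : Nonempty M := ⟨x₀⟩
  obtain ⟨f, hf⟩ := exists_countable_atlas n M
  set D := disjointed (fun i => (extChartAt (𝓡 n) (f i)).source) with hD
  have hm : ∀ i, MeasurableSet (D i) := MeasurableSet.disjointed fun i => measurableSet_chart_source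
  have hd : Pairwise (Function.onFun Disjoint D) := disjoint_disjointed _
  have hu : ⋃ i, D i = Set.univ := by rw [hD, iUnion_disjointed, hf]
  have hs : ∀ i, D i ⊆ (extChartAt (𝓡 n) (f i)).source := fun i => disjointed_subset _ i
  ext A hA
  rw [riemannianVolume_eq_sum hf, Measure.restrict_apply hA,
    Measure.sum_apply _ (hA.inter measurableSet_chart_source), ← chartVolume_inter_source A]
  have h : chartVolume (n := n) x₀
      = Measure.sum fun i => (chartVolume (n := n) x₀).restrict (D i) := by
    rw [← Measure.restrict_iUnion hd hm, hu, Measure.restrict_univ]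
  conv_rhs => rw [h]
  rw [Measure.sum_apply _ (hA.inter measurableSet_chart_source)]
  refine tsum_congr fun i => ?_
  have hAs := hA.inter (measurableSet_chart_source (n := n) (x₀ := x₀))
  rw [Measure.restrict_apply hAs, Measure.restrict_apply hAs]
  exact chartVolume_eq (hAs.inter (hm i)) (fun p hp => hs i hp.2) fun p hp => hp.1.2

instance isFiniteMeasure_riemannianVolume : IsFiniteMeasure (riemannianVolume n M) := by
  have : IsLocallyFiniteMeasure (riemannianVolume n M) := by
    refine ⟨fun x => ?_⟩
    obtain ⟨K, hK, hxK, hKt⟩ := exists_compact_subset (isOpen_extChartAt_target (I := 𝓡 n) x)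
      (mem_extChartAt_target x)
    set N := (extChartAt (𝓡 n) x).source ∩ extChartAt (𝓡 n) x ⁻¹' interior K with hN
    have hNo : IsOpen N := (continuousOn_extChartAt x).isOpen_inter_preimage
      isOpen_chart_source isOpen_interior
    refine ⟨N, hNo.mem_nhds ⟨mem_extChartAt_source x, hxK⟩, ?_⟩
    obtain ⟨C, hC⟩ := hK.exists_bound_of_continuousOn (continuousOn_chartDensity.mono hKt)
    have h1 : riemannianVolume n M N = chartVolume (n := n) x N := by
      rw [← restrict_riemannianVolume, Measure.restrict_apply hNo.measurableSet,
        Set.inter_eq_left.2 Set.inter_subset_left]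
    rw [h1, chartVolume_apply hNo.measurableSet,
      ← lintegral_indicator (isOpen_extChartAt_target x).measurableSet]
    calc _ ≤ ∫⁻ y, K.indicator (fun _ => ENNReal.ofReal C) y := by
            refine lintegral_mono fun y => ?_
            by_cases hy : y ∈ (extChartAt (𝓡 n) x).target
            · rw [Set.indicator_of_mem hy]
              by_cases hyN : (extChartAt (𝓡 n) x).symm y ∈ N
              · have hyK : y ∈ K := by
                  have := interior_subset hyN.2
                  rwa [(extChartAt (𝓡 n) x).right_inv hy] at this
                rw [Set.indicator_of_mem hyN, Set.indicator_of_mem hyK, Pi.one_apply, mul_one]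
                exact ENNReal.ofReal_le_ofReal ((le_abs_self _).trans (hC y hyK))
              · rw [Set.indicator_of_notMem hyN, mul_zero]
                exact zero_le
            · rw [Set.indicator_of_notMem hy]
              exact zero_le
      _ = ENNReal.ofReal C * volume K := by
            rw [lintegral_indicator hK.measurableSet, setLIntegral_const]
      _ < ⊤ := ENNReal.mul_lt_top ENNReal.ofReal_lt_top hK.measure_lt_top
  exact CompactSpace.isFiniteMeasure

theorem integral_riemannianVolume {f : M → ℝ} (hf : Continuous f)
    (h : ∀ p, p ∉ (extChartAt (𝓡 n) x₀).source → f p = 0) :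
    ∫ p, f p ∂(riemannianVolume n M) = ∫ y in (extChartAt (𝓡 n) x₀).target,
      chartDensity (n := n) x₀ y * f ((extChartAt (𝓡 n) x₀).symm y) := by
  rw [← setIntegral_eq_integral_of_forall_compl_eq_zero h, restrict_riemannianVolume, chartVolume,
    integral_map (aemeasurable_chart_symm.mono_ac (withDensity_absolutelyContinuous _ _))
      hf.measurable.aestronglyMeasurable]
  refine (integral_withDensity_eq_integral_toReal_smul₀ aemeasurable_chartDensity
    (Filter.Eventually.of_forall fun _ => ENNReal.ofReal_lt_top) _).trans ?_
  refine integral_congr_ae (Filter.Eventually.of_forall fun y => ?_)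
  simp only [smul_eq_mul]
  rw [ENNReal.toReal_ofReal (show 0 ≤ chartDensity (n := n) x₀ y from Real.sqrt_nonneg _)]

variable [T2Space M]

theorem integral_divField_of_support {X : VecField (𝓡 n) M} (hX : ∀ x, SmAt X x) {K : Set M}
    (hK : IsCompact K) (hKs : K ⊆ (extChartAt (𝓡 n) x₀).source) (h0 : ∀ p, p ∉ K → X p = 0) :
    ∫ p, divField X p ∂(riemannianVolume n M) = 0 := by
  have hd0 : ∀ p, p ∉ K → divField X p = 0 := by
    intro p hp
    have h : ∀ᶠ q in 𝓝 p, (0 : VecField (𝓡 n) M) q = X q := by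
      filter_upwards [hK.isClosed.isOpen_compl.mem_nhds hp] with q hq
      exact (h0 q hq).symm
    rw [← divField_congr (hX p) h]
    exact divField_sum (s := (∅ : Finset ℕ)) (X := fun _ => X) (by simp)
  have hc : Continuous (divField X) :=
    (show ContMDiff (𝓡 n) 𝓘(ℝ, ℝ) ∞ (divField X) from fun p => fnAt_divField (hX p)).continuous
  rw [integral_riemannianVolume (x₀ := x₀) hc fun p hp => hd0 p fun h => hp (hKs h)]
  set F : Fin n → EuclideanSpace ℝ (Fin n) → ℝ := fun i =>
    (extChartAt (𝓡 n) x₀).target.indicator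
      ((fun p => coordCoeff (stdBasis n) x₀ X i p * volDensity (I := 𝓡 n) (stdBasis n) x₀ p)
        ∘ (extChartAt (𝓡 n) x₀).symm) with hF
  have hFe : ∀ i y, y ∈ (extChartAt (𝓡 n) x₀).target → F i =ᶠ[𝓝 y]
      ((fun p => coordCoeff (stdBasis n) x₀ X i p * volDensity (I := 𝓡 n) (stdBasis n) x₀ p)
        ∘ (extChartAt (𝓡 n) x₀).symm) := fun i y hy => by
    filter_upwards [(isOpen_extChartAt_target x₀).mem_nhds hy] with z hz
    exact Set.indicator_of_mem hz _
  have hL : IsCompact (extChartAt (𝓡 n) x₀ '' K) :=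
    hK.image_of_continuousOn ((continuousOn_extChartAt x₀).mono hKs)
  have hF0 : ∀ i y, y ∉ extChartAt (𝓡 n) x₀ '' K → F i y = 0 := by
    intro i y hy
    by_cases hyt : y ∈ (extChartAt (𝓡 n) x₀).target
    · have : (extChartAt (𝓡 n) x₀).symm y ∉ K := fun h =>
        hy ⟨_, h, (extChartAt (𝓡 n) x₀).right_inv hyt⟩
      simp only [hF, Set.indicator_of_mem hyt, Function.comp_apply, coordCoeff, h0 _ this, map_zero,
        zero_mul]
    · exact Set.indicator_of_notMem hyt _
  have hFs : ∀ i, ContDiff ℝ ∞ (F i) := by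
    intro i
    refine contDiff_iff_contDiffAt.2 fun y => ?_
    by_cases hy : y ∈ (extChartAt (𝓡 n) x₀).target
    · have hp := (extChartAt (𝓡 n) x₀).map_target hy
      exact (contDiffAt_comp_chart_symm hy ((fnAt_coordCoeff (stdBasis n) hp (hX _) i).mul
        (fnAt_volDensity (stdBasis n) hp))).congr_of_eventuallyEq (hFe i y hy)
    · have hy' : y ∉ extChartAt (𝓡 n) x₀ '' K := by
        rintro ⟨p, hp, rfl⟩
        exact hy ((extChartAt (𝓡 n) x₀).map_source (hKs hp))
      refine (contDiffAt_const (c := (0 : ℝ))).congr_of_eventuallyEq ?_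
      filter_upwards [hL.isClosed.isOpen_compl.mem_nhds hy'] with z hz
      exact hF0 i z hz
  have hFc : ∀ i, HasCompactSupport (F i) := fun i => HasCompactSupport.intro hL (hF0 i)
  have hFd : ∀ i y, y ∉ (extChartAt (𝓡 n) x₀).target → fderiv ℝ (F i) y (stdBasis n i) = 0 := by
    intro i y hy
    have hy' : y ∉ extChartAt (𝓡 n) x₀ '' K := by
      rintro ⟨p, hp, rfl⟩
      exact hy ((extChartAt (𝓡 n) x₀).map_source (hKs hp))
    have : F i =ᶠ[𝓝 y] fun _ => 0 := by
      filter_upwards [hL.isClosed.isOpen_compl.mem_nhds hy'] with z hz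
      exact hF0 i z hz
    rw [this.fderiv_eq]
    simp
  have e : ∫ y in (extChartAt (𝓡 n) x₀).target, chartDensity (n := n) x₀ y
      * divField X ((extChartAt (𝓡 n) x₀).symm y)
      = ∫ y in (extChartAt (𝓡 n) x₀).target, ∑ i, fderiv ℝ (F i) y (stdBasis n i) := by
    refine setIntegral_congr_fun (isOpen_extChartAt_target x₀).measurableSet fun y hy => ?_
    rw [chartDensity_eq hy, mul_comm, divField_mul_volDensity _ hy (hX _)]
    exact Finset.sum_congr rfl fun i _ => by rw [(hFe i y hy).fderiv_eq]
  rw [e, setIntegral_eq_integral_of_forall_compl_eq_zero fun y hy =>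
    Finset.sum_eq_zero fun i _ => hFd i y hy, integral_finsetSum]
  · exact Finset.sum_eq_zero fun i _ => integral_fderiv_eq_zero (hFs i) (hFc i) _
  · intro i _
    exact (((hFs i).continuous_fderiv (by simp)).clm_apply
      continuous_const).integrable_of_hasCompactSupport ((hFc i).fderiv_apply ℝ _)

/-- The divergence theorem on a compact Riemannian manifold. -/
theorem integral_divField {X : VecField (𝓡 n) M} (hX : ∀ x, SmAt X x) :
    ∫ p, divField X p ∂(riemannianVolume n M) = 0 := by
  obtain ⟨f, hf⟩ := SmoothPartitionOfUnity.exists_isSubordinate_chartAt_source (𝓡 n) M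
  have hfin : {i | (Function.support (f i)).Nonempty}.Finite :=
    f.locallyFinite.finite_nonempty_of_compact
  set s := hfin.toFinset with hs
  have hsum : ∀ p, ∑ i ∈ s, f i p = 1 := by
    intro p
    rw [← f.sum_eq_one (Set.mem_univ p)]
    refine (finsum_eq_sum_of_support_subset _ fun i hi => ?_).symm
    simp only [hs, Set.Finite.coe_toFinset, Set.mem_ofPred_eq]
    exact ⟨p, hi⟩
  have hsm : ∀ i x, SmAt ((fun p => f i p) • X) x := fun i x =>
    FnAt.smul ((f i).contMDiff x) (hX x)
  have h : ∀ p, divField X p = ∑ i ∈ s, divField ((fun p => f i p) • X) p := by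
    intro p
    rw [← divField_sum fun i _ => hsm i p]
    refine divField_congr (SmAt.sum fun i _ => hsm i p) (Filter.Eventually.of_forall fun q => ?_)
    simp only [Pi.smul_apply']
    rw [← Finset.sum_smul, hsum, one_smul]
  simp only [h]
  rw [integral_finsetSum]
  · refine Finset.sum_eq_zero fun i _ => ?_
    refine integral_divField_of_support (x₀ := i) (hsm i) (K := tsupport (f i))
      (isClosed_tsupport _).isCompact ?_ fun p hp => ?_
    · rw [extChartAt_source]
      exact hf i
    · simp only [Pi.smul_apply', image_eq_zero_of_notMem_tsupport hp, zero_smul]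
  · intro i _
    have hc : Continuous (divField ((fun p => f i p) • X)) :=
      (show ContMDiff (𝓡 n) 𝓘(ℝ, ℝ) ∞ _ from fun p => fnAt_divField (hsm i p)).continuous
    exact hc.integrable_of_hasCompactSupport (HasCompactSupport.of_compactSpace _)

end Measure
section Global

variable {n : ℕ} {M : Type*} [TopologicalSpace M] [ChartedSpace (EuclideanSpace ℝ (Fin n)) M]
  [IsManifold (𝓡 n) ∞ M] [RiemannianBundle (fun x : M => TangentSpace (𝓡 n) x)]
  [IsContMDiffRiemannianBundle (𝓡 n) ∞ (EuclideanSpace ℝ (Fin n))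
    (fun x : M => TangentSpace (𝓡 n) x)]
  [MeasurableSpace M] [BorelSpace M] [CompactSpace M]

theorem integrable_of_fnAt {f : M → ℝ} (hf : ∀ x, FnAt (𝓡 n) f x) :
    Integrable f (riemannianVolume n M) :=
  (show ContMDiff (𝓡 n) 𝓘(ℝ, ℝ) ∞ f from hf).continuous.integrable_of_hasCompactSupport
    (HasCompactSupport.of_compactSpace _)

theorem integrable_innerTwo {α β : TwoTensor (𝓡 n) M} (hα : SmoothTwo α) (hβ : SmoothTwo β) :
    Integrable (fun x => innerTwo x (α x) (β x)) (riemannianVolume n M) :=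
  integrable_of_fnAt (fnAt_innerTwo hα hβ)

variable [T2Space M] {J a b c K : EndField (𝓡 n) M}

/-- The divergence on `2`-forms is the formal adjoint of `d_∇`. -/
theorem l2End_divTwo {α : TwoTensor (𝓡 n) M} (hα : SmoothTwo α)
    (hs : ∀ x u v, α x u v = -α x v u) (hc : SmEnd c) :
    l2End (divTwo α) (fun x => c x) = l2Two α (dNabla c) := by
  have hX : ∀ x, SmAt (trField fun x v w => adjTwo α x v (c x w)) x := fun x =>
    SmoothTwo.smAt_trField (hα.adj.comp (h := idEnd) (k := idEnd) smEnd_id smEnd_id hc) x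
  simp only [l2End, l2Two]
  simp only [fun x => innerEnd_divTwo hα hs hc x]
  rw [integral_sub (integrable_innerTwo hα (smoothTwo_dNabla hc))
    (integrable_of_fnAt fun x => fnAt_divField (hX x)), integral_divField hX, sub_zero]

/-- On a compact Kähler manifold, the derivatives in `⟨δK, δc⟩` may be interchanged. -/
theorem l2Vec_divEnd (hJ : IsKaehler J) (hc : IsSymAnti J c) (hK : SmEnd K)
    (hKs : ∀ (x : M) (u v : TangentSpace (𝓡 n) x),
      (inner ℝ (K x u) v : ℝ) = inner ℝ u (K x v))
    (hKJ : ∀ (x : M) (v : TangentSpace (𝓡 n) x), K x (J x v) = J x (K x v)) :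
    l2Vec (divEnd K) (divEnd c) = 2 * l2Two (fun x u v => covEnd K x v u) (covEnd c) := by
  have h : ∀ x, (inner ℝ (divEnd K x) (divEnd c x) : ℝ)
      = 2 * innerTwo x (fun u v => covEnd K x v u) (covEnd c x) - divField (ibpField K c) x := by
    intro x
    rw [divField_ibpField hJ hc hK hKs hKJ, innerTwo]
    ring
  have hX := smAt_ibpField hK hc.smEnd
  simp only [l2Vec, l2Two, h]
  rw [integral_sub ((integrable_innerTwo (smoothTwo_covEnd hK).swap
      (smoothTwo_covEnd hc.smEnd)).const_mul 2)
    (integrable_of_fnAt fun x => fnAt_divField (hX x)), integral_divField hX, sub_zero,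
    integral_const_mul]

theorem l2Vec_divEnd_antiComm (hJ : IsKaehler J) (ha : IsSymAnti J a) (hb : IsSymAnti J b)
    (hc : IsSymAnti J c) : l2Vec (divEnd (antiComm a b)) (divEnd c)
      = 2 * l2Two (fun x u v => covEnd (antiComm a b) x v u) (covEnd c) :=
  l2Vec_divEnd hJ hc (ha.smEnd.antiComm hb.smEnd) (ha.antiComm_symm hb) (ha.antiComm_complex hb)

theorem integral_add_add {X : Type*} [MeasurableSpace X] {μ : Measure X} {f g h : X → ℝ}
    (hf : Integrable f μ) (hg : Integrable g μ) (hh : Integrable h μ) :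
    ∫ x, (f x + g x + h x) ∂μ = ∫ x, f x ∂μ + ∫ x, g x ∂μ + ∫ x, h x ∂μ := by
  rw [← integral_add hf hg]
  exact integral_add (hf.add hg) hh

theorem cyclic_l2Two (hJ : IsKaehler J) (ha : IsSymAnti J a) (hb : IsSymAnti J b)
    (hc : IsSymAnti J c) :
    l2Two (fnBracket a b) (dNabla c) + l2Two (fnBracket b c) (dNabla a)
      + l2Two (fnBracket c a) (dNabla b)
    = 2 * (l2Two (ksBracket J a b) (dbar J c) + l2Two (ksBracket J b c) (dbar J a)
        + l2Two (ksBracket J c a) (dbar J b))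
      - (l2Two (fun x u v => covEnd (antiComm a b) x v u) (covEnd c)
        + l2Two (fun x u v => covEnd (antiComm b c) x v u) (covEnd a)
        + l2Two (fun x u v => covEnd (antiComm c a) x v u) (covEnd b)) := by
  have f1 : ∀ {a b c : EndField (𝓡 n) M}, IsSymAnti J a → IsSymAnti J b → IsSymAnti J c →
      Integrable (fun x => innerTwo x (fnBracket a b x) (dNabla c x)) (riemannianVolume n M) :=
    fun ha hb hc => integrable_innerTwo (smoothTwo_fnBracket ha.smEnd hb.smEnd)
      (smoothTwo_dNabla hc.smEnd)
  have f2 : ∀ {a b c : EndField (𝓡 n) M}, IsSymAnti J a → IsSymAnti J b → IsSymAnti J c →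
      Integrable (fun x => innerTwo x (ksBracket J a b x) (dbar J c x)) (riemannianVolume n M) :=
    fun ha hb hc => integrable_innerTwo (smoothTwo_ksBracket hJ ha.smEnd hb.smEnd)
      (smoothTwo_dbar hJ hc.smEnd)
  have f3 : ∀ {a b c : EndField (𝓡 n) M}, IsSymAnti J a → IsSymAnti J b → IsSymAnti J c →
      Integrable (fun x => innerTwo x (fun u v => covEnd (antiComm a b) x v u) (covEnd c x))
        (riemannianVolume n M) :=
    fun ha hb hc => integrable_innerTwo (smoothTwo_covEnd (ha.smEnd.antiComm hb.smEnd)).swap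
      (smoothTwo_covEnd hc.smEnd)
  simp only [l2Two]
  rw [← integral_add_add (f1 ha hb hc) (f1 hb hc ha) (f1 hc ha hb),
    ← integral_add_add (f2 ha hb hc) (f2 hb hc ha) (f2 hc ha hb),
    ← integral_add_add (f3 ha hb hc) (f3 hb hc ha) (f3 hc ha hb), ← integral_const_mul]
  exact (integral_congr_ae (Filter.Eventually.of_forall fun x => cyclic_innerTwo hJ ha hb hc x)).trans
    (integral_sub ((((f2 ha hb hc).add (f2 hb hc ha)).add (f2 hc ha hb)).const_mul 2)
      (((f3 ha hb hc).add (f3 hb hc ha)).add (f3 hc ha hb)))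

end Global
end Kaehler

theorem mainTheorem7 {m : ℕ} {M : Type*} [TopologicalSpace M] [T2Space M] [CompactSpace M]
    [ChartedSpace (EuclideanSpace ℝ (Fin (2 * m))) M] [IsManifold (𝓡 (2 * m)) ∞ M]
    [RiemannianBundle (fun x : M => TangentSpace (𝓡 (2 * m)) x)]
    [IsContMDiffRiemannianBundle (𝓡 (2 * m)) ∞ (EuclideanSpace ℝ (Fin (2 * m)))
      (fun x : M => TangentSpace (𝓡 (2 * m)) x)]
    [MeasurableSpace M] [BorelSpace M]
    (J : Kaehler.EndField (𝓡 (2 * m)) M) (hJ : Kaehler.IsKaehler J)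
    (h₁ h₂ h₃ : Kaehler.EndField (𝓡 (2 * m)) M)
    (hh₁ : Kaehler.IsSymAnti J h₁) (hh₂ : Kaehler.IsSymAnti J h₂) (hh₃ : Kaehler.IsSymAnti J h₃) :
    Kaehler.vForm h₁ h₂ h₃ =
      2 * Kaehler.cyclicSum (fun a b c => Kaehler.l2Two (Kaehler.ksBracket J a b) (Kaehler.dbar J c))
          h₁ h₂ h₃
        - 1 / 2 * Kaehler.cyclicSum (fun a b c =>
          Kaehler.l2Vec (Kaehler.divEnd (Kaehler.antiComm a b)) (Kaehler.divEnd c)) h₁ h₂ h₃ := by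
  simp only [Kaehler.vForm, Kaehler.cyclicSum]
  rw [Kaehler.l2End_divTwo (Kaehler.smoothTwo_fnBracket hh₁.smEnd hh₂.smEnd)
      (Kaehler.fnBracket_swap hh₁.smEnd hh₂.smEnd) hh₃.smEnd,
    Kaehler.l2End_divTwo (Kaehler.smoothTwo_fnBracket hh₂.smEnd hh₃.smEnd)
      (Kaehler.fnBracket_swap hh₂.smEnd hh₃.smEnd) hh₁.smEnd,
    Kaehler.l2End_divTwo (Kaehler.smoothTwo_fnBracket hh₃.smEnd hh₁.smEnd)
      (Kaehler.fnBracket_swap hh₃.smEnd hh₁.smEnd) hh₂.smEnd,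
    Kaehler.cyclic_l2Two hJ hh₁ hh₂ hh₃, Kaehler.l2Vec_divEnd_antiComm hJ hh₁ hh₂ hh₃,
    Kaehler.l2Vec_divEnd_antiComm hJ hh₂ hh₃ hh₁, Kaehler.l2Vec_divEnd_antiComm hJ hh₃ hh₁ hh₂]
  ring
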